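/- **Formulae.** Fix countably many propositional variables. A *linear formula* is built from $\top,\bot$, variables $x$ and negated variables $\neg x$ by $\wedge,\vee$, where each variable occurs at most once. A *linear inference* is a valid implication $\phi\to\psi$ between linear formulae; it is *on $n$ variables* if exactly $n$ variables occur in $\phi$ or $\psi$. $\sim_{\mathsf{ac}}$ is the least congruence on linear formulae containing associativity and commutativity of $\wedge,\vee$; $\sim_{\mathsf{acu}}$ is the least congruence containing in addition the unit laws $\phi\wedge\top\sim\phi$, $\phi\vee\bot\sim\phi$, $\phi\wedge\bot\sim\bot$, $\phi\vee\top\sim\top$ (and their commuted forms). For a set $S$ of linear inferences, $\to_S$ is the closure of $S$ under substitution and contexts; $\phi\to\psi$ is an *instance* of $S$ (without units) if $\phi\sim_{\mathsf{ac}}\phi'\to_S\psi'\sim_{\mathsf{ac}}\psi$ for some linear formulae $\phi',\psi'$, and is *derivable with units* from $S$ if it lies in the reflexive-transitive closure of $\sim_{\mathsf{acu}}$ together with the relation $\sim_{\mathsf{acu}}\cdot\to_S\cdot\sim_{\mathsf{acu}}$ on linear formulae. An inference is *trivial* if for one of its variables $x$ the implication $\phi[\top/x]\to\psi[\bot/x]$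 is valid; a linear inference $\phi\to\psi$ is *logically minimal* if every linear formula $\chi$ with $\phi\to\chi$ and $\chi\to\psi$ valid is logically equivalent to $\phi$ or to $\psi$. **The sets $M_n$.** For $n>4$, a set $X$ of $n$-variable linear inferences is *$n$-minimal* if it is minimal under inclusion such that $X$ together with all linear inferences on fewer than $n$ variables derives, with units, every linear inference on $n$ variables. $M_0=M_1=M_2=\emptyset$; $M_3$ consists of switch, $x\wedge(y\vee z)\to(x\wedge y)\vee z$; $M_4$ consists of medial, $(w\wedge x)\vee(y\wedge z)\to(w\vee y)\wedge(x\vee z)$; for $n>4$, $M_n$ is an $n$-minimal set of constant-free and negation-free inferences. All of these are understood up to $\sim_{\mathsf{ac}}$ and renaming of variables, applied to each inference. **The algorithm.** For a graph $R$ on $\{0,\dots,n-1\}$ let $N(R)=\sum 2^{\,x+y(y-1)/2}$, over the edges $xy$ with $x<y$; $R$ is *least* if $N(R)\le N(\rho(R))$ for every permutation $\rho$ of the nodes, and a pair $R\to S$ is *least* if $R$ is least and $N(S)\le N(\rho(S))$ for every $\rho$ with $\rho(R)=R$. Say that $R$ *implies* $S$ if each maximal clique of $R$ contains a maximal clique of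 $S$, and implies it *trivially* if, for some node $x$, each maximal clique $P$ of $R$ has a subset of $P\setminus\{x\}$ that is a maximal clique of $S$. Let $\Phi_R$ be the set of $P_4$-free graphs $S\neq R$ (on the same nodes) that $R$ implies non-trivially. A pair $R\to S$ is an *instance* of $A\to B$ (on nodes $0,\dots,k-1$) if there is a set $M$ of nodes that is a module of $R$ and of $S$, such that $R$ and $S$ agree on all pairs of nodes not both in $M$, and a partition of $M$ into non-empty parts $P_0,\dots,P_{k-1}$ such that, between $P_u$ and $P_v$ with $u\ne v$, the edges of $R$ and of $S$ are all present or all absent as $uv$ is an edge of $A$ resp. of $B$ or not, and $R$ and $S$ agree inside each part. Set $\mathsf{basis}(0)=\emptyset$ and $\mathsf{basis}(n+1)=\mathsf{basis}(n)\cup \mathcal S_{n+1}$, where $\mathcal S_{n+1}$ is found by generating the $P_4$-free graphs on $n+1$ nodes (adding a node at a time) and, for each least one $R$, collecting the least pairs $R\to S$ with $S\in\Phi_R\setminus\bigcup_{R'\in\Phi_R}\Phi_{R'}$ that are not an instance of an inference in $\mathsf{basis}(n)$. The *relation web* of a constant-free negation-free linear formula $\phi$ is the graph on its variables in which $x,y$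 are joined iff the connective at the root of the smallest subformula containing both is $\wedge$; $\phi$ is a *cograph decomposition* of $R$ if its relation web is $R$; and a cograph decomposition of $R\to S$ is an inference $\phi\to\psi$ with $\phi,\psi$ cograph decompositions of $R,S$. **Theorem.** Let $n\in\mathbb N$. The procedure $\mathsf{basis}(n)$ computes $M_n$, and indeed $M_m$ for all $m\le n$. Precisely: every inference in $\mathsf{basis}(n)$ has at most $n$ nodes, and for every $m\le n$: 1. $M_m$ exists, and a set $X$ of inferences is $M_m$ (up to $\sim_{\mathsf{ac}}$ and renaming) if and only if it consists of exactly one cograph decomposition, up to $\sim_{\mathsf{ac}}$ and renaming, of each $m$-node inference in $\mathsf{basis}(n)$. If $m>4$, then $M_m$ has moreover the least cardinality among all sets $Y$ of $m$-variable linear inferences that together with all linear inferences on fewer than $m$ variables derive, with units, every linear inference on $m$ variables. 2. The $m$-node inferences in $\mathsf{basis}(n)$ are exactly the least pairs $R\to S$ of distinct $P_4$-free graphs on $\{0,\dots,m-1\}$ that have a cograph decomposition $\phi\to\psi$ which is valid, non-trivial, logically minimal, and not an instance (without units) of the cograph decompositions of the inferences in $\mathsf{basis}(n)$ with fewer than $m$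 nodes. -/

import Mathlib

namespace LinearInference

/-! ## Formulae, linear formulae, Boolean semantics -/

/-- Propositional formulae in negation normal form; the variables are the natural numbers. -/
inductive Formula : Type
  | top : Formula
  | bot : Formula
  | var : ℕ → Formula
  | nvar : ℕ → Formula
  | and : Formula → Formula → Formula
  | or : Formula → Formula → Formula
  deriving DecidableEq

namespace Formula

/-- The set of variables that occur in a formula. -/
def vars : Formula → Finset ℕ
  | top => ∅
  | bot => ∅
  | var x => {x}
  | nvar x => {x}
  | and φ ψ => φ.vars ∪ ψ.vars
  | or φ ψ => φ.vars ∪ ψ.vars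

/-- `φ` is a linear formula (on the variable set `φ.vars`): every variable occurs at most once. -/
def Linear : Formula → Prop
  | top => True
  | bot => True
  | var _ => True
  | nvar _ => True
  | and φ ψ => φ.Linear ∧ ψ.Linear ∧ Disjoint φ.vars ψ.vars
  | or φ ψ => φ.Linear ∧ ψ.Linear ∧ Disjoint φ.vars ψ.vars

def ConstFree : Formula → Prop
  | top => False
  | bot => False
  | var _ => True
  | nvar _ => True
  | and φ ψ => φ.ConstFree ∧ ψ.ConstFree
  | or φ ψ => φ.ConstFree ∧ ψ.ConstFree

def NegFree : Formula → Prop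
  | top => True
  | bot => True
  | var _ => True
  | nvar _ => False
  | and φ ψ => φ.NegFree ∧ ψ.NegFree
  | or φ ψ => φ.NegFree ∧ ψ.NegFree

/-- The value of a formula under an assignment. -/
def eval (α : ℕ → Bool) : Formula → Bool
  | top => true
  | bot => false
  | var x => α x
  | nvar x => !(α x)
  | and φ ψ => φ.eval α && ψ.eval α
  | or φ ψ => φ.eval α || ψ.eval α

/-- Negation of an arbitrary formula, by De Morgan's laws. -/
def neg : Formula → Formula
  | top => bot
  | bot => top
  | var x => nvar x
  | nvar x => var x
  | and φ ψ => or φ.neg ψ.neg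
  | or φ ψ => and φ.neg ψ.neg

/-- Simultaneous substitution of formulae for variables. -/
def subst (σ : ℕ → Formula) : Formula → Formula
  | top => top
  | bot => bot
  | var x => σ x
  | nvar x => (σ x).neg
  | and φ ψ => and (φ.subst σ) (ψ.subst σ)
  | or φ ψ => or (φ.subst σ) (ψ.subst σ)

/-- Renaming of variables. -/
def rename (ρ : ℕ → ℕ) (φ : Formula) : Formula := φ.subst (fun x => var (ρ x))

/-- Substitution `φ[χ/x]` of `χ` for the single variable `x`. -/
def subst1 (φ : Formula) (x : ℕ) (χ : Formula) : Formula :=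
  φ.subst (Function.update var x χ)

/-- `φ → ψ` is a valid implication. -/
def Implies (φ ψ : Formula) : Prop := ∀ α : ℕ → Bool, φ.eval α = true → ψ.eval α = true

/-- `φ` and `ψ` are logically equivalent. -/
def LogEquiv (φ ψ : Formula) : Prop := ∀ α : ℕ → Bool, φ.eval α = ψ.eval α

/-- `φ.Edge x y`: the least common connective of `x` and `y` in the (linear) formula `φ` is `∧`.
This is the edge relation of the relation web of `φ`. -/
def Edge : Formula → ℕ → ℕ → Prop
  | top, _, _ => False
  | bot, _, _ => False
  | var _, _, _ => False
  | nvar _, _, _ => False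
  | and φ ψ, x, y => φ.Edge x y ∨ ψ.Edge x y ∨
      (x ∈ φ.vars ∧ y ∈ ψ.vars) ∨ (x ∈ ψ.vars ∧ y ∈ φ.vars)
  | or φ ψ, x, y => φ.Edge x y ∨ ψ.Edge x y

end Formula

open Formula

/-! ## Linear equations -/

/-- The smallest congruence on linear formulae that contains the instances (between linear
formulae) of the equations `E`. -/
inductive Cong (E : Formula → Formula → Prop) : Formula → Formula → Prop
  | ax {φ ψ : Formula} : E φ ψ → φ.Linear → ψ.Linear → Cong E φ ψ
  | refl {φ : Formula} : φ.Linear → Cong E φ φ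
  | symm {φ ψ : Formula} : Cong E φ ψ → Cong E ψ φ
  | trans {φ ψ χ : Formula} : Cong E φ ψ → Cong E ψ χ → Cong E φ χ
  | and_right {φ ψ : Formula} (χ : Formula) : Cong E φ ψ →
      (and φ χ).Linear → (and ψ χ).Linear → Cong E (and φ χ) (and ψ χ)
  | and_left {φ ψ : Formula} (χ : Formula) : Cong E φ ψ →
      (and χ φ).Linear → (and χ ψ).Linear → Cong E (and χ φ) (and χ ψ)
  | or_right {φ ψ : Formula} (χ : Formula) : Cong E φ ψ →
      (or φ χ).Linear → (or ψ χ).Linear → Cong E (or φ χ) (or ψ χ)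
  | or_left {φ ψ : Formula} (χ : Formula) : Cong E φ ψ →
      (or χ φ).Linear → (or χ ψ).Linear → Cong E (or χ φ) (or χ ψ)

/-- Associativity and commutativity of `∧` and `∨`. -/
inductive ACAxiom : Formula → Formula → Prop
  | or_comm (φ ψ : Formula) : ACAxiom (or φ ψ) (or ψ φ)
  | and_comm (φ ψ : Formula) : ACAxiom (and φ ψ) (and ψ φ)
  | and_assoc (φ ψ χ : Formula) : ACAxiom (and φ (and ψ χ)) (and (and φ ψ) χ)
  | or_assoc (φ ψ χ : Formula) : ACAxiom (or φ (or ψ χ)) (or (or φ ψ) χ)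

/-- The unit laws. -/
inductive UAxiom : Formula → Formula → Prop
  | and_top (φ : Formula) : UAxiom (and φ top) φ
  | top_and (φ : Formula) : UAxiom (and top φ) φ
  | or_bot (φ : Formula) : UAxiom (or φ bot) φ
  | bot_or (φ : Formula) : UAxiom (or bot φ) φ
  | and_bot (φ : Formula) : UAxiom (and φ bot) bot
  | bot_and (φ : Formula) : UAxiom (and bot φ) bot
  | or_top (φ : Formula) : UAxiom (or φ top) top
  | top_or (φ : Formula) : UAxiom (or top φ) top

/-- Equivalence modulo associativity and commutativity. -/
def AC : Formula → Formula → Prop := Cong ACAxiom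

/-- Equivalence modulo associativity, commutativity and the unit laws. -/
def ACU : Formula → Formula → Prop := Cong (fun φ ψ => ACAxiom φ ψ ∨ UAxiom φ ψ)

/-! ## Linear inferences and rewriting -/

/-- A pair of formulae, written `lhs → rhs`. -/
structure Inference : Type where
  lhs : Formula
  rhs : Formula
  deriving DecidableEq

namespace Inference

/-- A linear inference: a valid implication between linear formulae. -/
def IsLinear (r : Inference) : Prop := r.lhs.Linear ∧ r.rhs.Linear ∧ Implies r.lhs r.rhs

/-- The variables of an inference. -/
def vars (r : Inference) : Finset ℕ := r.lhs.vars ∪ r.rhs.vars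

def ConstFree (r : Inference) : Prop := r.lhs.ConstFree ∧ r.rhs.ConstFree

def NegFree (r : Inference) : Prop := r.lhs.NegFree ∧ r.rhs.NegFree

/-- `φ → ψ` is trivial at `x` if `φ[⊤/x] → ψ[⊥/x]` is valid. -/
def TrivialAt (r : Inference) (x : ℕ) : Prop :=
  Implies (r.lhs.subst1 x top) (r.rhs.subst1 x bot)

/-- An inference is trivial if it is trivial at one of its variables. -/
def Trivial (r : Inference) : Prop := ∃ x ∈ r.vars, r.TrivialAt x

/-- No linear formula lies logically strictly between the two sides. -/
def LogMinimal (r : Inference) : Prop :=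
  ∀ χ : Formula, χ.Linear → Implies r.lhs χ → Implies χ r.rhs →
    LogEquiv χ r.lhs ∨ LogEquiv χ r.rhs

/-- `r'` is a renaming of `r`, modulo associativity and commutativity. -/
def Variant (r r' : Inference) : Prop :=
  ∃ ρ : Equiv.Perm ℕ, AC (r.lhs.rename ρ) r'.lhs ∧ AC (r.rhs.rename ρ) r'.rhs

end Inference

/-- The term rewrite system generated by `S`: closure of `S` under substitutions and contexts. -/
inductive Rewrite (S : Set Inference) : Formula → Formula → Prop
  | rule {r : Inference} (σ : ℕ → Formula) : r ∈ S → Rewrite S (r.lhs.subst σ) (r.rhs.subst σ)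
  | and_right {φ ψ : Formula} (χ : Formula) : Rewrite S φ ψ → Rewrite S (and φ χ) (and ψ χ)
  | and_left {φ ψ : Formula} (χ : Formula) : Rewrite S φ ψ → Rewrite S (and χ φ) (and χ ψ)
  | or_right {φ ψ : Formula} (χ : Formula) : Rewrite S φ ψ → Rewrite S (or φ χ) (or ψ χ)
  | or_left {φ ψ : Formula} (χ : Formula) : Rewrite S φ ψ → Rewrite S (or χ φ) (or χ ψ)

/-- `φ → ψ` is an instance without units of an inference in `S`: one rewrite step between linear
formulae, modulo associativity and commutativity. -/
def Instance (S : Set Inference) (φ ψ : Formula) : Prop :=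
  ∃ φ' ψ' : Formula, AC φ φ' ∧ Rewrite S φ' ψ' ∧ AC ψ' ψ

/-- `φ → ψ` is an instance with units of an inference in `S`. (The relation `ACU` relates linear
formulae only, so both sides of the rewrite step are linear.) -/
def InstanceU (S : Set Inference) (φ ψ : Formula) : Prop :=
  ∃ φ' ψ' : Formula, ACU φ φ' ∧ Rewrite S φ' ψ' ∧ ACU ψ' ψ

/-- `φ → ψ` is `S`-derivable with units. -/
def DerivableU (S : Set Inference) : Formula → Formula → Prop :=
  Relation.ReflTransGen (fun φ ψ => InstanceU S φ ψ ∨ ACU φ ψ)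

/-! ## The sets `M_n` -/

/-- `L n`: all linear inferences on exactly `n` variables. -/
def L (n : ℕ) : Set Inference := {r | r.IsLinear ∧ r.vars.card = n}

/-- `LLt n`: all linear inferences on fewer than `n` variables. -/
def LLt (n : ℕ) : Set Inference := {r | r.IsLinear ∧ r.vars.card < n}

/-- `X` is a set of `n`-variable linear inferences which, together with all linear inferences on
fewer than `n` variables, derives (with units) every `n`-variable linear inference. -/
def Generates (n : ℕ) (X : Set Inference) : Prop :=
  X ⊆ L n ∧ ∀ r ∈ L n, DerivableU (X ∪ LLt n) r.lhs r.rhs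

/-- `X` is `n`-minimal: minimal, with respect to inclusion, with the property `Generates n`. -/
def NMinimal (n : ℕ) (X : Set Inference) : Prop := Minimal (Generates n) X

/-- Switch: `x ∧ (y ∨ z) → (x ∧ y) ∨ z`. -/
def switch : Inference :=
  ⟨and (var 0) (or (var 1) (var 2)), or (and (var 0) (var 1)) (var 2)⟩

/-- Medial: `(w ∧ x) ∨ (y ∧ z) → (w ∨ y) ∧ (x ∨ z)`. -/
def medial : Inference :=
  ⟨or (and (var 0) (var 1)) (and (var 2) (var 3)), and (or (var 0) (var 2)) (or (var 1) (var 3))⟩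

/-- `X` and `Y` are the same set of inferences up to associativity, commutativity and renaming of
variables (of each inference separately). -/
def SameUpToAC (X Y : Set Inference) : Prop :=
  ∃ e : X ≃ Y, ∀ r : X, Inference.Variant (r : Inference) (e r : Inference)

/-- `X` is (a version of) `M_n`; `M_n` is determined only up to associativity, commutativity and
renaming. -/
def IsM : ℕ → Set Inference → Prop
  | 0, X => X = ∅
  | 1, X => X = ∅
  | 2, X => X = ∅
  | 3, X => SameUpToAC X {switch}
  | 4, X => SameUpToAC X {medial}
  | n + 5, X => NMinimal (n + 5) X ∧ ∀ r ∈ X, r.ConstFree ∧ r.NegFree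

/-! ## Graphs on `{0, …, n-1}`, in executable form -/

/-- A simple undirected graph on `{0, …, n-1}`, given by its Boolean adjacency matrix. -/
structure Web (n : ℕ) : Type where
  adj : Fin n → Fin n → Bool
  symm : ∀ x y, adj x y = adj y x
  irrefl : ∀ x, adj x x = false
  deriving DecidableEq

namespace Web

variable {n : ℕ}

/-- No induced subgraph is isomorphic to the path `a - b - c - d`. (The pattern forces
`a`, `b`, `c`, `d` to be distinct.) -/
def P4Free (R : Web n) : Prop :=
  ∀ a b c d : Fin n, ¬ (R.adj a b = true ∧ R.adj b c = true ∧ R.adj c d = true ∧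
    R.adj a c = false ∧ R.adj b d = false ∧ R.adj a d = false)

instance (R : Web n) : Decidable R.P4Free := by unfold P4Free; infer_instance

/-- The graph with no nodes. -/
def empty : Web 0 := ⟨fun _ _ => false, fun _ _ => rfl, fun _ => rfl⟩

/-- Adds a new last node, with neighbourhood `N`. -/
def extend (R : Web n) (N : Finset (Fin n)) : Web (n + 1) where
  adj x y :=
    if hx : x.val < n then
      if hy : y.val < n then R.adj ⟨x.val, hx⟩ ⟨y.val, hy⟩ else decide (⟨x.val, hx⟩ ∈ N)
    else
      if hy : y.val < n then decide (⟨y.val, hy⟩ ∈ N) else false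
  symm x y := by
    by_cases hx : x.val < n <;> by_cases hy : y.val < n <;> simp [hx, hy, R.symm]
  irrefl x := by
    by_cases hx : x.val < n <;> simp [hx, R.irrefl]

/-- The graph `ρ(R)`, with an edge between `ρ x` and `ρ y` for each edge between `x` and `y`. -/
def map (ρ : Equiv.Perm (Fin n)) (R : Web n) : Web n where
  adj x y := R.adj (ρ.symm x) (ρ.symm y)
  symm _ _ := R.symm _ _
  irrefl _ := R.irrefl _

/-- The numerical representation: bit number `x + ∑ i < y, i` is set iff there is an edge between
`x` and `y`, for `x < y`. -/
def num (R : Web n) : ℕ :=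
  ∑ y : Fin n, ∑ x : Fin n,
    if x < y ∧ R.adj x y = true then 2 ^ (x.val + ∑ i ∈ Finset.range y.val, i) else 0

/-- `R` is least in its isomorphism class. -/
def IsLeast (R : Web n) : Prop := ∀ ρ : Equiv.Perm (Fin n), R.num ≤ (R.map ρ).num

instance (R : Web n) : Decidable R.IsLeast := by unfold IsLeast; infer_instance

/-- `R → S` is a least inference: `R` is least, and no automorphism of `R` makes `S` smaller. -/
def IsLeastPair (R S : Web n) : Prop :=
  R.IsLeast ∧ ∀ ρ : Equiv.Perm (Fin n), R.map ρ = R → S.num ≤ (S.map ρ).num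

instance (R S : Web n) : Decidable (IsLeastPair R S) := by unfold IsLeastPair; infer_instance

def IsClique (R : Web n) (P : Finset (Fin n)) : Prop :=
  ∀ x ∈ P, ∀ y ∈ P, x ≠ y → R.adj x y = true

instance (R : Web n) (P : Finset (Fin n)) : Decidable (R.IsClique P) := by
  unfold IsClique; infer_instance

end Web

/-- An inference between graphs with the same nodes, with its number of nodes. -/
abbrev GraphInference : Type := Σ n : ℕ, Web n × Web n

/-! ## The search algorithm

The definitions of this section are executable. -/

section Algorithm

variable {n : ℕ}

/-- Phase 1: all `P₄`-free graphs on `n` nodes, generated by adding nodes one at a time. -/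
def cographs : (n : ℕ) → Finset (Web n)
  | 0 => {Web.empty}
  | n + 1 => ((cographs n).biUnion
      (fun R => (Finset.univ : Finset (Finset (Fin n))).image R.extend)).filter
        (fun R => R.P4Free)

/-- Phase 2: the least webs. -/
def leastWebs (n : ℕ) : Finset (Web n) := (cographs n).filter (fun R => R.IsLeast)

/-- Phase 3: the maximal cliques of a graph. -/
def maxCliques (R : Web n) : Finset (Finset (Fin n)) :=
  Finset.univ.filter (fun P => R.IsClique P ∧ ∀ x, x ∉ P → ¬ R.IsClique (insert x P))

/-- Phase 4: the clique criterion for validity of `R → S`. -/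
def valid (R S : Web n) : Prop := ∀ P ∈ maxCliques R, ∃ Q ∈ maxCliques S, Q ⊆ P

instance (R S : Web n) : Decidable (valid R S) := by unfold valid; infer_instance

/-- Phase 5: the clique criterion for triviality of `R → S` at one of the nodes. -/
def triv (R S : Web n) : Prop :=
  ∃ x : Fin n, ∀ P ∈ maxCliques R, ∃ Q ∈ maxCliques S, Q ⊆ P.erase x

instance (R S : Web n) : Decidable (triv R S) := by unfold triv; infer_instance

/-- The webs distinct from `R` that `R` non-trivially implies. -/
def Phi (R : Web n) : Finset (Web n) :=
  (cographs n).filter (fun S => S ≠ R ∧ valid R S ∧ ¬ triv R S)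

/-- Phase 6: the webs `S` such that `R → S` is in addition logically minimal. -/
def logMin (R : Web n) : Finset (Web n) := Phi R \ (Phi R).biUnion Phi

/-- `M` is a module of `R`. -/
def IsModule (R : Web n) (M : Finset (Fin n)) : Prop :=
  ∀ x ∈ M, ∀ y ∈ M, ∀ z, z ∉ M → R.adj x z = R.adj y z

instance (R : Web n) (M : Finset (Fin n)) : Decidable (IsModule R M) := by
  unfold IsModule; infer_instance

/-- `M` is a module of `R` and of `S`, and `S` arises from `R` by replacing the subgraph induced
on `M`. -/
def IsRedex (R S : Web n) (M : Finset (Fin n)) : Prop :=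
  IsModule R M ∧ IsModule S M ∧ ∀ x y, ¬ (x ∈ M ∧ y ∈ M) → R.adj x y = S.adj x y

instance (R S : Web n) (M : Finset (Fin n)) : Decidable (IsRedex R S M) := by
  unfold IsRedex; infer_instance

/-- The partition of `M` into the non-empty parts `p⁻¹(u) ∩ M`, for the nodes `u` of the rule
`A → B`, exhibits the inference between the subgraphs of `R` and `S` induced on `M` as the
substitution of graphs for the nodes of `A → B`. -/
def IsPartition {k : ℕ} (A B : Web k) (R S : Web n) (M : Finset (Fin n)) (p : Fin n → Fin k) :
    Prop :=
  (∀ u : Fin k, ∃ x ∈ M, p x = u) ∧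
    ∀ x ∈ M, ∀ y ∈ M,
      if p x = p y then R.adj x y = S.adj x y
      else R.adj x y = A.adj (p x) (p y) ∧ S.adj x y = B.adj (p x) (p y)

instance {k : ℕ} (A B : Web k) (R S : Web n) (M : Finset (Fin n)) (p : Fin n → Fin k) :
    Decidable (IsPartition A B R S M p) := by
  unfold IsPartition; infer_instance

/-- The check whether `R → S` is an instance of the graph inference `A → B`. -/
def isInstance {k : ℕ} (A B : Web k) (R S : Web n) : Prop :=
  ∃ M : Finset (Fin n), IsRedex R S M ∧ ∃ p : Fin n → Fin k, IsPartition A B R S M p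

instance {k : ℕ} (A B : Web k) (R S : Web n) : Decidable (isInstance A B R S) := by
  unfold isInstance; infer_instance

/-- All phases of the search, for inferences on `n` nodes and the set `B` of rewrites to check
against: logically minimal inferences with least premise (phases 1 to 6) that are not an instance
of an inference in `B` (phase 7), one for each isomorphism class, namely the least one. -/
def search (n : ℕ) (B : Finset GraphInference) : Finset (Web n × Web n) :=
  ((leastWebs n).biUnion (fun R => (logMin R).image (fun S => (R, S)))).filter
    (fun t => (∀ b ∈ B, ¬ isInstance b.2.1 b.2.2 t.1 t.2) ∧ Web.IsLeastPair t.1 t.2)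

/-- The recursive procedure `basis`. -/
def basis : ℕ → Finset GraphInference
  | 0 => ∅
  | n + 1 => basis n ∪ (search (n + 1) (basis n)).image (fun t => ⟨n + 1, t⟩)

end Algorithm

/-! ## Reading graph inferences as inferences between formulae -/

/-- `φ` is a cograph decomposition of `R`: a constant-free negation-free linear formula on the
nodes of `R` whose relation web is `R`. -/
def IsDecomposition {n : ℕ} (φ : Formula) (R : Web n) : Prop :=
  φ.Linear ∧ φ.ConstFree ∧ φ.NegFree ∧ φ.vars = Finset.range n ∧
    ∀ x y : Fin n, φ.Edge x y ↔ R.adj x y = true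

/-- `r` is a cograph decomposition of the graph inference `w`. -/
def IsDecompositionOf (r : Inference) (w : GraphInference) : Prop :=
  IsDecomposition r.lhs w.2.1 ∧ IsDecomposition r.rhs w.2.2

/-- `X` consists of exactly one cograph decomposition of each graph inference in `W`, up to
associativity, commutativity and renaming of variables. -/
def Represents (W : Set GraphInference) (X : Set Inference) : Prop :=
  ∃ e : X ≃ W, ∀ r : X, ∃ r₀ : Inference,
    IsDecompositionOf r₀ (e r : GraphInference) ∧ Inference.Variant (r : Inference) r₀

/-- The cograph decompositions of those members of `W` that have fewer than `m` nodes. -/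
def smallerDecompositions (W : Set GraphInference) (m : ℕ) : Set Inference :=
  {r | ∃ w ∈ W, w.1 < m ∧ IsDecompositionOf r w}

end LinearInference

open LinearInference

/-! On clean formulae (linear, without constants or negations) syntax and semantics agree up to
`AC`. The minterms of such a formula are the maximal cliques of its relation web (`minterm_iff`);
the truth table determines the minterms, the minterms determine the web, and the web determines the
formula up to `AC` (`ac_of_edge_iff`, `LogEquiv.ac`). The webs that arise are the P₄-free graphs
(`edge_p4Free`, `exists_clean`). Hence validity, triviality and equivalence of inferences can be
decided on graphs.

The search compares `R → S` with P₄-free graphs on the same nodes only, whereas logical minimality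
speaks of all linear formulae. The gap is closed by interpolation: a constant-free linear formula
between the two sides of a non-trivial implication has the variables of that implication, all of
them positive (`NonTriv.clean_of_between`). So phases 1 to 6 find exactly the inferences called
`Good` (`mem_logMin_iff_good`). An instance without units is a substitution into a clean context,
and on graphs this is the replacement of a module (`isInstance_of_ctxInst`,
`ctxInst_of_isInstance`). As `num` is injective, least pairs select one member of each isomorphism
class, and every good inference is an instance of an enumerated one (`Good.exists_mem_basis`).

The enumerated inferences generate (`derivableU_of_mem_L`, `generates_of_iso`). If a linear
inference on m variables remains valid when the literal of some variable is replaced by ⊤ on the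
left and by ⊥ on the right, it factors through an inference on fewer variables. Otherwise a change
of polarities and the unit laws turn it into a non-trivial inference between clean formulae, and
finitely many interpolants cut this into good steps.

None of them can be spared (`exists_signedVariant`). All formulae in a derivation of a good
inference lie between its two sides, so by minimality one single step leads from the class of the
left side to the class of the right side (`Good.exists_rewrite`). Units can be removed from this
step: once context, rule and substitution are simplified, what remains is an instance, without
units, of a good inference on no more variables than the rule (`Good.unit_elim`). For an enumerated
inference this good inference cannot be smaller, because the search would have rejected the pair.
Hence every generating set contains a renaming, up to polarities, of each enumerated inference, and
different ones need different generators. This gives minimality under inclusion and least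
cardinality together, and shows that a minimal set of clean inferences has no further members.

For m ≤ 4, where M_m is prescribed, truth tables reduce the claim to a finite computation: up to
renaming switch is the only good inference on three variables, there is none on fewer, and a good
one on four variables is medial or an instance of switch. -/

namespace LinearInference
open Formula

/-! ### Substitution, polarity and values of linear formulae -/

namespace Formula

@[simp] theorem neg_neg (φ : Formula) : φ.neg.neg = φ := by
  induction φ <;> simp_all [neg]

@[simp] theorem eval_neg (α : ℕ → Bool) (φ : Formula) : φ.neg.eval α = !(φ.eval α) := by
  induction φ <;> simp_all [neg, eval]

@[simp] theorem vars_neg (φ : Formula) : φ.neg.vars = φ.vars := by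
  induction φ <;> simp_all [neg, vars]

@[simp] theorem linear_neg (φ : Formula) : φ.neg.Linear ↔ φ.Linear := by
  induction φ <;> simp_all [neg, Linear]

@[simp] theorem constFree_neg (φ : Formula) : φ.neg.ConstFree ↔ φ.ConstFree := by
  induction φ <;> simp_all [neg, ConstFree]

theorem eval_subst (α : ℕ → Bool) (σ : ℕ → Formula) (φ : Formula) :
    (φ.subst σ).eval α = φ.eval (fun x => (σ x).eval α) := by
  induction φ <;> simp_all [subst, eval]

theorem neg_subst (σ : ℕ → Formula) (φ : Formula) : φ.neg.subst σ = (φ.subst σ).neg := by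
  induction φ <;> simp_all [subst, neg]

theorem subst_subst (σ τ : ℕ → Formula) (φ : Formula) :
    (φ.subst σ).subst τ = φ.subst (fun x => (σ x).subst τ) := by
  induction φ <;> simp_all [subst, neg_subst]

@[simp] theorem subst_var (φ : Formula) : φ.subst var = φ := by
  induction φ <;> simp_all [subst, neg]

theorem subst_congr {σ τ : ℕ → Formula} {φ : Formula} (h : ∀ x ∈ φ.vars, σ x = τ x) :
    φ.subst σ = φ.subst τ := by
  induction φ <;> simp_all [subst, vars]

theorem eval_congr {α β : ℕ → Bool} {φ : Formula} (h : ∀ x ∈ φ.vars, α x = β x) :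
    φ.eval α = φ.eval β := by
  induction φ <;> simp_all [eval, vars]

theorem vars_subst (σ : ℕ → Formula) (φ : Formula) :
    (φ.subst σ).vars = φ.vars.biUnion (fun x => (σ x).vars) := by
  induction φ <;> simp_all [subst, vars, Finset.union_biUnion]

theorem mem_vars_subst {σ : ℕ → Formula} {φ : Formula} {y : ℕ} :
    y ∈ (φ.subst σ).vars ↔ ∃ x ∈ φ.vars, y ∈ (σ x).vars := by
  simp [vars_subst]

/-- The substitution `σ` keeps linear formulae on the variables `s` linear. -/
def LinOn (σ : ℕ → Formula) (s : Finset ℕ) : Prop :=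
  (∀ x ∈ s, (σ x).Linear) ∧ ∀ x ∈ s, ∀ y ∈ s, x ≠ y → Disjoint (σ x).vars (σ y).vars

theorem LinOn.mono {σ : ℕ → Formula} {s t : Finset ℕ} (h : LinOn σ t) (hst : s ⊆ t) :
    LinOn σ s :=
  ⟨fun x hx => h.1 x (hst hx), fun x hx y hy => h.2 x (hst hx) y (hst hy)⟩

/-- As `φ` is linear, each substitute is inserted exactly once; a repeated variable can only come
from inside one substitute or from two different ones. -/
theorem linear_subst {σ : ℕ → Formula} {φ : Formula} (hφ : φ.Linear) :
    (φ.subst σ).Linear ↔ LinOn σ φ.vars := by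
  have key : ∀ a b : Formula, Disjoint a.vars b.vars →
      (LinOn σ (a.vars ∪ b.vars) ↔
        LinOn σ a.vars ∧ LinOn σ b.vars ∧ Disjoint (a.subst σ).vars (b.subst σ).vars) := by
    intro a b hd
    constructor
    · intro h
      refine ⟨h.mono Finset.subset_union_left, h.mono Finset.subset_union_right, ?_⟩
      rw [vars_subst, vars_subst, Finset.disjoint_biUnion_left]
      intro x hx
      rw [Finset.disjoint_biUnion_right]
      intro y hy
      exact h.2 x (Finset.mem_union_left _ hx) y (Finset.mem_union_right _ hy)
        (fun e => Finset.disjoint_left.mp hd hx (e ▸ hy))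
    · rintro ⟨h1, h2, h3⟩
      rw [vars_subst, vars_subst, Finset.disjoint_biUnion_left] at h3
      have h3' : ∀ x ∈ a.vars, ∀ y ∈ b.vars, Disjoint (σ x).vars (σ y).vars := fun x hx y hy =>
        (Finset.disjoint_biUnion_right _ _ _).mp (h3 x hx) y hy
      refine ⟨fun x hx => ?_, fun x hx y hy hxy => ?_⟩
      · rcases Finset.mem_union.mp hx with hx | hx
        exacts [h1.1 x hx, h2.1 x hx]
      · rcases Finset.mem_union.mp hx with hx | hx <;> rcases Finset.mem_union.mp hy with hy | hy
        exacts [h1.2 x hx y hy hxy, h3' x hx y hy, (h3' y hy x hx).symm, h2.2 x hx y hy hxy]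
  induction φ with
  | top => simp [subst, Linear, LinOn, vars]
  | bot => simp [subst, Linear, LinOn, vars]
  | var x => simp [subst, LinOn, vars]
  | nvar x => simp [subst, LinOn, vars]
  | and a b iha ihb =>
    simp only [subst, Linear, vars]
    exact ((iha hφ.1).and ((ihb hφ.2.1).and Iff.rfl)).trans (key a b hφ.2.2).symm
  | or a b iha ihb =>
    simp only [subst, Linear, vars]
    exact ((iha hφ.1).and ((ihb hφ.2.1).and Iff.rfl)).trans (key a b hφ.2.2).symm

theorem constFree_subst {σ : ℕ → Formula} {φ : Formula} (hφ : φ.ConstFree) :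
    (φ.subst σ).ConstFree ↔ ∀ x ∈ φ.vars, (σ x).ConstFree := by
  induction φ with
  | top => exact hφ.elim
  | bot => exact hφ.elim
  | var x => simp [subst, vars]
  | nvar x => simp [subst, vars]
  | and a b iha ihb =>
    simp only [subst, ConstFree, vars, iha hφ.1, ihb hφ.2, Finset.forall_mem_union]
  | or a b iha ihb =>
    simp only [subst, ConstFree, vars, iha hφ.1, ihb hφ.2, Finset.forall_mem_union]

/-- The variables that occur positively. -/
def posv : Formula → Finset ℕ
  | top => ∅
  | bot => ∅
  | var x => {x}
  | nvar _ => ∅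
  | and φ ψ => φ.posv ∪ ψ.posv
  | or φ ψ => φ.posv ∪ ψ.posv

/-- The variables that occur negatively. -/
def negv : Formula → Finset ℕ
  | top => ∅
  | bot => ∅
  | var _ => ∅
  | nvar x => {x}
  | and φ ψ => φ.negv ∪ ψ.negv
  | or φ ψ => φ.negv ∪ ψ.negv

theorem vars_eq_posv_union_negv (φ : Formula) : φ.vars = φ.posv ∪ φ.negv := by
  induction φ <;> simp_all [vars, posv, negv]
  all_goals ext; simp; tauto

theorem negv_subset (φ : Formula) : φ.negv ⊆ φ.vars := by
  rw [vars_eq_posv_union_negv]; exact Finset.subset_union_right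

theorem posv_subset (φ : Formula) : φ.posv ⊆ φ.vars := by
  rw [vars_eq_posv_union_negv]; exact Finset.subset_union_left

theorem negFree_iff (φ : Formula) : φ.NegFree ↔ φ.negv = ∅ := by
  induction φ <;> simp_all [NegFree, negv, Finset.union_eq_empty]

theorem NegFree.mem_posv {φ : Formula} (h : φ.NegFree) {x : ℕ} (hx : x ∈ φ.vars) :
    x ∈ φ.posv := by
  rw [vars_eq_posv_union_negv, (negFree_iff φ).mp h] at hx; simpa using hx

theorem negFree_subst (σ : ℕ → Formula) (φ : Formula) :
    (φ.subst σ).NegFree ↔ (∀ x ∈ φ.posv, (σ x).NegFree) ∧ ∀ x ∈ φ.negv, (σ x).neg.NegFree := by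
  induction φ with
  | top => simp [subst, NegFree, posv, negv]
  | bot => simp [subst, NegFree, posv, negv]
  | var x => simp [subst, posv, negv]
  | nvar x => simp [subst, posv, negv]
  | and a b iha ihb =>
    simp only [subst, NegFree, posv, negv, iha, ihb, Finset.forall_mem_union]; tauto
  | or a b iha ihb =>
    simp only [subst, NegFree, posv, negv, iha, ihb, Finset.forall_mem_union]; tauto

theorem NegFree.subst {σ : ℕ → Formula} {φ : Formula} (h : φ.NegFree)
    (hσ : ∀ x ∈ φ.vars, (σ x).NegFree) : (φ.subst σ).NegFree := by
  rw [negFree_subst, (negFree_iff φ).mp h]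
  exact ⟨fun x hx => hσ x (posv_subset φ hx), by simp⟩

/-- Without constants there is at least one literal, and negation changes its sign. Unit elimination
uses this to exclude negative occurrences in the simplified rule. -/
theorem ConstFree.not_negFree_neg {φ : Formula} (h : φ.ConstFree) (h' : φ.NegFree) :
    ¬ φ.neg.NegFree := by
  induction φ <;> simp_all [ConstFree, NegFree, neg]

theorem ConstFree.vars_nonempty {φ : Formula} (h : φ.ConstFree) : φ.vars.Nonempty := by
  induction φ with
  | top => exact h.elim
  | bot => exact h.elim
  | var x => simp [vars]
  | nvar x => simp [vars]
  | and a b iha ihb => exact (iha h.1).mono Finset.subset_union_left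
  | or a b iha ihb => exact (iha h.1).mono Finset.subset_union_left

theorem NegFree.mono {φ : Formula} (h : φ.NegFree) {α β : ℕ → Bool}
    (hαβ : ∀ x ∈ φ.vars, α x = true → β x = true) (hα : φ.eval α = true) : φ.eval β = true := by
  induction φ with
  | top => rfl
  | bot => simp [eval] at hα
  | var x => exact hαβ x (by simp [vars]) hα
  | nvar x => exact h.elim
  | and a b iha ihb =>
    simp only [vars, Finset.mem_union, eval, Bool.and_eq_true] at *
    exact ⟨iha h.1 (fun x hx => hαβ x (Or.inl hx)) hα.1, ihb h.2 (fun x hx => hαβ x (Or.inr hx)) hα.2⟩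
  | or a b iha ihb =>
    simp only [vars, Finset.mem_union, eval, Bool.or_eq_true] at *
    exact hα.imp (iha h.1 (fun x hx => hαβ x (Or.inl hx))) (ihb h.2 (fun x hx => hαβ x (Or.inr hx)))

theorem eval_update_of_notMem {φ : Formula} {x : ℕ} (hx : x ∉ φ.vars) (α : ℕ → Bool) (b : Bool) :
    φ.eval (Function.update α x b) = φ.eval α :=
  eval_congr fun y hy => Function.update_of_ne (fun e : y = x => hx (e ▸ hy)) _ _

/-- Setting a variable to the truth value opposed to its polarity makes the formula smaller. -/
theorem eval_update_le {φ : Formula} (hφ : φ.Linear) (x : ℕ) (b : Bool)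
    (hb : b = decide (x ∉ φ.negv)) {α : ℕ → Bool} (h : φ.eval α = true) :
    φ.eval (Function.update α x b) = true := by
  subst hb
  induction φ with
  | top => rfl
  | bot => simp [eval] at h
  | var y =>
    by_cases hxy : y = x
    · subst hxy; simp [eval, negv]
    · simpa [eval, Function.update_of_ne hxy] using h
  | nvar y =>
    by_cases hxy : y = x
    · subst hxy; simp [eval, negv]
    · simpa [eval, Function.update_of_ne hxy] using h
  | and a b iha ihb =>
    have ha : a.eval α = true → a.eval (Function.update α x (decide (x ∉ (a.and b).negv))) = true := by
      intro h
      by_cases hx : x ∈ a.vars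
      · have := iha hφ.1 h
        have hb : x ∉ b.negv := fun h' => Finset.disjoint_left.mp hφ.2.2 hx (negv_subset b h')
        simpa [negv, hb] using this
      · rw [← h]; exact eval_update_of_notMem hx _ _
    have hb : b.eval α = true → b.eval (Function.update α x (decide (x ∉ (a.and b).negv))) = true := by
      intro h
      by_cases hx : x ∈ b.vars
      · have := ihb hφ.2.1 h
        have hb : x ∉ a.negv := fun h' => Finset.disjoint_left.mp hφ.2.2 (negv_subset a h') hx
        simpa [negv, hb] using this
      · rw [← h]; exact eval_update_of_notMem hx _ _
    simp only [eval, Bool.and_eq_true] at *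
    exact ⟨ha h.1, hb h.2⟩
  | or a b iha ihb =>
    have ha : a.eval α = true → a.eval (Function.update α x (decide (x ∉ (a.or b).negv))) = true := by
      intro h
      by_cases hx : x ∈ a.vars
      · have := iha hφ.1 h
        have hb : x ∉ b.negv := fun h' => Finset.disjoint_left.mp hφ.2.2 hx (negv_subset b h')
        simpa [negv, hb] using this
      · rw [← h]; exact eval_update_of_notMem hx _ _
    have hb : b.eval α = true → b.eval (Function.update α x (decide (x ∉ (a.or b).negv))) = true := by
      intro h
      by_cases hx : x ∈ b.vars
      · have := ihb hφ.2.1 h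
        have hb : x ∉ a.negv := fun h' => Finset.disjoint_left.mp hφ.2.2 (negv_subset a h') hx
        simpa [negv, hb] using this
      · rw [← h]; exact eval_update_of_notMem hx _ _
    simp only [eval, Bool.or_eq_true] at *
    exact h.imp ha hb

/-- Every linear constant-free formula takes both truth values. -/
theorem exists_eval_eq {φ : Formula} (hφ : φ.Linear) (hc : φ.ConstFree) (b : Bool) :
    ∃ α : ℕ → Bool, φ.eval α = b := by
  -- Assignments for disjoint sets of variables can be glued, so the two values can be prescribed
  -- independently.
  have key : ∀ a b : Formula, Disjoint a.vars b.vars → ∀ c d : Bool, (∃ α, a.eval α = c) →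
      (∃ α, b.eval α = d) → ∃ α, a.eval α = c ∧ b.eval α = d := by
    rintro a b hd c d ⟨α, hα⟩ ⟨β, hβ⟩
    refine ⟨fun x => if x ∈ a.vars then α x else β x, ?_, ?_⟩
    · rw [← hα]; exact eval_congr fun x hx => by simp [hx]
    · rw [← hβ]
      exact eval_congr fun x hx => by simp [Finset.disjoint_right.mp hd hx]
  induction φ with
  | top => exact hc.elim
  | bot => exact hc.elim
  | var x => exact ⟨fun _ => b, rfl⟩
  | nvar x => exact ⟨fun _ => !b, by simp [eval]⟩
  | and a c iha ihc =>
    obtain ⟨α, h1, h2⟩ := key a c hφ.2.2 b b (iha hφ.1 hc.1) (ihc hφ.2.1 hc.2)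
    exact ⟨α, by simp [eval, h1, h2]⟩
  | or a c iha ihc =>
    obtain ⟨α, h1, h2⟩ := key a c hφ.2.2 b b (iha hφ.1 hc.1) (ihc hφ.2.1 hc.2)
    exact ⟨α, by simp [eval, h1, h2]⟩

/-- A linear constant-free formula depends on each of its variables. -/
theorem exists_critical {φ : Formula} (hφ : φ.Linear) (hc : φ.ConstFree) {x : ℕ}
    (hx : x ∈ φ.vars) : ∃ α : ℕ → Bool, ∀ b,
      φ.eval (Function.update α x b) = (if x ∈ φ.negv then !b else b) := by
  -- A critical assignment for the side that contains `x` is glued with one that gives the other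
  -- side the value `d`; below, `d` is the neutral value of the connective.
  have key : ∀ a c : Formula, Disjoint a.vars c.vars → x ∈ a.vars → c.Linear → c.ConstFree →
      (∃ α : ℕ → Bool, ∀ b, a.eval (Function.update α x b) = (if x ∈ a.negv then !b else b)) →
      ∀ d, ∃ α : ℕ → Bool, (∀ b, c.eval (Function.update α x b) = d) ∧
        ∀ b, a.eval (Function.update α x b) = (if x ∈ a.negv ∪ c.negv then !b else b) := by
    rintro a c hd hx hl hc ⟨α, hα⟩ d
    obtain ⟨β, hβ⟩ := exists_eval_eq hl hc d
    have hxc : x ∉ c.vars := Finset.disjoint_left.mp hd hx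
    refine ⟨fun x => if x ∈ a.vars then α x else β x, fun b => ?_, fun b => ?_⟩
    · rw [eval_update_of_notMem hxc, ← hβ]
      exact eval_congr fun x hx => by simp [Finset.disjoint_right.mp hd hx]
    · have : x ∉ c.negv := fun h => hxc (negv_subset c h)
      have e : a.eval (Function.update (fun x => if x ∈ a.vars then α x else β x) x b)
          = a.eval (Function.update α x b) := by
        refine eval_congr fun y hy => ?_
        by_cases hyx : y = x
        · subst hyx; simp
        · simp [Function.update_of_ne hyx, hy]
      rw [e, hα]; simp [this]
  induction φ with
  | top => exact hc.elim
  | bot => exact hc.elim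
  | var y =>
    simp only [vars, Finset.mem_singleton] at hx; subst hx
    exact ⟨fun _ => true, fun b => by simp [eval, negv]⟩
  | nvar y =>
    simp only [vars, Finset.mem_singleton] at hx; subst hx
    exact ⟨fun _ => true, fun b => by simp [eval, negv]⟩
  | and a c iha ihc =>
    rcases Finset.mem_union.mp hx with hx | hx
    · obtain ⟨α, h1, h2⟩ := key a c hφ.2.2 hx hφ.2.1 hc.2 (iha hφ.1 hc.1 hx) true
      exact ⟨α, fun b => by
        simp only [eval, h1, h2, negv, Bool.and_true]; congr 1⟩
    · obtain ⟨α, h1, h2⟩ := key c a hφ.2.2.symm hx hφ.1 hc.1 (ihc hφ.2.1 hc.2 hx) true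
      exact ⟨α, fun b => by
        simp only [eval, h1, h2, negv, Bool.true_and]; rw [Finset.union_comm]; congr 1⟩
  | or a c iha ihc =>
    rcases Finset.mem_union.mp hx with hx | hx
    · obtain ⟨α, h1, h2⟩ := key a c hφ.2.2 hx hφ.2.1 hc.2 (iha hφ.1 hc.1 hx) false
      exact ⟨α, fun b => by
        simp only [eval, h1, h2, negv, Bool.or_false]; congr 1⟩
    · obtain ⟨α, h1, h2⟩ := key c a hφ.2.2.symm hx hφ.1 hc.1 (ihc hφ.2.1 hc.2 hx) false
      exact ⟨α, fun b => by
        simp only [eval, h1, h2, negv, Bool.false_or]; rw [Finset.union_comm]; congr 1⟩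

/-! ### Clean formulae -/

/-- Linear, constant-free and negation-free formulae. -/
structure Clean (φ : Formula) : Prop where
  linear : φ.Linear
  constFree : φ.ConstFree
  negFree : φ.NegFree

theorem Clean.subst {σ : ℕ → Formula} {φ : Formula} (h : φ.Clean)
    (hσ : ∀ x ∈ φ.vars, (σ x).Clean)
    (hd : ∀ x ∈ φ.vars, ∀ y ∈ φ.vars, x ≠ y → Disjoint (σ x).vars (σ y).vars) :
    (φ.subst σ).Clean :=
  ⟨(linear_subst h.linear).mpr ⟨fun x hx => (hσ x hx).linear, hd⟩,
    (constFree_subst h.constFree).mpr fun x hx => (hσ x hx).constFree,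
    h.negFree.subst fun x hx => (hσ x hx).negFree⟩

theorem Clean.exists_critical {φ : Formula} (h : φ.Clean) {x : ℕ} (hx : x ∈ φ.vars) :
    ∃ α : ℕ → Bool, ∀ b, φ.eval (Function.update α x b) = b := by
  obtain ⟨α, hα⟩ := Formula.exists_critical h.linear h.constFree hx
  exact ⟨α, fun b => by simpa [(negFree_iff φ).mp h.negFree] using hα b⟩

theorem LogEquiv.symm {φ ψ : Formula} (h : LogEquiv φ ψ) : LogEquiv ψ φ := fun α => (h α).symm

theorem LogEquiv.trans {φ ψ χ : Formula} (h : LogEquiv φ ψ) (h' : LogEquiv ψ χ) :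
    LogEquiv φ χ := fun α => (h α).trans (h' α)

theorem LogEquiv.refl (φ : Formula) : LogEquiv φ φ := fun _ => rfl

theorem eval_subst1 (α : ℕ → Bool) (φ : Formula) (x : ℕ) (χ : Formula) :
    (φ.subst1 x χ).eval α = φ.eval (Function.update α x (χ.eval α)) := by
  rw [subst1, eval_subst]
  refine eval_congr fun y _ => ?_
  by_cases hy : y = x
  · subst hy; simp
  · simp [Function.update_of_ne hy, eval]

theorem Implies.trans {φ ψ χ : Formula} (h : Implies φ ψ) (h' : Implies ψ χ) : Implies φ χ :=
  fun α hα => h' α (h α hα)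

theorem LogEquiv.implies {φ ψ : Formula} (h : LogEquiv φ ψ) : Implies φ ψ :=
  fun α hα => by rw [← h]; exact hα

theorem Implies.antisymm {φ ψ : Formula} (h : Implies φ ψ) (h' : Implies ψ φ) : LogEquiv φ ψ :=
  fun α => Bool.eq_iff_iff.mpr ⟨h α, h' α⟩

/-! ### Simplification of units -/

/-- Conjunction, simplified by the unit laws. -/
def sand : Formula → Formula → Formula
  | top, ψ => ψ
  | bot, _ => bot
  | φ, top => φ
  | _, bot => bot
  | φ, ψ => and φ ψ

/-- Disjunction, simplified by the unit laws. -/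
def sor : Formula → Formula → Formula
  | bot, ψ => ψ
  | top, _ => top
  | φ, bot => φ
  | _, top => top
  | φ, ψ => or φ ψ

/-- Simplification by the unit laws. -/
def nf : Formula → Formula
  | and φ ψ => sand φ.nf ψ.nf
  | or φ ψ => sor φ.nf ψ.nf
  | φ => φ

/-- Condenses the pattern match to the only distinctions that the inductions on `nf` need. -/
theorem sand_cases (φ ψ : Formula) : (φ = top ∧ sand φ ψ = ψ) ∨ (φ = bot ∧ sand φ ψ = bot) ∨
    (ψ = top ∧ sand φ ψ = φ) ∨ (ψ = bot ∧ sand φ ψ = bot) ∨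
    (φ ≠ top ∧ φ ≠ bot ∧ ψ ≠ top ∧ ψ ≠ bot ∧ sand φ ψ = and φ ψ) := by
  cases φ <;> cases ψ <;> simp [sand]

theorem sor_cases (φ ψ : Formula) : (φ = bot ∧ sor φ ψ = ψ) ∨ (φ = top ∧ sor φ ψ = top) ∨
    (ψ = bot ∧ sor φ ψ = φ) ∨ (ψ = top ∧ sor φ ψ = top) ∨
    (φ ≠ top ∧ φ ≠ bot ∧ ψ ≠ top ∧ ψ ≠ bot ∧ sor φ ψ = or φ ψ) := by
  cases φ <;> cases ψ <;> simp [sor]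

/-- At each connective a unit either vanishes or absorbs the other argument, so a unit can survive
only as the whole formula. -/
theorem nf_cases (φ : Formula) : φ.nf = top ∨ φ.nf = bot ∨ φ.nf.ConstFree := by
  induction φ with
  | top => simp [nf]
  | bot => simp [nf]
  | var x => simp [nf, ConstFree]
  | nvar x => simp [nf, ConstFree]
  | and a b iha ihb =>
    simp only [nf]
    rcases sand_cases a.nf b.nf with ⟨_, h⟩ | ⟨_, h⟩ | ⟨_, h⟩ | ⟨_, h⟩ | ⟨h1, h2, h3, h4, h⟩ <;>
      rw [h] <;> simp_all [ConstFree]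
  | or a b iha ihb =>
    simp only [nf]
    rcases sor_cases a.nf b.nf with ⟨_, h⟩ | ⟨_, h⟩ | ⟨_, h⟩ | ⟨_, h⟩ | ⟨h1, h2, h3, h4, h⟩ <;>
      rw [h] <;> simp_all [ConstFree]

theorem eval_nf (α : ℕ → Bool) (φ : Formula) : φ.nf.eval α = φ.eval α := by
  induction φ with
  | top => rfl
  | bot => rfl
  | var x => rfl
  | nvar x => rfl
  | and a b iha ihb =>
    simp only [nf]
    rcases sand_cases a.nf b.nf with ⟨e, h⟩ | ⟨e, h⟩ | ⟨e, h⟩ | ⟨e, h⟩ | ⟨h1, h2, h3, h4, h⟩ <;>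
      rw [h] <;> simp_all [eval]
  | or a b iha ihb =>
    simp only [nf]
    rcases sor_cases a.nf b.nf with ⟨e, h⟩ | ⟨e, h⟩ | ⟨e, h⟩ | ⟨e, h⟩ | ⟨h1, h2, h3, h4, h⟩ <;>
      rw [h] <;> simp_all [eval]

theorem logEquiv_nf (φ : Formula) : LogEquiv φ.nf φ := fun α => eval_nf α φ

theorem vars_nf (φ : Formula) : φ.nf.vars ⊆ φ.vars := by
  induction φ with
  | top => exact Finset.Subset.refl _
  | bot => exact Finset.Subset.refl _
  | var x => exact Finset.Subset.refl _
  | nvar x => exact Finset.Subset.refl _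
  | and a b iha ihb =>
    have : (sand a.nf b.nf).vars ⊆ a.nf.vars ∪ b.nf.vars := by
      rcases sand_cases a.nf b.nf with ⟨e, h⟩ | ⟨e, h⟩ | ⟨e, h⟩ | ⟨e, h⟩ | ⟨h1, h2, h3, h4, h⟩ <;>
        rw [h] <;> simp [vars]
    exact this.trans (Finset.union_subset_union iha ihb)
  | or a b iha ihb =>
    have : (sor a.nf b.nf).vars ⊆ a.nf.vars ∪ b.nf.vars := by
      rcases sor_cases a.nf b.nf with ⟨e, h⟩ | ⟨e, h⟩ | ⟨e, h⟩ | ⟨e, h⟩ | ⟨h1, h2, h3, h4, h⟩ <;>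
        rw [h] <;> simp [vars]
    exact this.trans (Finset.union_subset_union iha ihb)

theorem negv_nf (φ : Formula) : φ.nf.negv ⊆ φ.negv := by
  induction φ with
  | top => exact Finset.Subset.refl _
  | bot => exact Finset.Subset.refl _
  | var x => exact Finset.Subset.refl _
  | nvar x => exact Finset.Subset.refl _
  | and a b iha ihb =>
    have : (sand a.nf b.nf).negv ⊆ a.nf.negv ∪ b.nf.negv := by
      rcases sand_cases a.nf b.nf with ⟨e, h⟩ | ⟨e, h⟩ | ⟨e, h⟩ | ⟨e, h⟩ | ⟨h1, h2, h3, h4, h⟩ <;>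
        rw [h] <;> simp [negv]
    exact this.trans (Finset.union_subset_union iha ihb)
  | or a b iha ihb =>
    have : (sor a.nf b.nf).negv ⊆ a.nf.negv ∪ b.nf.negv := by
      rcases sor_cases a.nf b.nf with ⟨e, h⟩ | ⟨e, h⟩ | ⟨e, h⟩ | ⟨e, h⟩ | ⟨h1, h2, h3, h4, h⟩ <;>
        rw [h] <;> simp [negv]
    exact this.trans (Finset.union_subset_union iha ihb)

theorem Linear.nf {φ : Formula} (hφ : φ.Linear) : φ.nf.Linear := by
  induction φ with
  | top => trivial
  | bot => trivial
  | var x => trivial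
  | nvar x => trivial
  | and a b iha ihb =>
    have hd : Disjoint a.nf.vars b.nf.vars := hφ.2.2.mono (vars_nf a) (vars_nf b)
    simp only [Formula.nf]
    rcases sand_cases a.nf b.nf with ⟨e, h⟩ | ⟨e, h⟩ | ⟨e, h⟩ | ⟨e, h⟩ | ⟨h1, h2, h3, h4, h⟩ <;>
      rw [h]
    exacts [ihb hφ.2.1, trivial, iha hφ.1, trivial, ⟨iha hφ.1, ihb hφ.2.1, hd⟩]
  | or a b iha ihb =>
    have hd : Disjoint a.nf.vars b.nf.vars := hφ.2.2.mono (vars_nf a) (vars_nf b)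
    simp only [Formula.nf]
    rcases sor_cases a.nf b.nf with ⟨e, h⟩ | ⟨e, h⟩ | ⟨e, h⟩ | ⟨e, h⟩ | ⟨h1, h2, h3, h4, h⟩ <;>
      rw [h]
    exacts [ihb hφ.2.1, trivial, iha hφ.1, trivial, ⟨iha hφ.1, ihb hφ.2.1, hd⟩]

end Formula
end LinearInference

namespace LinearInference
open Formula

namespace Formula

/-! ### The relation web of a formula -/

theorem Edge.mem {φ : Formula} {x y : ℕ} (h : φ.Edge x y) : x ∈ φ.vars ∧ y ∈ φ.vars := by
  induction φ with
  | top => exact h.elim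
  | bot => exact h.elim
  | var z => exact h.elim
  | nvar z => exact h.elim
  | and a b iha ihb =>
    simp only [vars, Finset.mem_union]
    rcases h with h | h | h | h
    · have := iha h; tauto
    · have := ihb h; tauto
    · tauto
    · tauto
  | or a b iha ihb =>
    simp only [vars, Finset.mem_union]
    rcases h with h | h
    · have := iha h; tauto
    · have := ihb h; tauto

theorem Edge.symm {φ : Formula} {x y : ℕ} (h : φ.Edge x y) : φ.Edge y x := by
  induction φ with
  | top => exact h.elim
  | bot => exact h.elim
  | var z => exact h.elim
  | nvar z => exact h.elim
  | and a b iha ihb =>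
    simp only [Edge] at *
    tauto
  | or a b iha ihb =>
    simp only [Edge] at *
    tauto

theorem Edge.ne {φ : Formula} (hφ : φ.Linear) {x y : ℕ} (h : φ.Edge x y) : x ≠ y := by
  induction φ with
  | top => exact h.elim
  | bot => exact h.elim
  | var z => exact h.elim
  | nvar z => exact h.elim
  | and a b iha ihb =>
    rcases h with h | h | h | h
    · exact iha hφ.1 h
    · exact ihb hφ.2.1 h
    · exact fun e => Finset.disjoint_left.mp hφ.2.2 h.1 (e ▸ h.2)
    · exact fun e => Finset.disjoint_left.mp hφ.2.2 (e ▸ h.2) h.1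
  | or a b iha ihb =>
    rcases h with h | h
    · exact iha hφ.1 h
    · exact ihb hφ.2.1 h

theorem edge_and_left {a b : Formula} (h : Disjoint a.vars b.vars) {x y : ℕ} (hx : x ∈ a.vars)
    (hy : y ∈ a.vars) : (and a b).Edge x y ↔ a.Edge x y := by
  have hx' := Finset.disjoint_left.mp h hx
  have hy' := Finset.disjoint_left.mp h hy
  simp only [Edge, hx', hy', and_false, false_and, or_false, or_iff_left_iff_imp]
  exact fun h => absurd h.mem.1 hx'

theorem edge_and_right {a b : Formula} (h : Disjoint a.vars b.vars) {x y : ℕ} (hx : x ∈ b.vars)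
    (hy : y ∈ b.vars) : (and a b).Edge x y ↔ b.Edge x y := by
  have hx' := Finset.disjoint_right.mp h hx
  have hy' := Finset.disjoint_right.mp h hy
  simp only [Edge, hx', hy', and_false, false_and, or_false, or_iff_right_iff_imp]
  exact fun h => absurd h.mem.1 hx'

theorem edge_or_left {a b : Formula} (h : Disjoint a.vars b.vars) {x y : ℕ} (hx : x ∈ a.vars) :
    (or a b).Edge x y ↔ a.Edge x y := by
  have hx' := Finset.disjoint_left.mp h hx
  simp only [Edge, or_iff_left_iff_imp]
  exact fun h => absurd h.mem.1 hx'

theorem edge_or_right {a b : Formula} (h : Disjoint a.vars b.vars) {x y : ℕ} (hx : x ∈ b.vars) :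
    (or a b).Edge x y ↔ b.Edge x y := by
  have hx' := Finset.disjoint_right.mp h hx
  simp only [Edge, or_iff_right_iff_imp]
  exact fun h => absurd h.mem.1 hx'

/-- De Morgan duality exchanges ∧ and ∨ at every least common connective, so negation complements
the web. Statements about disjunctions are thereby reduced to conjunctions. -/
theorem edge_neg {φ : Formula} (hφ : φ.Linear) (x y : ℕ) :
    φ.neg.Edge x y ↔ x ∈ φ.vars ∧ y ∈ φ.vars ∧ x ≠ y ∧ ¬ φ.Edge x y := by
  induction φ with
  | top => simp [neg, Edge, vars]
  | bot => simp [neg, Edge, vars]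
  | var z => simp only [neg, Edge, vars, Finset.mem_singleton]; grind
  | nvar z => simp only [neg, Edge, vars, Finset.mem_singleton]; grind
  | and a b iha ihb =>
    have hx : x ∈ a.vars → x ∉ b.vars := fun h => Finset.disjoint_left.mp hφ.2.2 h
    have hy : y ∈ a.vars → y ∉ b.vars := fun h => Finset.disjoint_left.mp hφ.2.2 h
    have m1 : a.Edge x y → x ∈ a.vars ∧ y ∈ a.vars := Edge.mem
    have m2 : b.Edge x y → x ∈ b.vars ∧ y ∈ b.vars := Edge.mem
    simp only [neg, Edge, vars, Finset.mem_union, iha hφ.1, ihb hφ.2.1]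
    clear iha ihb
    grind
  | or a b iha ihb =>
    have hx : x ∈ a.vars → x ∉ b.vars := fun h => Finset.disjoint_left.mp hφ.2.2 h
    have hy : y ∈ a.vars → y ∉ b.vars := fun h => Finset.disjoint_left.mp hφ.2.2 h
    have m1 : a.Edge x y → x ∈ a.vars ∧ y ∈ a.vars := Edge.mem
    have m2 : b.Edge x y → x ∈ b.vars ∧ y ∈ b.vars := Edge.mem
    simp only [neg, Edge, vars, Finset.mem_union, iha hφ.1, ihb hφ.2.1, vars_neg]
    clear iha ihb
    grind

/-- Both P₄ and its complement are connected. Under a root ∨ adjacent nodes lie on the same side,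
under a root ∧ non-adjacent ones do; either way all four nodes fall into one immediate subformula.
-/
theorem edge_p4Free {φ : Formula} (hφ : φ.Linear) (a b c d : ℕ) : ¬ (φ.Edge a b ∧ φ.Edge b c ∧
    φ.Edge c d ∧ ¬ φ.Edge a c ∧ ¬ φ.Edge b d ∧ ¬ φ.Edge a d) := by
  induction φ with
  | top => simp [Edge]
  | bot => simp [Edge]
  | var z => simp [Edge]
  | nvar z => simp [Edge]
  | and p q ihp ihq =>
    rintro ⟨h1, h2, h3, h4, h5, h6⟩
    have ha := h1.mem.1
    have hb := h1.mem.2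
    have hc := h2.mem.2
    have hd := h3.mem.2
    simp only [vars, Finset.mem_union] at ha hb hc hd
    have h4' := h4; have h5' := h5; have h6' := h6
    simp only [Edge, not_or, not_and] at h4' h5' h6'
    have dj := hφ.2.2
    rcases ha with ha | ha
    · have hc := hc.resolve_right (h4'.2.2.1 ha)
      have hd := hd.resolve_right (h6'.2.2.1 ha)
      have hb := hb.resolve_right fun h => h5'.2.2.2 h hd
      rw [edge_and_left dj (by assumption) (by assumption)] at h1 h2 h3 h4 h5 h6
      exact ihp hφ.1 ⟨h1, h2, h3, h4, h5, h6⟩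
    · have hc := hc.resolve_left (h4'.2.2.2 ha)
      have hd := hd.resolve_left (h6'.2.2.2 ha)
      have hb := hb.resolve_left fun h => h5'.2.2.1 h hd
      rw [edge_and_right dj (by assumption) (by assumption)] at h1 h2 h3 h4 h5 h6
      exact ihq hφ.2.1 ⟨h1, h2, h3, h4, h5, h6⟩
  | or p q ihp ihq =>
    rintro ⟨h1, h2, h3, h4, h5, h6⟩
    have dj := hφ.2.2
    have ha := h1.mem.1
    simp only [vars, Finset.mem_union] at ha
    rcases ha with ha | ha
    · have h1' := (edge_or_left dj ha).mp h1
      have h2' := (edge_or_left dj h1'.mem.2).mp h2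
      have h3' := (edge_or_left dj h2'.mem.2).mp h3
      rw [edge_or_left dj ha] at h4 h6
      rw [edge_or_left dj h1'.mem.2] at h5
      exact ihp hφ.1 ⟨h1', h2', h3', h4, h5, h6⟩
    · have h1' := (edge_or_right dj ha).mp h1
      have h2' := (edge_or_right dj h1'.mem.2).mp h2
      have h3' := (edge_or_right dj h2'.mem.2).mp h3
      rw [edge_or_right dj ha] at h4 h6
      rw [edge_or_right dj h1'.mem.2] at h5
      exact ihq hφ.2.1 ⟨h1', h2', h3', h4, h5, h6⟩

end Formula

/-! ### Invariants of the congruences -/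

theorem Cong.linear {E : Formula → Formula → Prop} {φ ψ : Formula} (h : Cong E φ ψ) :
    φ.Linear ∧ ψ.Linear := by
  induction h <;> tauto

theorem Cong.mono {E F : Formula → Formula → Prop} (hEF : ∀ φ ψ, E φ ψ → F φ ψ) {φ ψ : Formula}
    (h : Cong E φ ψ) : Cong F φ ψ := by
  induction h with
  | ax h h1 h2 => exact .ax (hEF _ _ h) h1 h2
  | refl h => exact .refl h
  | symm _ ih => exact ih.symm
  | trans _ _ ih1 ih2 => exact ih1.trans ih2
  | and_right χ _ h1 h2 ih => exact .and_right χ ih h1 h2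
  | and_left χ _ h1 h2 ih => exact .and_left χ ih h1 h2
  | or_right χ _ h1 h2 ih => exact .or_right χ ih h1 h2
  | or_left χ _ h1 h2 ih => exact .or_left χ ih h1 h2

theorem AC.acu {φ ψ : Formula} (h : AC φ ψ) : ACU φ ψ := Cong.mono (fun _ _ => Or.inl) h

theorem Cong.logEquiv {E : Formula → Formula → Prop} (hE : ∀ φ ψ, E φ ψ → LogEquiv φ ψ)
    {φ ψ : Formula} (h : Cong E φ ψ) : LogEquiv φ ψ := by
  induction h with
  | ax h h1 h2 => exact hE _ _ h
  | refl h => exact .refl _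
  | symm _ ih => exact ih.symm
  | trans _ _ ih1 ih2 => exact ih1.trans ih2
  | _ χ _ h1 h2 ih => intro α; simp only [eval, ih α]

theorem ACAxiom.logEquiv {φ ψ : Formula} (h : ACAxiom φ ψ) : LogEquiv φ ψ := by
  intro α
  cases h <;> simp only [eval]
  · exact Bool.or_comm _ _
  · exact Bool.and_comm _ _
  · exact (Bool.and_assoc _ _ _).symm
  · exact (Bool.or_assoc _ _ _).symm

theorem AC.logEquiv {φ ψ : Formula} (h : AC φ ψ) : LogEquiv φ ψ :=
  Cong.logEquiv (fun _ _ h => h.logEquiv) h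

theorem ACU.logEquiv {φ ψ : Formula} (h : ACU φ ψ) : LogEquiv φ ψ := by
  refine Cong.logEquiv (fun φ ψ h => ?_) h
  rcases h with h | h
  · exact h.logEquiv
  · intro α
    cases h <;> simp [eval]

/-- Invariants of associativity and commutativity are invariants of the generated congruence. -/
theorem AC.vars_eq {φ ψ : Formula} (h : AC φ ψ) : φ.vars = ψ.vars := by
  induction h with
  | ax h h1 h2 =>
    cases h <;> simp only [vars] <;>
      first | exact Finset.union_comm _ _ | exact (Finset.union_assoc _ _ _).symm
  | refl h => rfl
  | symm _ ih => exact ih.symm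
  | trans _ _ ih1 ih2 => exact ih1.trans ih2
  | _ χ _ h1 h2 ih => simp only [vars, ih]

theorem AC.negv_eq {φ ψ : Formula} (h : AC φ ψ) : φ.negv = ψ.negv := by
  induction h with
  | ax h h1 h2 =>
    cases h <;> simp only [negv] <;>
      first | exact Finset.union_comm _ _ | exact (Finset.union_assoc _ _ _).symm
  | refl h => rfl
  | symm _ ih => exact ih.symm
  | trans _ _ ih1 ih2 => exact ih1.trans ih2
  | _ χ _ h1 h2 ih => simp only [negv, ih]

theorem AC.constFree_iff {φ ψ : Formula} (h : AC φ ψ) : φ.ConstFree ↔ ψ.ConstFree := by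
  induction h with
  | ax h h1 h2 => cases h <;> simp only [ConstFree] <;> tauto
  | refl h => rfl
  | symm _ ih => exact ih.symm
  | trans _ _ ih1 ih2 => exact ih1.trans ih2
  | _ χ _ h1 h2 ih => simp only [ConstFree, ih]

theorem AC.edge_iff {φ ψ : Formula} (h : AC φ ψ) (x y : ℕ) : φ.Edge x y ↔ ψ.Edge x y := by
  induction h with
  | ax h h1 h2 => cases h <;> simp only [Edge, vars, Finset.mem_union] <;> tauto
  | refl h => rfl
  | symm _ ih => exact ih.symm
  | trans _ _ ih1 ih2 => exact ih1.trans ih2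
  | and_right χ h _ _ ih => simp only [Edge, ih, AC.vars_eq h]
  | and_left χ h _ _ ih => simp only [Edge, ih, AC.vars_eq h]
  | _ χ _ h1 h2 ih => simp only [Edge, ih]

theorem AC.clean_iff {φ ψ : Formula} (h : AC φ ψ) : φ.Clean ↔ ψ.Clean := by
  have h1 := Cong.linear h
  have h2 := h.constFree_iff
  have h3 := h.negv_eq
  constructor
  · rintro ⟨_, c, n⟩; exact ⟨h1.2, h2.mp c, by rw [negFree_iff] at *; rw [← h3, n]⟩
  · rintro ⟨_, c, n⟩; exact ⟨h1.1, h2.mpr c, by rw [negFree_iff] at *; rw [h3, n]⟩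

/-- The axioms for ∧ and for ∨ are De Morgan duals of each other. -/
theorem AC.neg {φ ψ : Formula} (h : AC φ ψ) : AC φ.neg ψ.neg := by
  induction h with
  | ax h h1 h2 =>
    refine .ax ?_ ((linear_neg _).mpr h1) ((linear_neg _).mpr h2)
    cases h <;> constructor
  | refl h => exact .refl ((linear_neg _).mpr h)
  | symm _ ih => exact .symm ih
  | trans _ _ ih1 ih2 => exact .trans ih1 ih2
  | and_right χ _ h1 h2 ih =>
    exact .or_right χ.neg ih ((linear_neg (.and _ _)).mpr h1) ((linear_neg (.and _ _)).mpr h2)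
  | and_left χ _ h1 h2 ih =>
    exact .or_left χ.neg ih ((linear_neg (.and _ _)).mpr h1) ((linear_neg (.and _ _)).mpr h2)
  | or_right χ _ h1 h2 ih =>
    exact .and_right χ.neg ih ((linear_neg (.or _ _)).mpr h1) ((linear_neg (.or _ _)).mpr h2)
  | or_left χ _ h1 h2 ih =>
    exact .and_left χ.neg ih ((linear_neg (.or _ _)).mpr h1) ((linear_neg (.or _ _)).mpr h2)

theorem AC.and_congr {a b c d : Formula} (h : AC a c) (h' : AC b d)
    (hd : Disjoint a.vars b.vars) : AC (and a b) (and c d) := by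
  have h1 := Cong.linear h
  have h2 := Cong.linear h'
  refine .trans (.and_right b h ⟨h1.1, h2.1, hd⟩ ⟨h1.2, h2.1, h.vars_eq ▸ hd⟩)
    (.and_left c h' ⟨h1.2, h2.1, h.vars_eq ▸ hd⟩ ⟨h1.2, h2.2, ?_⟩)
  rw [← h.vars_eq, ← h'.vars_eq]; exact hd

theorem AC.or_congr {a b c d : Formula} (h : AC a c) (h' : AC b d)
    (hd : Disjoint a.vars b.vars) : AC (or a b) (or c d) := by
  have := (AC.and_congr h.neg h'.neg (by simpa using hd)).neg
  simpa [Formula.neg] using this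

theorem AC.and_comm {a b : Formula} (h : (and a b).Linear) : AC (and a b) (and b a) :=
  .ax (.and_comm _ _) h ⟨h.2.1, h.1, h.2.2.symm⟩

theorem AC.and_assoc {a b c : Formula} (h : (and a (and b c)).Linear) :
    AC (and a (and b c)) (and (and a b) c) := by
  refine .ax (.and_assoc _ _ _) h ?_
  simp only [Linear, vars, Finset.disjoint_union_left, Finset.disjoint_union_right] at *
  tauto

theorem union_inter_eq_of_subset {P Q A B : Finset ℕ} (hd : Disjoint A B) (hv : P ∪ Q = A ∪ B)
    (hP : P ⊆ A) : P ∪ (Q ∩ A) = A ∧ Q ∩ B = B := by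
  rw [Finset.disjoint_left] at hd
  simp only [Finset.ext_iff, Finset.mem_union, Finset.mem_inter] at *
  constructor <;> intro x <;> have := hv x <;> have := @hP x <;> have := @hd x <;> tauto

theorem eq_of_union_eq_union {P Q A B : Finset ℕ} (hd : Disjoint A B) (hv : P ∪ Q = A ∪ B)
    (hP : P ⊆ A) (hQ : Q ⊆ B) : P = A ∧ Q = B := by
  rw [Finset.disjoint_left] at hd
  simp only [Finset.ext_iff, Finset.mem_union] at *
  constructor <;> intro x <;> have := hv x <;> have := @hP x <;> have := @hQ x <;>
    have := @hd x <;> tauto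

/-- A constant-free linear formula whose web is the join of its restrictions to `A` and `B` is a
conjunction of formulae on `A` and on `B`. -/
theorem exists_ac_and {φ : Formula} (hφ : φ.Linear) (hc : φ.ConstFree) (A B : Finset ℕ)
    (hA : A.Nonempty) (hB : B.Nonempty) (hd : Disjoint A B) (hv : φ.vars = A ∪ B)
    (he : ∀ a ∈ A, ∀ b ∈ B, φ.Edge a b) :
    ∃ α β, AC φ (and α β) ∧ α.vars = A ∧ β.vars = B := by
  induction φ generalizing A B with
  | top => exact hc.elim
  | bot => exact hc.elim
  | var z => obtain ⟨a, ha⟩ := hA; obtain ⟨b, hb⟩ := hB; exact (he a ha b hb).elim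
  | nvar z => obtain ⟨a, ha⟩ := hA; obtain ⟨b, hb⟩ := hB; exact (he a ha b hb).elim
  | or p q ihp ihq =>
    exfalso
    have hpq := hφ.2.2
    -- The web of a disjunction has no edges across, whereas `A` and `B` are completely joined: one
    -- node of `A` in `p` would pull all of `A` and `B` into `p` and leave nothing for `q`.
    have key : ∀ {p q A B : _}, Disjoint (vars p) (vars q) → (∀ a ∈ A, ∀ b ∈ B, (or p q).Edge a b) →
        vars p ∪ vars q = A ∪ B → q.vars.Nonempty → A.Nonempty → B.Nonempty → ∀ x ∈ p.vars, x ∉ A := by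
      intro p q A B hpq he hv hq hA hB x hx hxA
      have hBp : ∀ b ∈ B, b ∈ p.vars := fun b hb =>
        ((edge_or_left hpq hx).mp (he x hxA b hb)).mem.2
      have hAp : ∀ a ∈ A, a ∈ p.vars := by
        obtain ⟨b, hb⟩ := hB
        exact fun a ha => ((edge_or_left hpq (hBp b hb)).mp ((he a ha b hb).symm)).mem.2
      obtain ⟨y, hy⟩ := hq
      have : y ∈ A ∪ B := hv ▸ Finset.mem_union_right _ hy
      rcases Finset.mem_union.mp this with h | h
      · exact Finset.disjoint_left.mp hpq (hAp y h) hy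
      · exact Finset.disjoint_left.mp hpq (hBp y h) hy
    obtain ⟨x, hx⟩ := hc.1.vars_nonempty
    have h1 := key hpq he hv hc.2.vars_nonempty hA hB x hx
    have h2 := key hpq (fun a ha b hb => (he b hb a ha).symm)
      (hv.trans (Finset.union_comm _ _)) hc.2.vars_nonempty hB hA x hx
    have : x ∈ A ∪ B := hv ▸ Finset.mem_union_left _ hx
    rcases Finset.mem_union.mp this with h | h <;> contradiction
  | and p q ihp ihq =>
    -- each conjunct lies in one of the two sets or is split by them
    have hpq := hφ.2.2
    have hp : p.vars ⊆ A ∪ B := hv ▸ Finset.subset_union_left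
    have hq : q.vars ⊆ A ∪ B := hv ▸ Finset.subset_union_right
    have split : ∀ r : Formula, r.vars ⊆ A ∪ B →
        (∀ A' B' : Finset ℕ, A'.Nonempty → B'.Nonempty → Disjoint A' B' → r.vars = A' ∪ B' →
          (∀ a ∈ A', ∀ b ∈ B', r.Edge a b) → ∃ α β, AC r (and α β) ∧ α.vars = A' ∧ β.vars = B') →
        (∀ x ∈ r.vars, ∀ y ∈ r.vars, (and p q).Edge x y ↔ r.Edge x y) →
        r.vars ⊆ A ∨ r.vars ⊆ B ∨ ∃ α β, AC r (and α β) ∧ α.vars = r.vars ∩ A ∧ β.vars = r.vars ∩ B := by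
      intro r hr ih hre
      by_cases h1 : (r.vars ∩ A).Nonempty
      · by_cases h2 : (r.vars ∩ B).Nonempty
        · refine Or.inr (Or.inr (ih _ _ h1 h2 (hd.mono Finset.inter_subset_right
            Finset.inter_subset_right) ?_ ?_))
          · rw [← Finset.inter_union_distrib_left, Finset.inter_eq_left.mpr hr]
          · intro a ha b hb
            rw [Finset.mem_inter] at ha hb
            exact (hre a ha.1 b hb.1).mp (he a ha.2 b hb.2)
        · left
          intro x hx
          rcases Finset.mem_union.mp (hr hx) with h | h
          · exact h
          · exact absurd ⟨x, Finset.mem_inter.mpr ⟨hx, h⟩⟩ h2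
      · right; left
        intro x hx
        rcases Finset.mem_union.mp (hr hx) with h | h
        · exact absurd ⟨x, Finset.mem_inter.mpr ⟨hx, h⟩⟩ h1
        · exact h
    have hp3 := split p hp (fun A' B' h1 h2 h3 h4 h5 => ihp hφ.1 hc.1 A' B' h1 h2 h3 h4 h5)
      (fun x hx y hy => edge_and_left hpq hx hy)
    have hq3 := split q hq (fun A' B' h1 h2 h3 h4 h5 => ihq hφ.2.1 hc.2 A' B' h1 h2 h3 h4 h5)
      (fun x hx y hy => edge_and_right hpq hx hy)
    have hdA := Finset.disjoint_left.mp hd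
    simp only [vars] at hv
    have hv2 := (Finset.union_comm q.vars p.vars).trans hv
    have rp := Cong.refl (E := ACAxiom) hφ.1
    have rq := Cong.refl (E := ACAxiom) hφ.2.1
    -- Of the nine cases, two put everything on one side and contradict the non-emptiness of `A` or
    -- `B`; in the others the pieces on `A` and the pieces on `B` are collected by associativity and
    -- commutativity.
    rcases hp3 with h1 | h1 | ⟨α, β, h1, hα, hβ⟩
    · rcases hq3 with h2 | h2 | ⟨γ, δ, h2, hγ, hδ⟩
      · obtain ⟨b, hb⟩ := hB
        exact absurd hb (hdA (Finset.union_subset h1 h2 (hv ▸ Finset.mem_union_right _ hb)))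
      · exact ⟨p, q, .refl hφ, eq_of_union_eq_union hd hv h1 h2⟩
      · have e := AC.and_congr rp h2 hpq
        have := union_inter_eq_of_subset hd hv h1
        exact ⟨and p γ, δ, e.trans (AC.and_assoc (Cong.linear e).2), by rw [vars, hγ, this.1],
          hδ.trans this.2⟩
    · rcases hq3 with h2 | h2 | ⟨γ, δ, h2, hγ, hδ⟩
      · exact ⟨q, p, AC.and_comm hφ, eq_of_union_eq_union hd hv2 h2 h1⟩
      · obtain ⟨a, ha⟩ := hA
        exact absurd (Finset.union_subset h1 h2 (hv ▸ Finset.mem_union_left _ ha)) (hdA ha)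
      · have := union_inter_eq_of_subset hd.symm (hv.trans (Finset.union_comm _ _)) h1
        have e := AC.and_congr rp h2 hpq
        have l := (Cong.linear e).2
        have l1 : (and δ γ).Linear := ⟨l.2.1.2.1, l.2.1.1, l.2.1.2.2.symm⟩
        have l2 : (and p (and δ γ)).Linear := ⟨l.1, l1, by
          have := l.2.2; simp only [vars] at *; rwa [Finset.union_comm]⟩
        have e1 := (e.trans (.and_left p (AC.and_comm l.2.1) l l2)).trans (AC.and_assoc l2)
        exact ⟨γ, and p δ, e1.trans (AC.and_comm (Cong.linear e1).2), hγ.trans this.2,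
          by rw [vars, hδ, this.1]⟩
    · rcases hq3 with h2 | h2 | ⟨γ, δ, h2, hγ, hδ⟩
      · have := union_inter_eq_of_subset hd hv2 h2
        have e := AC.and_congr rq h1 hpq.symm
        exact ⟨and q α, β, ((AC.and_comm hφ).trans e).trans (AC.and_assoc (Cong.linear e).2),
          by rw [vars, hα, this.1], hβ.trans this.2⟩
      · have := union_inter_eq_of_subset hd.symm (hv2.trans (Finset.union_comm _ _)) h2
        have e := AC.and_congr rq h1 hpq.symm
        have l := (Cong.linear e).2
        have l1 : (and β α).Linear := ⟨l.2.1.2.1, l.2.1.1, l.2.1.2.2.symm⟩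
        have l2 : (and q (and β α)).Linear := ⟨l.1, l1, by
          have := l.2.2; simp only [vars] at *; rwa [Finset.union_comm]⟩
        have e1 := ((AC.and_comm hφ).trans (e.trans (.and_left q (AC.and_comm l.2.1) l l2))).trans
          (AC.and_assoc l2)
        exact ⟨α, and q β, e1.trans (AC.and_comm (Cong.linear e1).2), hα.trans this.2,
          by rw [vars, hβ, this.1]⟩
      · have e := AC.and_congr h1 h2 hpq
        have l := (Cong.linear e).2
        have hl : (and α (and γ (and β δ))).Linear ∧
            (and (and γ β) δ).Linear ∧ (and (and β γ) δ).Linear ∧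
            (and α (and β (and γ δ))).Linear ∧ (and β (and γ δ)).Linear
            ∧ (and γ (and β δ)).Linear ∧ (and β γ).Linear := by
          simp only [Linear, vars, Finset.disjoint_union_left, Finset.disjoint_union_right] at l
          obtain ⟨⟨a1, a2, a3⟩, ⟨a4, a5, a6⟩, ⟨a7, a8⟩, a9, a10⟩ := l
          simp only [Linear, vars, Finset.disjoint_union_left, Finset.disjoint_union_right,
            a1, a2, a3, a4, a5, a6, a7, a8, a9, a10, a8.symm, and_self]
        obtain ⟨l2, l3, l4, l7, l8, l9, l10⟩ := hl
        have s1 : AC (and (and α β) (and γ δ)) (and α (and β (and γ δ))) := (AC.and_assoc l7).symm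
        have s2 : AC (and β (and γ δ)) (and γ (and β δ)) :=
          ((AC.and_assoc l8).trans (.and_right δ (AC.and_comm l10) l4 l3)).trans
            (AC.and_assoc l9).symm
        have s3 : AC (and α (and β (and γ δ))) (and α (and γ (and β δ))) := .and_left α s2 l7 l2
        have s4 : AC (and α (and γ (and β δ))) (and (and α γ) (and β δ)) := AC.and_assoc l2
        refine ⟨and α γ, and β δ, ((e.trans s1).trans s3).trans s4, ?_, ?_⟩
        · rw [vars, hα, hγ, ← Finset.union_inter_distrib_right, hv]; simp
        · rw [vars, hβ, hδ, ← Finset.union_inter_distrib_right, hv]; simp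

/-- Dual to `exists_ac_and`, which is applied to the negation, whose web is the complement. -/
theorem exists_ac_or {φ : Formula} (hφ : φ.Linear) (hc : φ.ConstFree) (A B : Finset ℕ)
    (hA : A.Nonempty) (hB : B.Nonempty) (hd : Disjoint A B) (hv : φ.vars = A ∪ B)
    (he : ∀ a ∈ A, ∀ b ∈ B, ¬ φ.Edge a b) :
    ∃ α β, AC φ (or α β) ∧ α.vars = A ∧ β.vars = B := by
  obtain ⟨α, β, h, h1, h2⟩ := exists_ac_and ((linear_neg φ).mpr hφ) ((constFree_neg φ).mpr hc) A B
    hA hB hd ((vars_neg φ).trans hv) (fun a ha b hb => by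
      rw [edge_neg hφ, hv]
      exact ⟨Finset.mem_union_left _ ha, Finset.mem_union_right _ hb,
        fun e => Finset.disjoint_left.mp hd ha (e ▸ hb), he a ha b hb⟩)
  exact ⟨α.neg, β.neg, by simpa [Formula.neg] using h.neg, by simpa using h1, by simpa using h2⟩

/-- Constant-free linear formulae are determined up to associativity and commutativity by their
literals and their web. -/
theorem ac_of_edge_iff {φ ψ : Formula} (hφ : φ.Linear) (hψ : ψ.Linear) (cφ : φ.ConstFree)
    (cψ : ψ.ConstFree) (hv : φ.vars = ψ.vars) (hn : φ.negv = ψ.negv)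
    (he : ∀ x y, φ.Edge x y ↔ ψ.Edge x y) : AC φ ψ := by
  -- Negative variables belong to the variables of their own side, so equal unions of `negv` over
  -- disjoint sides split into equal parts.
  have key : ∀ {α β p q : Formula}, α.vars = p.vars → β.vars = q.vars → Disjoint p.vars q.vars →
      p.negv ∪ q.negv = α.negv ∪ β.negv → p.negv = α.negv := by
    intro α β p q h1 h2 hd hn
    ext x
    have h := Finset.ext_iff.mp hn x
    simp only [Finset.mem_union] at h
    have a1 := @negv_subset p x
    have a2 := @negv_subset q x
    have a3 := @negv_subset α x
    have a4 := @negv_subset β x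
    rw [h1] at a3; rw [h2] at a4
    have : x ∈ p.vars → x ∉ q.vars := fun h => Finset.disjoint_left.mp hd h
    tauto
  induction φ generalizing ψ with
  | top => exact cφ.elim
  | bot => exact cφ.elim
  | var x =>
    have hs : ∀ a b : Formula, Disjoint a.vars b.vars → a.vars.Nonempty → b.vars.Nonempty →
        a.vars ∪ b.vars ≠ {x} := by
      rintro a b hd ⟨u, hu⟩ ⟨v, hv⟩ h
      have h1 : u = x := by simpa [h] using Finset.mem_union_left b.vars hu
      have h2 : v = x := by simpa [h] using Finset.mem_union_right a.vars hv
      exact Finset.disjoint_left.mp hd hu (by rw [h1, ← h2]; exact hv)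
    cases ψ with
    | top => exact cψ.elim
    | bot => exact cψ.elim
    | var y => simp only [vars, Finset.singleton_inj] at hv; subst hv; exact .refl trivial
    | nvar y => simp [negv] at hn
    | and a b => exact absurd hv.symm (hs a b hψ.2.2 cψ.1.vars_nonempty cψ.2.vars_nonempty)
    | or a b => exact absurd hv.symm (hs a b hψ.2.2 cψ.1.vars_nonempty cψ.2.vars_nonempty)
  | nvar x =>
    have hs : ∀ a b : Formula, Disjoint a.vars b.vars → a.vars.Nonempty → b.vars.Nonempty →
        a.vars ∪ b.vars ≠ {x} := by
      rintro a b hd ⟨u, hu⟩ ⟨v, hv⟩ h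
      have h1 : u = x := by simpa [h] using Finset.mem_union_left b.vars hu
      have h2 : v = x := by simpa [h] using Finset.mem_union_right a.vars hv
      exact Finset.disjoint_left.mp hd hu (by rw [h1, ← h2]; exact hv)
    cases ψ with
    | top => exact cψ.elim
    | bot => exact cψ.elim
    | var y => simp [negv] at hn
    | nvar y => simp only [vars, Finset.singleton_inj] at hv; subst hv; exact .refl trivial
    | and a b => exact absurd hv.symm (hs a b hψ.2.2 cψ.1.vars_nonempty cψ.2.vars_nonempty)
    | or a b => exact absurd hv.symm (hs a b hψ.2.2 cψ.1.vars_nonempty cψ.2.vars_nonempty)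
  | and p q ihp ihq =>
    -- The root connective of `φ` and the variables of its two arguments can be read off the web, so
    -- `ψ` can be brought to the same shape at the root.
    obtain ⟨α, β, h, h1, h2⟩ := exists_ac_and hψ cψ p.vars q.vars cφ.1.vars_nonempty
      cφ.2.vars_nonempty hφ.2.2 hv.symm
      (fun a ha b hb => (he a b).mp (Or.inr (Or.inr (Or.inl ⟨ha, hb⟩))))
    have hl := (Cong.linear h).2
    have hc := h.constFree_iff.mp cψ
    have hn' : p.negv ∪ q.negv = α.negv ∪ β.negv := hn.trans h.negv_eq
    have e : ∀ x y, (and p q).Edge x y ↔ (and α β).Edge x y := fun x y =>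
      (he x y).trans (h.edge_iff x y)
    have ep : AC p α := by
      refine ihp hφ.1 hl.1 cφ.1 hc.1 h1.symm (key h1 h2 hφ.2.2 hn') fun x y => ?_
      by_cases hx : x ∈ p.vars ∧ y ∈ p.vars
      · rw [← edge_and_left hφ.2.2 hx.1 hx.2, e, edge_and_left hl.2.2 (h1 ▸ hx.1) (h1 ▸ hx.2)]
      · exact ⟨fun h => absurd h.mem hx, fun h => absurd h.mem (h1 ▸ hx)⟩
    have eq : AC q β := by
      refine ihq hφ.2.1 hl.2.1 cφ.2 hc.2 h2.symm (key h2 h1 hφ.2.2.symm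
        (by rw [Finset.union_comm, hn', Finset.union_comm])) fun x y => ?_
      by_cases hx : x ∈ q.vars ∧ y ∈ q.vars
      · rw [← edge_and_right hφ.2.2 hx.1 hx.2, e, edge_and_right hl.2.2 (h2 ▸ hx.1) (h2 ▸ hx.2)]
      · exact ⟨fun h => absurd h.mem hx, fun h => absurd h.mem (h2 ▸ hx)⟩
    exact (AC.and_congr ep eq hφ.2.2).trans h.symm
  | or p q ihp ihq =>
    obtain ⟨α, β, h, h1, h2⟩ := exists_ac_or hψ cψ p.vars q.vars cφ.1.vars_nonempty
      cφ.2.vars_nonempty hφ.2.2 hv.symm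
      (fun a ha b hb h => Finset.disjoint_left.mp hφ.2.2
        ((edge_or_left hφ.2.2 ha).mp ((he a b).mpr h)).mem.2 hb)
    have hl := (Cong.linear h).2
    have hc := h.constFree_iff.mp cψ
    have hn' : p.negv ∪ q.negv = α.negv ∪ β.negv := hn.trans h.negv_eq
    have e : ∀ x y, (or p q).Edge x y ↔ (or α β).Edge x y := fun x y =>
      (he x y).trans (h.edge_iff x y)
    have ep : AC p α := by
      refine ihp hφ.1 hl.1 cφ.1 hc.1 h1.symm (key h1 h2 hφ.2.2 hn') fun x y => ?_
      by_cases hx : x ∈ p.vars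
      · rw [← edge_or_left hφ.2.2 hx, e, edge_or_left hl.2.2 (h1 ▸ hx)]
      · exact ⟨fun h => absurd h.mem.1 hx, fun h => absurd h.mem.1 (h1 ▸ hx)⟩
    have eq : AC q β := by
      refine ihq hφ.2.1 hl.2.1 cφ.2 hc.2 h2.symm (key h2 h1 hφ.2.2.symm
        (by rw [Finset.union_comm, hn', Finset.union_comm])) fun x y => ?_
      by_cases hx : x ∈ q.vars
      · rw [← edge_or_right hφ.2.2 hx, e, edge_or_right hl.2.2 (h2 ▸ hx)]
      · exact ⟨fun h => absurd h.mem.1 hx, fun h => absurd h.mem.1 (h2 ▸ hx)⟩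
    exact (AC.or_congr ep eq hφ.2.2).trans h.symm

/-! ### Minterms and maximal cliques -/

namespace Formula

/-- `φ.Minterm P`: the conjunction of `P` is a minterm of the negation-free formula `φ`. -/
def Minterm : Formula → Finset ℕ → Prop
  | top, P => P = ∅
  | bot, _ => False
  | var x, P => P = {x}
  | nvar x, P => P = {x}
  | and φ ψ, P => ∃ Q R, φ.Minterm Q ∧ ψ.Minterm R ∧ P = Q ∪ R
  | or φ ψ, P => φ.Minterm P ∨ ψ.Minterm P

theorem eval_eq_true_iff {φ : Formula} (h : φ.NegFree) (α : ℕ → Bool) :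
    φ.eval α = true ↔ ∃ P, φ.Minterm P ∧ ∀ x ∈ P, α x = true := by
  induction φ with
  | top => simp [eval, Minterm]
  | bot => simp [eval, Minterm]
  | var x => simp [eval, Minterm]
  | nvar x => exact h.elim
  | and a b iha ihb =>
    simp only [eval, Bool.and_eq_true, iha h.1, ihb h.2, Minterm]
    constructor
    · rintro ⟨⟨P, hP, h1⟩, Q, hQ, h2⟩
      exact ⟨P ∪ Q, ⟨P, Q, hP, hQ, rfl⟩, fun x hx => (Finset.mem_union.mp hx).elim (h1 x) (h2 x)⟩
    · rintro ⟨_, ⟨P, Q, hP, hQ, rfl⟩, h⟩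
      exact ⟨⟨P, hP, fun x hx => h x (Finset.mem_union_left _ hx)⟩,
        Q, hQ, fun x hx => h x (Finset.mem_union_right _ hx)⟩
  | or a b iha ihb =>
    simp only [eval, Bool.or_eq_true, iha h.1, ihb h.2, Minterm, or_and_right, exists_or]

theorem Minterm.subset {φ : Formula} {P : Finset ℕ} (h : φ.Minterm P) : P ⊆ φ.vars := by
  induction φ generalizing P with
  | top => simp only [Minterm] at h; simp [h]
  | bot => exact h.elim
  | var x => simp only [Minterm] at h; simp [h, vars]
  | nvar x => simp only [Minterm] at h; simp [h, vars]
  | and a b iha ihb =>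
    obtain ⟨Q, R, hQ, hR, rfl⟩ := h
    exact Finset.union_subset_union (iha hQ) (ihb hR)
  | or a b iha ihb =>
    exact h.elim (fun h => (iha h).trans Finset.subset_union_left)
      (fun h => (ihb h).trans Finset.subset_union_right)

/-- The shape is that of the base case of `minterm_iff`: a literal has no edges, so each `Edge`
there unfolds to `False`. -/
theorem eq_singleton_iff_of_subset {P : Finset ℕ} {z : ℕ} : P = {z} ↔ P ⊆ {z} ∧
    (∀ x ∈ P, ∀ y ∈ P, x ≠ y → False) ∧ ∀ w ∈ ({z} : Finset ℕ), w ∉ P → ∃ x ∈ P, ¬ False := by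
  constructor
  · rintro rfl
    exact ⟨Finset.Subset.refl _, by simp, fun w hw hw' => absurd hw hw'⟩
  · rintro ⟨h1, -, h3⟩
    rcases Finset.subset_singleton_iff.mp h1 with rfl | h
    · obtain ⟨x, hx, -⟩ := h3 z (by simp) (by simp); simp at hx
    · exact h

/-- The minterms of a linear formula are the maximal cliques of its web. -/
theorem minterm_iff {φ : Formula} (hφ : φ.Linear) (hc : φ.ConstFree) (P : Finset ℕ) :
    φ.Minterm P ↔ P ⊆ φ.vars ∧ (∀ x ∈ P, ∀ y ∈ P, x ≠ y → φ.Edge x y) ∧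
      ∀ z ∈ φ.vars, z ∉ P → ∃ x ∈ P, ¬ φ.Edge x z := by
  induction φ generalizing P with
  | top => exact hc.elim
  | bot => exact hc.elim
  | var z => exact eq_singleton_iff_of_subset
  | nvar z => exact eq_singleton_iff_of_subset
  | and a b iha ihb =>
    have hd := hφ.2.2
    have iha := fun P => iha hφ.1 hc.1 P
    have ihb := fun P => ihb hφ.2.1 hc.2 P
    constructor
    · rintro ⟨Q, R, hQ, hR, rfl⟩
      obtain ⟨q1, q2, q3⟩ := (iha Q).mp hQ
      obtain ⟨r1, r2, r3⟩ := (ihb R).mp hR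
      refine ⟨Finset.union_subset_union q1 r1, ?_, ?_⟩
      · intro x hx y hy hxy
        rcases Finset.mem_union.mp hx with hx | hx <;> rcases Finset.mem_union.mp hy with hy | hy
        · exact Or.inl (q2 x hx y hy hxy)
        · exact Or.inr (Or.inr (Or.inl ⟨q1 hx, r1 hy⟩))
        · exact Or.inr (Or.inr (Or.inr ⟨r1 hx, q1 hy⟩))
        · exact Or.inr (Or.inl (r2 x hx y hy hxy))
      · intro z hz hzP
        rw [Finset.mem_union, not_or] at hzP
        rcases Finset.mem_union.mp hz with hz | hz
        · obtain ⟨x, hx, h⟩ := q3 z hz hzP.1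
          exact ⟨x, Finset.mem_union_left _ hx, by rwa [edge_and_left hd (q1 hx) hz]⟩
        · obtain ⟨x, hx, h⟩ := r3 z hz hzP.2
          exact ⟨x, Finset.mem_union_right _ hx, by rwa [edge_and_right hd (r1 hx) hz]⟩
    · rintro ⟨h1, h2, h3⟩
      refine ⟨P ∩ a.vars, P ∩ b.vars, (iha _).mpr ⟨Finset.inter_subset_right, ?_, ?_⟩,
        (ihb _).mpr ⟨Finset.inter_subset_right, ?_, ?_⟩, ?_⟩
      · intro x hx y hy hxy
        rw [Finset.mem_inter] at hx hy
        exact (edge_and_left hd hx.2 hy.2).mp (h2 x hx.1 y hy.1 hxy)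
      · intro z hz hzP
        obtain ⟨x, hx, h⟩ := h3 z (Finset.mem_union_left _ hz)
          (fun h => hzP (Finset.mem_inter.mpr ⟨h, hz⟩))
        simp only [Edge, not_or, not_and] at h
        have hxa : x ∈ a.vars := (Finset.mem_union.mp (h1 hx)).resolve_right fun h' =>
          h.2.2.2 h' hz
        exact ⟨x, Finset.mem_inter.mpr ⟨hx, hxa⟩, h.1⟩
      · intro x hx y hy hxy
        rw [Finset.mem_inter] at hx hy
        exact (edge_and_right hd hx.2 hy.2).mp (h2 x hx.1 y hy.1 hxy)
      · intro z hz hzP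
        obtain ⟨x, hx, h⟩ := h3 z (Finset.mem_union_right _ hz)
          (fun h => hzP (Finset.mem_inter.mpr ⟨h, hz⟩))
        simp only [Edge, not_or, not_and] at h
        have hxb : x ∈ b.vars := (Finset.mem_union.mp (h1 hx)).resolve_left fun h' =>
          h.2.2.1 h' hz
        exact ⟨x, Finset.mem_inter.mpr ⟨hx, hxb⟩, h.2.1⟩
      · rw [← Finset.inter_union_distrib_left]; exact (Finset.inter_eq_left.mpr h1).symm
  | or a b iha ihb =>
    -- A non-empty clique of a disjunction lies on one side, and then no node of the other side is
    -- adjacent to its members. Non-emptiness of `P` is needed to name such a member.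
    have side : ∀ {a b : Formula}, Disjoint a.vars b.vars → b.ConstFree →
        (∀ x y, x ∈ a.vars → ((or a b).Edge x y ↔ a.Edge x y)) →
        ((P ⊆ a.vars ∧ (∀ x ∈ P, ∀ y ∈ P, x ≠ y → a.Edge x y) ∧
            ∀ z ∈ a.vars, z ∉ P → ∃ x ∈ P, ¬ a.Edge x z) ∧ P.Nonempty ↔
          P ⊆ a.vars ∧ P.Nonempty ∧ (∀ x ∈ P, ∀ y ∈ P, x ≠ y → (or a b).Edge x y) ∧
            ∀ z ∈ (or a b).vars, z ∉ P → ∃ x ∈ P, ¬ (or a b).Edge x z) := by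
      intro a b hd hb he
      constructor
      · rintro ⟨⟨h1, h2, h3⟩, h4⟩
        refine ⟨h1, h4, fun x hx y hy hxy => (he x y (h1 hx)).mpr (h2 x hx y hy hxy), ?_⟩
        intro z hz hzP
        rcases Finset.mem_union.mp hz with hz | hz
        · obtain ⟨x, hx, h⟩ := h3 z hz hzP
          exact ⟨x, hx, by rwa [he x z (h1 hx)]⟩
        · obtain ⟨x, hx⟩ := h4
          refine ⟨x, hx, fun h => ?_⟩
          exact Finset.disjoint_left.mp hd (((he x z (h1 hx)).mp h).mem.2) hz
      · rintro ⟨h1, h4, h2, h3⟩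
        refine ⟨⟨h1, fun x hx y hy hxy => (he x y (h1 hx)).mp (h2 x hx y hy hxy), ?_⟩, h4⟩
        intro z hz hzP
        obtain ⟨x, hx, h⟩ := h3 z (Finset.mem_union_left _ hz) hzP
        exact ⟨x, hx, by rwa [← he x z (h1 hx)]⟩
    have ne : ∀ {a : Formula}, a.ConstFree → (∀ z ∈ a.vars, z ∉ P → ∃ x ∈ P, ¬ a.Edge x z) →
        P.Nonempty := by
      intro a ha h
      obtain ⟨z, hz⟩ := ha.vars_nonempty
      by_cases hzP : z ∈ P
      · exact ⟨z, hzP⟩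
      · obtain ⟨x, hx, -⟩ := h z hz hzP; exact ⟨x, hx⟩
    have hcomm : ∀ x y, (or a b).Edge x y ↔ (or b a).Edge x y := fun x y => Or.comm
    have s1 := side hφ.2.2 hc.2 (fun x y hx => edge_or_left hφ.2.2 hx)
    have s2 := side hφ.2.2.symm hc.1 (fun x y hx => edge_or_left hφ.2.2.symm hx)
    simp only [Minterm]
    rw [iha hφ.1 hc.1, ihb hφ.2.1 hc.2]
    have hvc : (or b a).vars = (or a b).vars := Finset.union_comm _ _
    simp only [← hcomm, hvc] at s2
    constructor
    · rintro (h | h)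
      · obtain ⟨h1, -, h2⟩ := s1.mp ⟨h, ne hc.1 h.2.2⟩
        exact ⟨h1.trans Finset.subset_union_left, h2⟩
      · obtain ⟨h1, -, h2⟩ := s2.mp ⟨h, ne hc.2 h.2.2⟩
        exact ⟨h1.trans Finset.subset_union_right, h2⟩
    · rintro ⟨h1, h2, h3⟩
      have hne : P.Nonempty := ne (a := or a b) hc h3
      obtain ⟨x, hx⟩ := hne
      rcases Finset.mem_union.mp (h1 hx) with hxa | hxb
      · left
        refine (s1.mpr ⟨fun y hy => ?_, ⟨x, hx⟩, h2, h3⟩).1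
        by_cases e : x = y
        · exact e ▸ hxa
        · exact ((edge_or_left hφ.2.2 hxa).mp (h2 x hx y hy e)).mem.2
      · right
        refine (s2.mpr ⟨fun y hy => ?_, ⟨x, hx⟩, h2, h3⟩).1
        by_cases e : x = y
        · exact e ▸ hxb
        · exact ((edge_or_right hφ.2.2 hxb).mp (h2 x hx y hy e)).mem.2

/-- Maximal cliques are pairwise incomparable: a node of `P` outside `Q` would be adjacent to all of
`Q`. -/
theorem Minterm.eq_of_subset {φ : Formula} (hφ : φ.Linear) (hc : φ.ConstFree) {P Q : Finset ℕ}
    (hP : φ.Minterm P) (hQ : φ.Minterm Q) (h : Q ⊆ P) : Q = P := by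
  rw [minterm_iff hφ hc] at hP hQ
  refine h.antisymm fun z hz => ?_
  by_contra hzQ
  obtain ⟨x, hx, hxz⟩ := hQ.2.2 z (hP.1 hz) hzQ
  exact hxz (hP.2.1 x (h hx) z hz (fun e => hzQ (e ▸ hx)))

theorem exists_minterm {φ : Formula} (hc : φ.ConstFree) : ∃ P, φ.Minterm P := by
  induction φ with
  | top => exact hc.elim
  | bot => exact hc.elim
  | var x => exact ⟨_, rfl⟩
  | nvar x => exact ⟨_, rfl⟩
  | and a b iha ihb =>
    obtain ⟨P, hP⟩ := iha hc.1
    obtain ⟨Q, hQ⟩ := ihb hc.2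
    exact ⟨_, P, Q, hP, hQ, rfl⟩
  | or a b iha ihb =>
    obtain ⟨P, hP⟩ := iha hc.1
    exact ⟨P, Or.inl hP⟩

theorem exists_minterm_mem {φ : Formula} (hc : φ.ConstFree) {x : ℕ} (hx : x ∈ φ.vars) :
    ∃ P, φ.Minterm P ∧ x ∈ P := by
  induction φ with
  | top => exact hc.elim
  | bot => exact hc.elim
  | var z => exact ⟨_, rfl, hx⟩
  | nvar z => exact ⟨_, rfl, hx⟩
  | and a b iha ihb =>
    rcases Finset.mem_union.mp hx with hx | hx
    · obtain ⟨P, hP, h⟩ := iha hc.1 hx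
      obtain ⟨Q, hQ⟩ := exists_minterm hc.2
      exact ⟨_, ⟨P, Q, hP, hQ, rfl⟩, Finset.mem_union_left _ h⟩
    · obtain ⟨P, hP, h⟩ := ihb hc.2 hx
      obtain ⟨Q, hQ⟩ := exists_minterm hc.1
      exact ⟨_, ⟨Q, P, hQ, hP, rfl⟩, Finset.mem_union_right _ h⟩
  | or a b iha ihb =>
    rcases Finset.mem_union.mp hx with hx | hx
    · obtain ⟨P, hP, h⟩ := iha hc.1 hx; exact ⟨P, Or.inl hP, h⟩
    · obtain ⟨P, hP, h⟩ := ihb hc.2 hx; exact ⟨P, Or.inr hP, h⟩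

/-- This is what makes the web recoverable from the minterms, and hence from the truth table. -/
theorem exists_minterm_of_edge {φ : Formula} (hc : φ.ConstFree) {x y : ℕ} (h : φ.Edge x y) :
    ∃ P, φ.Minterm P ∧ x ∈ P ∧ y ∈ P := by
  induction φ with
  | top => exact hc.elim
  | bot => exact hc.elim
  | var z => exact h.elim
  | nvar z => exact h.elim
  | and a b iha ihb =>
    rcases h with h | h | h | h
    · obtain ⟨P, hP, h1, h2⟩ := iha hc.1 h
      obtain ⟨Q, hQ⟩ := exists_minterm hc.2
      exact ⟨_, ⟨P, Q, hP, hQ, rfl⟩, Finset.mem_union_left _ h1, Finset.mem_union_left _ h2⟩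
    · obtain ⟨P, hP, h1, h2⟩ := ihb hc.2 h
      obtain ⟨Q, hQ⟩ := exists_minterm hc.1
      exact ⟨_, ⟨Q, P, hQ, hP, rfl⟩, Finset.mem_union_right _ h1, Finset.mem_union_right _ h2⟩
    · obtain ⟨P, hP, h1⟩ := exists_minterm_mem hc.1 h.1
      obtain ⟨Q, hQ, h2⟩ := exists_minterm_mem hc.2 h.2
      exact ⟨_, ⟨P, Q, hP, hQ, rfl⟩, Finset.mem_union_left _ h1, Finset.mem_union_right _ h2⟩
    · obtain ⟨P, hP, h1⟩ := exists_minterm_mem hc.1 h.2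
      obtain ⟨Q, hQ, h2⟩ := exists_minterm_mem hc.2 h.1
      exact ⟨_, ⟨P, Q, hP, hQ, rfl⟩, Finset.mem_union_right _ h2, Finset.mem_union_left _ h1⟩
  | or a b iha ihb =>
    rcases h with h | h
    · obtain ⟨P, hP, h⟩ := iha hc.1 h; exact ⟨P, Or.inl hP, h⟩
    · obtain ⟨P, hP, h⟩ := ihb hc.2 h; exact ⟨P, Or.inr hP, h⟩

/-- Logically equivalent formulae have the same minterms. -/
theorem LogEquiv.minterm {φ ψ : Formula} (hφ : φ.Clean) (hψ : ψ.Clean) (h : LogEquiv φ ψ)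
    {P : Finset ℕ} (hP : φ.Minterm P) : ψ.Minterm P := by
  have step : ∀ {φ ψ : Formula}, φ.Clean → ψ.Clean → LogEquiv φ ψ → ∀ {P}, φ.Minterm P →
      ∃ Q, ψ.Minterm Q ∧ Q ⊆ P := by
    intro φ ψ hφ hψ h P hP
    have h1 : φ.eval (fun x => decide (x ∈ P)) = true :=
      (eval_eq_true_iff hφ.negFree _).mpr ⟨P, hP, by simp⟩
    rw [h, eval_eq_true_iff hψ.negFree] at h1
    obtain ⟨Q, hQ, h1⟩ := h1
    exact ⟨Q, hQ, fun x hx => by simpa using h1 x hx⟩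
  -- Passing to `ψ` and back gives `R ⊆ Q ⊆ P` with `R` and `P` minterms of `φ`, so incomparability
  -- forces all three to be equal.
  obtain ⟨Q, hQ, hQP⟩ := step hφ hψ h hP
  obtain ⟨R, hR, hRQ⟩ := step hψ hφ h.symm hQ
  have e := Minterm.eq_of_subset hφ.linear hφ.constFree hP hR (hRQ.trans hQP)
  rwa [show P = Q from (e ▸ hRQ).antisymm hQP]

theorem LogEquiv.vars_eq {φ ψ : Formula} (hφ : φ.Clean) (hψ : ψ.Clean) (h : LogEquiv φ ψ) :
    φ.vars = ψ.vars := by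
  have : ∀ {φ ψ : Formula}, φ.Clean → ψ.Clean → LogEquiv φ ψ → φ.vars ⊆ ψ.vars := by
    intro φ ψ hφ hψ h x hx
    obtain ⟨P, hP, hxP⟩ := exists_minterm_mem hφ.constFree hx
    exact (h.minterm hφ hψ hP).subset hxP
  exact (this hφ hψ h).antisymm (this hψ hφ h.symm)

theorem LogEquiv.edge_iff {φ ψ : Formula} (hφ : φ.Clean) (hψ : ψ.Clean) (h : LogEquiv φ ψ)
    (x y : ℕ) : φ.Edge x y ↔ ψ.Edge x y := by
  have : ∀ {φ ψ : Formula}, φ.Clean → ψ.Clean → LogEquiv φ ψ → φ.Edge x y → ψ.Edge x y := by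
    intro φ ψ hφ hψ h he
    obtain ⟨P, hP, hxP, hyP⟩ := exists_minterm_of_edge hφ.constFree he
    exact ((minterm_iff hψ.linear hψ.constFree P).mp (h.minterm hφ hψ hP)).2.1 x hxP y hyP
      (he.ne hφ.linear)
  exact ⟨this hφ hψ h, this hψ hφ h.symm⟩

theorem Clean.ac_of_edge_iff {φ ψ : Formula} (hφ : φ.Clean) (hψ : ψ.Clean)
    (hv : φ.vars = ψ.vars) (he : ∀ x y, φ.Edge x y ↔ ψ.Edge x y) : AC φ ψ :=
  LinearInference.ac_of_edge_iff hφ.linear hψ.linear hφ.constFree hψ.constFree hv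
    (by rw [(negFree_iff φ).mp hφ.negFree, (negFree_iff ψ).mp hψ.negFree]) he

/-- Truth table, minterms, web and `AC`-class determine one another. Because of this, later
arguments work with `LogEquiv` and return to `AC` only at the end. -/
theorem LogEquiv.ac {φ ψ : Formula} (h : LogEquiv φ ψ) (hφ : φ.Clean) (hψ : ψ.Clean) : AC φ ψ :=
  hφ.ac_of_edge_iff hψ (h.vars_eq hφ hψ) (h.edge_iff hφ hψ)

end Formula
end LinearInference

namespace LinearInference
open Formula

/-! ### Cographs -/

/-- No four nodes in `V` induce a path. -/
def P4FreeOn (E : ℕ → ℕ → Prop) (V : Finset ℕ) : Prop :=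
  ∀ a ∈ V, ∀ b ∈ V, ∀ c ∈ V, ∀ d ∈ V, a ≠ b → a ≠ c → a ≠ d → b ≠ c → b ≠ d → c ≠ d →
    ¬ (E a b ∧ E b c ∧ E c d ∧ ¬ E a c ∧ ¬ E b d ∧ ¬ E a d)

/-- `V` is the disjoint union or the join of two non-empty parts. -/
def Splits (E : ℕ → ℕ → Prop) (V : Finset ℕ) : Prop :=
  ∃ A B : Finset ℕ, A.Nonempty ∧ B.Nonempty ∧ Disjoint A B ∧ V = A ∪ B ∧
    ((∀ a ∈ A, ∀ b ∈ B, E a b) ∨ ∀ a ∈ A, ∀ b ∈ B, ¬ E a b)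

/-- P₄ is self-complementary: a path `a, b, c, d` in the complement is the path `b, d, a, c` in the
graph. -/
theorem P4FreeOn.compl {E : ℕ → ℕ → Prop} {V : Finset ℕ} (hs : ∀ x y, E x y → E y x)
    (h : P4FreeOn E V) : P4FreeOn (fun x y => ¬ E x y) V := by
  rintro a ha b hb c hc d hd h1 h2 h3 h4 h5 h6 ⟨p1, p2, p3, p4, p5, p6⟩
  simp only [not_not] at *
  exact h b hb d hd a ha c hc h5 h1.symm h4 h3.symm h6.symm h2
    ⟨p5, hs _ _ p6, p4, fun e => p1 (hs _ _ e), fun e => p3 (hs _ _ e), p2⟩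

theorem Splits.compl {E : ℕ → ℕ → Prop} {V : Finset ℕ} (h : Splits (fun x y => ¬ E x y) V) :
    Splits E V := by
  obtain ⟨A, B, h1, h2, h3, h4, h5 | h5⟩ := h
  · exact ⟨A, B, h1, h2, h3, h4, Or.inr h5⟩
  · exact ⟨A, B, h1, h2, h3, h4, Or.inl (by simpa using h5)⟩

theorem P4FreeOn.mono {E : ℕ → ℕ → Prop} {V W : Finset ℕ} (h : P4FreeOn E V) (hW : W ⊆ V) :
    P4FreeOn E W := fun a ha b hb c hc d hd => h a (hW ha) b (hW hb) c (hW hc) d (hW hd)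

-- Unless `v` is joined to all of `V`, some `y` is not a neighbour of `v`; let `K` be the component
-- of `y` in `V`. If `v` has no neighbour in `K`, then `K` splits off. If it has one, P₄-freeness
-- forbids neighbours of `v` outside `K`, and `V \ K`, which is non-empty since `V` is disconnected,
-- splits off.
open Classical in
theorem splits_insert_of_disconnected {E : ℕ → ℕ → Prop} {V A B : Finset ℕ} {v : ℕ}
    (hs : ∀ x y, E x y → E y x) (h : P4FreeOn E (insert v V)) (hv : v ∉ V) (hA : A.Nonempty)
    (hB : B.Nonempty) (hV : V = A ∪ B) (hd : Disjoint A B) (hAB : ∀ a ∈ A, ∀ b ∈ B, ¬ E a b) :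
    Splits E (insert v V) := by
  by_cases hall : ∀ y ∈ V, E v y
  · refine ⟨{v}, V, by simp, hV ▸ hA.mono Finset.subset_union_left, by simpa using hv, rfl, ?_⟩
    left; simpa using hall
  push Not at hall
  obtain ⟨y, hy, hvy⟩ := hall
  set K := V.filter fun z => Relation.ReflTransGen (fun a b => b ∈ V ∧ E a b) y z with hK
  have hyK : y ∈ K := by simp [hK, hy, Relation.ReflTransGen.refl]
  have hKV : K ⊆ V := Finset.filter_subset _ _
  have hKc : ∀ k ∈ K, ∀ w ∈ V, E k w → w ∈ K := by
    intro k hk w hw hkw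
    simp only [hK, Finset.mem_filter] at hk ⊢
    exact ⟨hw, hk.2.tail ⟨hw, hkw⟩⟩
  by_cases hn : ∃ x ∈ K, E v x
  · obtain ⟨x, hx, hvx⟩ := hn
    -- A walk inside `K` from the non-neighbour `y` of `v` to the neighbour `x` must cross from
    -- non-neighbours to neighbours somewhere.
    have : ∃ p ∈ K, ∃ q ∈ K, E p q ∧ ¬ E v p ∧ E v q := by
      by_contra hcon
      push Not at hcon
      have : ∀ z, Relation.ReflTransGen (fun a b => b ∈ V ∧ E a b) y z → z ∈ K ∧ ¬ E v z := by
        intro z hz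
        induction hz with
        | refl => exact ⟨hyK, hvy⟩
        | tail _ h ih =>
          have hc := hKc _ ih.1 _ h.1 h.2
          exact ⟨hc, hcon _ ih.1 _ hc h.2 ih.2⟩
      simp only [hK, Finset.mem_filter] at hx
      exact (this x hx.2).2 hvx
    obtain ⟨p, hp, q, hq, hpq, hvp, hvq⟩ := this
    have hne : (V \ K).Nonempty := by
      have hside : ∀ {A B : Finset ℕ}, V = A ∪ B → (∀ a ∈ A, ∀ b ∈ B, ¬ E a b) → y ∈ A →
          K ⊆ A := by
        intro A B hV hAB hyA z hz
        simp only [hK, Finset.mem_filter] at hz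
        have := hz.2
        clear hz
        induction this with
        | refl => exact hyA
        | tail _ h ih =>
          have := h.1
          rw [hV, Finset.mem_union] at this
          exact this.resolve_right fun hb => hAB _ ih _ hb h.2
      have hyAB : y ∈ A ∪ B := hV ▸ hy
      rcases Finset.mem_union.mp hyAB with hyA | hyB
      · have := hside hV hAB hyA
        obtain ⟨b, hb⟩ := hB
        exact ⟨b, Finset.mem_sdiff.mpr ⟨hV ▸ Finset.mem_union_right _ hb,
          fun hbK => Finset.disjoint_left.mp hd (this hbK) hb⟩⟩
      · have := hside (hV.trans (Finset.union_comm _ _))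
          (fun b hb a ha e => hAB a ha b hb (hs _ _ e)) hyB
        obtain ⟨a, ha⟩ := hA
        exact ⟨a, Finset.mem_sdiff.mpr ⟨hV ▸ Finset.mem_union_left _ ha,
          fun haK => Finset.disjoint_left.mp hd ha (this haK)⟩⟩
    -- Otherwise `p, q, v, z` would be an induced path.
    have hnz : ∀ z ∈ V \ K, ¬ E v z := by
      intro z hz hvz
      rw [Finset.mem_sdiff] at hz
      have m : ∀ {x}, x ∈ V → x ∈ insert v V := fun hx => Finset.mem_insert_of_mem hx
      have ne : ∀ {x}, x ∈ V → x ≠ v := fun hx e => hv (e ▸ hx)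
      have nk : ∀ {x}, x ∈ K → x ≠ z := fun hx e => hz.2 (e ▸ hx)
      exact h p (m (hKV hp)) q (m (hKV hq)) v (Finset.mem_insert_self _ _) z (m hz.1)
        (fun e => hvp (e ▸ hvq)) (ne (hKV hp)) (nk hp) (ne (hKV hq)) (nk hq) (ne hz.1).symm
        ⟨hpq, hs _ _ hvq, hvz, fun e => hvp (hs _ _ e), fun e => hz.2 (hKc q hq z hz.1 e),
          fun e => hz.2 (hKc p hp z hz.1 e)⟩
    refine ⟨V \ K, insert v K, hne, Finset.insert_nonempty _ _, ?_, ?_, Or.inr ?_⟩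
    · rw [Finset.disjoint_insert_right]
      exact ⟨fun h => hv (Finset.mem_sdiff.mp h).1, Finset.sdiff_disjoint⟩
    · rw [Finset.union_insert, Finset.sdiff_union_of_subset hKV]
    · intro a ha b hb e
      rcases Finset.mem_insert.mp hb with rfl | hb
      · exact hnz a ha (hs _ _ e)
      · rw [Finset.mem_sdiff] at ha
        exact ha.2 (hKc b hb a ha.1 (hs _ _ e))
  · push Not at hn
    refine ⟨K, insert v (V \ K), ⟨y, hyK⟩, Finset.insert_nonempty _ _, ?_, ?_, Or.inr ?_⟩
    · rw [Finset.disjoint_insert_right]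
      exact ⟨fun h => hv (hKV h), Finset.disjoint_sdiff⟩
    · rw [Finset.union_insert, Finset.union_sdiff_of_subset hKV]
    · intro a ha b hb e
      rcases Finset.mem_insert.mp hb with rfl | hb
      · exact hn a ha (hs _ _ e)
      · rw [Finset.mem_sdiff] at hb
        exact hb.2 (hKc a ha b hb.1 e)

/-- `P₄`-free graphs with at least two nodes are disjoint unions or joins. -/
theorem P4FreeOn.splits {E : ℕ → ℕ → Prop} {V : Finset ℕ} (hs : ∀ x y, E x y → E y x)
    (h : P4FreeOn E V) (hV : 2 ≤ V.card) : Splits E V := by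
  induction V using Finset.induction_on with
  | empty => simp at hV
  | insert v V hv ih =>
    rw [Finset.card_insert_of_notMem hv] at hV
    have hV1 : 1 ≤ V.card := by omega
    rcases Nat.eq_or_lt_of_le hV1 with h1 | h1
    · obtain ⟨w, rfl⟩ := Finset.card_eq_one.mp h1.symm
      have hvw : v ≠ w := by simpa using hv
      refine ⟨{v}, {w}, by simp, by simp, by simpa using hvw, rfl, ?_⟩
      simpa using em (E v w)
    · obtain ⟨A, B, hA, hB, hd, hAB, hj | hj⟩ := ih (h.mono (Finset.subset_insert _ _)) h1
      -- A join is a disjoint union in the complement, and both P₄-freeness and splitting are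
      -- invariant under complementation.
      · exact (splits_insert_of_disconnected (E := fun x y => ¬ E x y)
          (fun x y h h' => h (hs _ _ h')) (h.compl hs) hv hA hB hAB hd (by simpa using hj)).compl
      · exact splits_insert_of_disconnected hs h hv hA hB hAB hd hj

/-- Every `P₄`-free graph has a cograph decomposition. -/
theorem exists_clean {E : ℕ → ℕ → Prop} {V : Finset ℕ} (hs : ∀ x y, E x y → E y x)
    (h : P4FreeOn E V) (hV : V.Nonempty) : ∃ φ : Formula, φ.Clean ∧ φ.vars = V ∧
      ∀ x ∈ V, ∀ y ∈ V, x ≠ y → (φ.Edge x y ↔ E x y) := by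
  induction V using Finset.strongInduction with
  | H V ih =>
    rcases Nat.lt_or_ge V.card 2 with h1 | h1
    · have : V.card = 1 := by have := hV.card_pos; omega
      obtain ⟨w, rfl⟩ := Finset.card_eq_one.mp this
      refine ⟨var w, ⟨trivial, trivial, trivial⟩, rfl, fun x hx y hy hxy => ?_⟩
      simp only [Finset.mem_singleton] at hx hy
      exact absurd (hx.trans hy.symm) hxy
    · obtain ⟨A, B, hA, hB, hd, hAB, hj⟩ := h.splits hs h1
      have hAV : A ⊂ V := by
        obtain ⟨b, hb⟩ := hB
        refine (Finset.ssubset_iff_of_subset (hAB ▸ Finset.subset_union_left)).mpr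
          ⟨b, hAB ▸ Finset.mem_union_right _ hb, Finset.disjoint_right.mp hd hb⟩
      have hBV : B ⊂ V := by
        obtain ⟨a, ha⟩ := hA
        refine (Finset.ssubset_iff_of_subset (hAB ▸ Finset.subset_union_right)).mpr
          ⟨a, hAB ▸ Finset.mem_union_left _ ha, Finset.disjoint_left.mp hd ha⟩
      obtain ⟨α, cα, vα, eα⟩ := ih A hAV (h.mono hAV.1) hA
      obtain ⟨β, cβ, vβ, eβ⟩ := ih B hBV (h.mono hBV.1) hB
      have hd' : Disjoint α.vars β.vars := by rwa [vα, vβ]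
      rcases hj with hj | hj
      · refine ⟨and α β, ⟨⟨cα.linear, cβ.linear, hd'⟩, ⟨cα.constFree, cβ.constFree⟩,
          ⟨cα.negFree, cβ.negFree⟩⟩, by rw [vars, vα, vβ, hAB], ?_⟩
        intro x hx y hy hxy
        rw [hAB, Finset.mem_union] at hx hy
        rcases hx with hx | hx <;> rcases hy with hy | hy
        · rw [edge_and_left hd' (vα ▸ hx) (vα ▸ hy), eα x hx y hy hxy]
        · exact ⟨fun _ => hj x hx y hy, fun _ => Or.inr (Or.inr (Or.inl ⟨vα ▸ hx, vβ ▸ hy⟩))⟩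
        · exact ⟨fun _ => hs _ _ (hj y hy x hx),
            fun _ => Or.inr (Or.inr (Or.inr ⟨vβ ▸ hx, vα ▸ hy⟩))⟩
        · rw [edge_and_right hd' (vβ ▸ hx) (vβ ▸ hy), eβ x hx y hy hxy]
      · refine ⟨or α β, ⟨⟨cα.linear, cβ.linear, hd'⟩, ⟨cα.constFree, cβ.constFree⟩,
          ⟨cα.negFree, cβ.negFree⟩⟩, by rw [vars, vα, vβ, hAB], ?_⟩
        intro x hx y hy hxy
        rw [hAB, Finset.mem_union] at hx hy
        rcases hx with hx | hx <;> rcases hy with hy | hy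
        · rw [edge_or_left hd' (vα ▸ hx), eα x hx y hy hxy]
        · rw [edge_or_left hd' (vα ▸ hx)]
          exact ⟨fun e => absurd e.mem.2 (by rw [vα]; exact Finset.disjoint_right.mp hd hy),
            fun e => absurd e (hj x hx y hy)⟩
        · rw [edge_or_right hd' (vβ ▸ hx)]
          exact ⟨fun e => absurd e.mem.2 (by rw [vβ]; exact Finset.disjoint_left.mp hd hy),
            fun e => absurd (hs _ _ e) (hj y hy x hx)⟩
        · rw [edge_or_right hd' (vβ ▸ hx), eβ x hx y hy hxy]

end LinearInference

namespace LinearInference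
open Formula

/-! ### Non-triviality and interpolation -/

/-- The implication from `φ` to `ψ` is not trivial at any of the variables in `V`. -/
def NonTriv (φ ψ : Formula) (V : Finset ℕ) : Prop :=
  ∀ x ∈ V, ∃ α : ℕ → Bool, φ.eval (Function.update α x true) = true ∧
    ψ.eval (Function.update α x false) = false

theorem Inference.not_trivial_iff (r : Inference) : ¬ r.Trivial ↔ NonTriv r.lhs r.rhs r.vars := by
  simp only [Inference.Trivial, Inference.TrivialAt, Implies, NonTriv, eval_subst1, eval]
  push Not
  simp

/-- The same witnesses serve: narrowing the interval between premise and conclusion preserves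
non-triviality. -/
theorem NonTriv.mono {φ ψ φ' ψ' : Formula} {V : Finset ℕ} (h : NonTriv φ ψ V) (h1 : Implies φ φ')
    (h2 : Implies ψ' ψ) : NonTriv φ' ψ' V := by
  intro x hx
  obtain ⟨α, ha, hb⟩ := h x hx
  refine ⟨α, h1 _ ha, ?_⟩
  by_contra hc
  rw [Bool.not_eq_false] at hc
  rw [h2 _ hc] at hb
  cases hb

/-- If `x` were missing on one side, the two updates in the witness could be made to agree, and the
witness would refute `hi`. -/
theorem NonTriv.subset {φ ψ : Formula} {V : Finset ℕ} (h : NonTriv φ ψ V) (hi : Implies φ ψ) :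
    V ⊆ φ.vars ∩ ψ.vars := by
  intro x hx
  obtain ⟨α, h1, h2⟩ := h x hx
  rw [Finset.mem_inter]
  constructor
  · by_contra hc
    rw [eval_update_of_notMem hc, ← eval_update_of_notMem hc α false] at h1
    rw [hi _ h1] at h2; cases h2
  · by_contra hc
    rw [eval_update_of_notMem hc, ← eval_update_of_notMem hc α true] at h2
    rw [hi _ h1] at h2; cases h2

/-- Increasing `x` makes `χ` true at some assignment of `V`, whatever the values outside `V`. -/
def CriticalOn (V : Finset ℕ) (χ : Formula) (x : ℕ) : Prop :=
  ∃ α : ℕ → Bool, ∀ β : ℕ → Bool, (∀ y ∈ V, β y = α y) →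
    χ.eval (Function.update β x true) = true ∧ χ.eval (Function.update β x false) = false

/-- The witness squeezes `χ`: `φ` is true once `x` is raised and forces `χ` to be true, `ψ` is false
once `x` is lowered and forces `χ` to be false. Values outside `V` matter neither to `φ` nor to `ψ`.
-/
theorem NonTriv.criticalOn {φ ψ χ : Formula} {V : Finset ℕ} (h : NonTriv φ ψ V)
    (hφ : φ.vars ⊆ V) (hψ : ψ.vars ⊆ V) (h1 : Implies φ χ) (h2 : Implies χ ψ) {x : ℕ}
    (hx : x ∈ V) : CriticalOn V χ x := by
  obtain ⟨α, ha, hb⟩ := h x hx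
  have key : ∀ β : ℕ → Bool, (∀ y ∈ V, β y = α y) → ∀ b, ∀ y ∈ V,
      Function.update β x b y = Function.update α x b y := by
    intro β hβ b y hy
    by_cases e : y = x
    · subst e; simp
    · simp [Function.update_of_ne e, hβ y hy]
  refine ⟨α, fun β hβ => ⟨h1 _ ?_, ?_⟩⟩
  · exact (eval_congr fun y hy => key β hβ true y (hφ hy)).trans ha
  · by_contra hc
    rw [Bool.not_eq_false] at hc
    have := h2 _ hc
    rw [eval_congr fun y hy => key β hβ false y (hψ hy), hb] at this
    cases this

theorem CriticalOn.mem_vars {V : Finset ℕ} {χ : Formula} {x : ℕ} (h : CriticalOn V χ x) :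
    x ∈ χ.vars := by
  obtain ⟨α, h⟩ := h
  obtain ⟨h1, h2⟩ := h α fun _ _ => rfl
  by_contra hc
  rw [eval_update_of_notMem hc] at h1 h2
  rw [h1] at h2; cases h2

theorem CriticalOn.notMem_negv {V : Finset ℕ} {χ : Formula} {x : ℕ} (hχ : χ.Linear)
    (h : CriticalOn V χ x) : x ∉ χ.negv := by
  obtain ⟨α, h⟩ := h
  obtain ⟨h1, h2⟩ := h α fun _ _ => rfl
  intro hc
  have := eval_update_le hχ x false (by simpa using hc) h1
  rw [Function.update_idem, h2] at this
  cases this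

/-- Suppose one argument of a connective uses only variables in `V` and the other only variables
outside. The latter can be given the absorbing value of the connective without touching `V`, and
then no variable of the former is critical on `V`. By induction no subformula mixes the two kinds of
variables. -/
theorem vars_subset_or_disjoint_of_criticalOn {V : Finset ℕ} {χ : Formula} (hχ : χ.Linear)
    (hc : χ.ConstFree) (h : ∀ x ∈ V, x ∈ χ.vars → CriticalOn V χ x) :
    χ.vars ⊆ V ∨ Disjoint χ.vars V := by
  -- a part outside `V` that decides the value of the other part is impossible
  have mix : ∀ (a b : Formula) (d : Bool), a.vars.Nonempty → b.Linear → b.ConstFree →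
      (∀ x ∈ V, x ∈ a.vars → ∃ α : ℕ → Bool, ∀ β : ℕ → Bool, (∀ y ∈ V, β y = α y) →
        b.eval (Function.update β x (!d)) ≠ d) →
      a.vars ⊆ V → Disjoint b.vars V → Disjoint a.vars b.vars → False := by
    rintro a b d ⟨x, hx⟩ hb hbc h ha hbV hab
    obtain ⟨α, hα⟩ := h x (ha hx) hx
    obtain ⟨γ, hγ⟩ := exists_eval_eq hb hbc d
    refine hα (fun y => if y ∈ V then α y else γ y) (fun y hy => by simp [hy]) ?_
    rw [eval_update_of_notMem (Finset.disjoint_left.mp hab hx), ← hγ]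
    exact eval_congr fun y hy => by simp [Finset.disjoint_left.mp hbV hy]
  have fin : ∀ a b : Formula, (a.vars ⊆ V ∨ Disjoint a.vars V) → (b.vars ⊆ V ∨ Disjoint b.vars V) →
      ¬ (a.vars ⊆ V ∧ Disjoint b.vars V) → ¬ (b.vars ⊆ V ∧ Disjoint a.vars V) →
      a.vars ∪ b.vars ⊆ V ∨ Disjoint (a.vars ∪ b.vars) V := by
    intro a b h1 h2 h3 h4
    rw [Finset.disjoint_union_left, Finset.union_subset_iff]; tauto
  induction χ with
  | top => exact hc.elim
  | bot => exact hc.elim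
  | var x =>
    simp only [vars, Finset.singleton_subset_iff, Finset.disjoint_singleton_left]; exact em _
  | nvar x =>
    simp only [vars, Finset.singleton_subset_iff, Finset.disjoint_singleton_left]; exact em _
  | and a b iha ihb =>
    have hA : ∀ x ∈ V, x ∈ a.vars → CriticalOn V a x ∧ ∃ α : ℕ → Bool, ∀ β : ℕ → Bool,
        (∀ y ∈ V, β y = α y) → b.eval (Function.update β x (!false)) ≠ false := by
      intro x hx hxa
      obtain ⟨α, hα⟩ := h x hx (Finset.mem_union_left _ hxa)
      have hxb := Finset.disjoint_left.mp hχ.2.2 hxa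
      simp only [eval, Bool.and_eq_true, Bool.and_eq_false_iff, eval_update_of_notMem hxb] at hα
      refine ⟨⟨α, fun β hβ => ⟨(hα β hβ).1.1, ?_⟩⟩, α, fun β hβ => ?_⟩
      · exact (hα β hβ).2.resolve_right (by simp [(hα β hβ).1.2])
      · simp [eval_update_of_notMem hxb, (hα β hβ).1.2]
    have hB : ∀ x ∈ V, x ∈ b.vars → CriticalOn V b x ∧ ∃ α : ℕ → Bool, ∀ β : ℕ → Bool,
        (∀ y ∈ V, β y = α y) → a.eval (Function.update β x (!false)) ≠ false := by
      intro x hx hxa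
      obtain ⟨α, hα⟩ := h x hx (Finset.mem_union_right _ hxa)
      have hxb := Finset.disjoint_right.mp hχ.2.2 hxa
      simp only [eval, Bool.and_eq_true, Bool.and_eq_false_iff, eval_update_of_notMem hxb] at hα
      refine ⟨⟨α, fun β hβ => ⟨(hα β hβ).1.2, ?_⟩⟩, α, fun β hβ => ?_⟩
      · exact (hα β hβ).2.resolve_left (by simp [(hα β hβ).1.1])
      · simp [eval_update_of_notMem hxb, (hα β hβ).1.1]
    refine fin a b (iha hχ.1 hc.1 fun x hx h => (hA x hx h).1)
      (ihb hχ.2.1 hc.2 fun x hx h => (hB x hx h).1) (fun h => ?_) fun h => ?_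
    · exact mix a b false hc.1.vars_nonempty hχ.2.1 hc.2 (fun x hx h => (hA x hx h).2) h.1 h.2
        hχ.2.2
    · exact mix b a false hc.2.vars_nonempty hχ.1 hc.1 (fun x hx h => (hB x hx h).2) h.1 h.2
        hχ.2.2.symm
  | or a b iha ihb =>
    have hA : ∀ x ∈ V, x ∈ a.vars → CriticalOn V a x ∧ ∃ α : ℕ → Bool, ∀ β : ℕ → Bool,
        (∀ y ∈ V, β y = α y) → b.eval (Function.update β x (!true)) ≠ true := by
      intro x hx hxa
      obtain ⟨α, hα⟩ := h x hx (Finset.mem_union_left _ hxa)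
      have hxb := Finset.disjoint_left.mp hχ.2.2 hxa
      simp only [eval, Bool.or_eq_true, Bool.or_eq_false_iff, eval_update_of_notMem hxb] at hα
      refine ⟨⟨α, fun β hβ => ⟨?_, (hα β hβ).2.1⟩⟩, α, fun β hβ => ?_⟩
      · exact (hα β hβ).1.resolve_right (by simp [(hα β hβ).2.2])
      · simp [eval_update_of_notMem hxb, (hα β hβ).2.2]
    have hB : ∀ x ∈ V, x ∈ b.vars → CriticalOn V b x ∧ ∃ α : ℕ → Bool, ∀ β : ℕ → Bool,
        (∀ y ∈ V, β y = α y) → a.eval (Function.update β x (!true)) ≠ true := by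
      intro x hx hxa
      obtain ⟨α, hα⟩ := h x hx (Finset.mem_union_right _ hxa)
      have hxb := Finset.disjoint_right.mp hχ.2.2 hxa
      simp only [eval, Bool.or_eq_true, Bool.or_eq_false_iff, eval_update_of_notMem hxb] at hα
      refine ⟨⟨α, fun β hβ => ⟨?_, (hα β hβ).2.2⟩⟩, α, fun β hβ => ?_⟩
      · exact (hα β hβ).1.resolve_left (by simp [(hα β hβ).2.1])
      · simp [eval_update_of_notMem hxb, (hα β hβ).2.1]
    refine fin a b (iha hχ.1 hc.1 fun x hx h => (hA x hx h).1)
      (ihb hχ.2.1 hc.2 fun x hx h => (hB x hx h).1) (fun h => ?_) fun h => ?_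
    · exact mix a b true hc.1.vars_nonempty hχ.2.1 hc.2 (fun x hx h => (hA x hx h).2) h.1 h.2
        hχ.2.2
    · exact mix b a true hc.2.vars_nonempty hχ.1 hc.1 (fun x hx h => (hB x hx h).2) h.1 h.2
        hχ.2.2.symm

/-- A linear constant-free formula between the two sides of a non-trivial implication has the same
variables as these, all of them positive. -/
theorem NonTriv.clean_of_between {φ ψ χ : Formula} {V : Finset ℕ} (h : NonTriv φ ψ V)
    (hφ : φ.vars ⊆ V) (hψ : ψ.vars ⊆ V) (hV : V.Nonempty) (h1 : Implies φ χ) (h2 : Implies χ ψ)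
    (hχ : χ.Linear) (hc : χ.ConstFree) : χ.Clean ∧ χ.vars = V := by
  have cr := fun x hx => h.criticalOn hφ hψ h1 h2 (x := x) hx
  have hsub : V ⊆ χ.vars := fun x hx => (cr x hx).mem_vars
  have hv : χ.vars = V := by
    rcases vars_subset_or_disjoint_of_criticalOn hχ hc fun x hx _ => cr x hx with h | h
    · exact h.antisymm hsub
    · obtain ⟨x, hx⟩ := hV
      exact absurd hx (Finset.disjoint_left.mp h (hsub hx))
  refine ⟨⟨hχ, hc, ?_⟩, hv⟩
  rw [negFree_iff, Finset.eq_empty_iff_forall_notMem]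
  exact fun x hx => (cr x (hv ▸ negv_subset χ hx)).notMem_negv hχ hx

/-- Simplification removes the units of an interpolant, and the result is not itself a unit because
it depends on the variables in `V`. -/
theorem NonTriv.clean_nf_of_between {φ ψ χ : Formula} {V : Finset ℕ} (h : NonTriv φ ψ V)
    (hφ : φ.vars ⊆ V) (hψ : ψ.vars ⊆ V) (hV : V.Nonempty) (h1 : Implies φ χ) (h2 : Implies χ ψ)
    (hχ : χ.Linear) : χ.nf.Clean ∧ χ.nf.vars = V := by
  have e1 : Implies φ χ.nf := h1.trans (logEquiv_nf χ).symm.implies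
  have e2 : Implies χ.nf ψ := (logEquiv_nf χ).implies.trans h2
  refine h.clean_of_between hφ hψ hV e1 e2 hχ.nf ?_
  obtain ⟨x, hx⟩ := hV
  have := (h.criticalOn hφ hψ e1 e2 hx).mem_vars
  rcases nf_cases χ with h | h | h
  · rw [h] at this; simp [vars] at this
  · rw [h] at this; simp [vars] at this
  · exact h

/-- Non-trivial, logically minimal implications between inequivalent clean formulae. -/
structure Good (r : Inference) : Prop where
  lhs : r.lhs.Clean
  rhs : r.rhs.Clean
  vars_eq : r.lhs.vars = r.rhs.vars
  implies : Implies r.lhs r.rhs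
  nonTriv : NonTriv r.lhs r.rhs r.lhs.vars
  logMinimal : r.LogMinimal
  not_logEquiv : ¬ LogEquiv r.lhs r.rhs

theorem Good.nonempty {r : Inference} (h : Good r) : r.lhs.vars.Nonempty :=
  h.lhs.constFree.vars_nonempty

theorem Good.clean_of_between {r : Inference} (h : Good r) {χ : Formula} (h1 : Implies r.lhs χ)
    (h2 : Implies χ r.rhs) (hχ : χ.Linear) (hc : χ.ConstFree) : χ.Clean ∧ χ.vars = r.lhs.vars :=
  h.nonTriv.clean_of_between subset_rfl h.vars_eq.ge h.nonempty h1 h2 hχ hc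

end LinearInference

namespace LinearInference
open Formula

/-! ### Webs and their cograph decompositions -/

theorem Web.ext {n : ℕ} {R S : Web n} (h : ∀ x y, R.adj x y = S.adj x y) : R = S := by
  cases R; cases S
  simp only [Web.mk.injEq]
  funext x y
  exact h x y

/-- The restriction of a web to all nodes but the last one. -/
def Web.init {n : ℕ} (R : Web (n + 1)) : Web n :=
  ⟨fun x y => R.adj x.castSucc y.castSucc, fun _ _ => R.symm _ _, fun _ => R.irrefl _⟩

theorem Web.extend_init {n : ℕ} (R : Web (n + 1)) :
    R.init.extend (Finset.univ.filter fun x => R.adj x.castSucc (Fin.last n) = true) = R := by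
  apply Web.ext
  intro x y
  simp only [Web.extend, Web.init, Finset.mem_filter, Finset.mem_univ, true_and, Bool.decide_eq_true]
  by_cases hx : x.val < n <;> by_cases hy : y.val < n <;> simp only [hx, hy, dite_true, dite_false]
  · rfl
  · have : y = Fin.last n := Fin.ext (by simp; omega)
    subst this; rfl
  · have : x = Fin.last n := Fin.ext (by simp; omega)
    subst this; rw [R.symm]; rfl
  · have h1 : x = Fin.last n := Fin.ext (by simp; omega)
    have h2 : y = Fin.last n := Fin.ext (by simp; omega)
    subst h1; subst h2; exact (R.irrefl _).symm

/-- P₄-freeness passes to induced subgraphs, so filtering at every stage discards no ancestor of a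
P₄-free graph. -/
theorem mem_cographs {n : ℕ} (R : Web n) : R ∈ cographs n ↔ R.P4Free := by
  induction n with
  | zero =>
    simp only [cographs, Finset.mem_singleton]
    exact ⟨fun _ a => a.elim0, fun _ => Web.ext fun x => x.elim0⟩
  | succ n ih =>
    simp only [cographs, Finset.mem_filter, Finset.mem_biUnion, Finset.mem_image,
      Finset.mem_univ, true_and, and_iff_right_iff_imp]
    intro h
    exact ⟨R.init, (ih _).mpr fun a b c d => h _ _ _ _, _, R.extend_init⟩

/-- The edge relation of a web, on the natural numbers. -/
def Web.E {n : ℕ} (R : Web n) (x y : ℕ) : Prop :=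
  ∃ (hx : x < n) (hy : y < n), R.adj ⟨x, hx⟩ ⟨y, hy⟩ = true

theorem Web.E_val {n : ℕ} (R : Web n) (x y : Fin n) : R.E x y ↔ R.adj x y = true :=
  ⟨fun ⟨_, _, h⟩ => h, fun h => ⟨x.2, y.2, h⟩⟩

theorem Web.E.symm {n : ℕ} {R : Web n} (x y : ℕ) (h : R.E x y) : R.E y x := by
  obtain ⟨hx, hy, h⟩ := h; exact ⟨hy, hx, R.symm _ _ ▸ h⟩

theorem Web.E.ne {n : ℕ} {R : Web n} {x y : ℕ} (h : R.E x y) : x ≠ y := by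
  obtain ⟨hx, hy, h⟩ := h
  rintro rfl
  rw [R.irrefl] at h; cases h

theorem Web.P4Free.p4FreeOn {n : ℕ} {R : Web n} (h : R.P4Free) :
    P4FreeOn R.E (Finset.range n) := by
  intro a ha b hb c hc d hd _ _ _ _ _ _
  simp only [Finset.mem_range] at ha hb hc hd
  have := h ⟨a, ha⟩ ⟨b, hb⟩ ⟨c, hc⟩ ⟨d, hd⟩
  simpa only [← Web.E_val, ← Bool.not_eq_true] using this

namespace IsDecomposition

variable {n : ℕ} {φ ψ : Formula} {R S : Web n}

theorem clean (h : IsDecomposition φ R) : φ.Clean := ⟨h.1, h.2.1, h.2.2.1⟩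

theorem vars (h : IsDecomposition φ R) : φ.vars = Finset.range n := h.2.2.2.1

theorem edge (h : IsDecomposition φ R) (x y : ℕ) : φ.Edge x y ↔ R.E x y := by
  by_cases hxy : x < n ∧ y < n
  · exact (h.2.2.2.2 ⟨x, hxy.1⟩ ⟨y, hxy.2⟩).trans (R.E_val ⟨x, hxy.1⟩ ⟨y, hxy.2⟩).symm
  · constructor
    · intro he
      have := he.mem
      rw [h.vars, Finset.mem_range, Finset.mem_range] at this
      exact absurd this hxy
    · rintro ⟨hx, hy, _⟩; exact absurd ⟨hx, hy⟩ hxy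

theorem of_clean (hc : φ.Clean) (hv : φ.vars = Finset.range n)
    (he : ∀ x < n, ∀ y < n, φ.Edge x y ↔ R.E x y) : IsDecomposition φ R :=
  ⟨hc.1, hc.2, hc.3, hv, fun x y => by rw [he x x.2 y y.2, R.E_val]⟩

theorem p4Free (h : IsDecomposition φ R) : R.P4Free := by
  intro a b c d
  have := edge_p4Free h.clean.linear a b c d
  simpa only [h.edge, R.E_val, Bool.not_eq_true] using this

theorem pos (h : IsDecomposition φ R) : 0 < n := by
  obtain ⟨x, hx⟩ := h.clean.constFree.vars_nonempty
  rw [h.vars, Finset.mem_range] at hx; omega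

theorem logEquiv_iff (h : IsDecomposition φ R) (h' : IsDecomposition ψ S) :
    LogEquiv φ ψ ↔ R = S := by
  constructor
  · intro e
    apply Web.ext
    intro x y
    rw [Bool.eq_iff_iff, ← R.E_val, ← S.E_val, ← h.edge, ← h'.edge, e.edge_iff h.clean h'.clean]
  · rintro rfl
    exact (h.clean.ac_of_edge_iff h'.clean (h.vars.trans h'.vars.symm)
      fun x y => by rw [h.edge, h'.edge]).logEquiv

end IsDecomposition

theorem Web.P4Free.exists_decomposition {n : ℕ} {R : Web n} (h : R.P4Free) (hn : 0 < n) :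
    ∃ φ, IsDecomposition φ R := by
  obtain ⟨φ, hc, hv, he⟩ := exists_clean (E := R.E) Web.E.symm h.p4FreeOn
    (Finset.nonempty_range_iff.mpr hn.ne')
  refine ⟨φ, .of_clean hc hv fun x hx y hy => ?_⟩
  by_cases e : x = y
  · subst e
    exact ⟨fun h => absurd rfl (h.ne hc.linear), fun h => absurd rfl h.ne⟩
  · exact he x (Finset.mem_range.mpr hx) y (Finset.mem_range.mpr hy) e

open Classical in
theorem Formula.Clean.exists_web {n : ℕ} {φ : Formula} (h : φ.Clean)
    (hv : φ.vars = Finset.range n) : ∃ R : Web n, IsDecomposition φ R := by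
  refine ⟨⟨fun x y => decide (φ.Edge x y), fun x y => ?_, fun x => ?_⟩, h.1, h.2, h.3, hv, ?_⟩
  · simp only [decide_eq_decide]; exact ⟨Edge.symm, Edge.symm⟩
  · simp only [decide_eq_false_iff_not]; exact fun e => e.ne h.linear rfl
  · simp

/-! ### The clique criteria -/

namespace IsDecomposition

variable {n : ℕ} {φ ψ : Formula} {R S : Web n}

theorem mem_maxCliques_iff (h : IsDecomposition φ R) (P : Finset (Fin n)) :
    P ∈ maxCliques R ↔ φ.Minterm (P.map Fin.valEmbedding) := by
  rw [minterm_iff h.clean.linear h.clean.constFree, h.vars]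
  simp only [maxCliques, Finset.mem_filter, Finset.mem_univ, true_and, Web.IsClique,
    Finset.mem_map, Fin.valEmbedding_apply, forall_exists_index, and_imp, forall_apply_eq_imp_iff₂,
    h.edge, R.E_val, Finset.mem_range, ne_eq, Fin.val_inj, exists_exists_and_eq_and, not_exists,
    not_and, Finset.mem_insert]
  constructor
  · rintro ⟨h1, h2⟩
    refine ⟨?_, h1, ?_⟩
    · intro x hx
      obtain ⟨y, _, rfl⟩ := Finset.mem_map.mp hx
      simp
    · intro z hz hzP
      have := h2 ⟨z, hz⟩ (fun hc => hzP _ hc rfl)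
      by_contra hcon
      push Not at hcon
      have hc : ∀ x ∈ P, R.adj x ⟨z, hz⟩ = true := fun x hx => (R.E_val x ⟨z, hz⟩).mp (hcon x hx)
      apply this
      rintro x (rfl | hx) y (rfl | hy) hxy
      · exact absurd rfl hxy
      · rw [R.symm]; exact hc y hy
      · exact hc x hx
      · exact h1 x hx y hy hxy
  · rintro ⟨-, h1, h2⟩
    refine ⟨h1, fun z hz hcl => ?_⟩
    obtain ⟨x, hx, hxz⟩ := h2 z z.2 (fun y hy e => hz (Fin.ext e ▸ hy))
    rw [R.E_val] at hxz
    exact hxz (hcl x (Or.inr hx) z (Or.inl rfl) (fun e => hz (e ▸ hx)))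

theorem exists_map_of_minterm (h : IsDecomposition φ R) {Q : Finset ℕ} (hQ : φ.Minterm Q) :
    ∃ P : Finset (Fin n), Q = P.map Fin.valEmbedding := by
  refine ⟨Finset.univ.filter fun x : Fin n => (x : ℕ) ∈ Q, ?_⟩
  ext x
  simp only [Finset.mem_map, Finset.mem_filter, Finset.mem_univ, true_and, Fin.valEmbedding_apply]
  constructor
  · intro hx
    have := hQ.subset hx
    rw [h.vars, Finset.mem_range] at this
    exact ⟨⟨x, this⟩, hx, rfl⟩
  · rintro ⟨y, hy, rfl⟩; exact hy

theorem eval_iff (h : IsDecomposition φ R) (α : ℕ → Bool) :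
    φ.eval α = true ↔ ∃ P ∈ maxCliques R, ∀ x ∈ P, α x = true := by
  rw [eval_eq_true_iff h.clean.negFree]
  constructor
  · rintro ⟨Q, hQ, hα⟩
    obtain ⟨P, rfl⟩ := h.exists_map_of_minterm hQ
    exact ⟨P, (h.mem_maxCliques_iff P).mpr hQ,
      fun x hx => hα x (Finset.mem_map.mpr ⟨x, hx, rfl⟩)⟩
  · rintro ⟨P, hP, hα⟩
    refine ⟨_, (h.mem_maxCliques_iff P).mp hP, fun x hx => ?_⟩
    obtain ⟨y, hy, rfl⟩ := Finset.mem_map.mp hx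
    exact hα y hy

theorem valid_iff (h : IsDecomposition φ R) (h' : IsDecomposition ψ S) :
    valid R S ↔ Implies φ ψ := by
  constructor
  · intro hv α hα
    rw [h.eval_iff] at hα
    obtain ⟨P, hP, hα⟩ := hα
    obtain ⟨Q, hQ, hQP⟩ := hv P hP
    exact (h'.eval_iff α).mpr ⟨Q, hQ, fun x hx => hα x (hQP hx)⟩
  · intro hi P hP
    -- The indicator of `P` is the least assignment that satisfies the minterm `P`, hence the
    -- decisive test.
    have := hi (fun x => decide (∃ y ∈ P, (y : ℕ) = x))
      ((h.eval_iff _).mpr ⟨P, hP, fun x hx => decide_eq_true ⟨x, hx, rfl⟩⟩)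
    obtain ⟨Q, hQ, hα⟩ := (h'.eval_iff _).mp this
    refine ⟨Q, hQ, fun x hx => ?_⟩
    obtain ⟨y, hy, e⟩ := of_decide_eq_true (hα x hx)
    exact Fin.ext e ▸ hy

/-- Raising `x` in the indicator of a clique `P` still satisfies `P`, and lowering `x` leaves the
indicator of `P.erase x`. So a clique that violates the graph criterion is the same as a witness of
non-triviality. -/
theorem not_triv_iff (h : IsDecomposition φ R) (h' : IsDecomposition ψ S) :
    ¬ triv R S ↔ NonTriv φ ψ φ.vars := by
  rw [triv, not_exists, NonTriv, h.vars]
  constructor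
  · intro ht x hx
    have hx := Finset.mem_range.mp hx
    have := ht ⟨x, hx⟩
    push Not at this
    obtain ⟨P, hP, hn⟩ := this
    refine ⟨fun z => decide (∃ y ∈ P, (y : ℕ) = z), (h.eval_iff _).mpr ⟨P, hP, fun y hy => ?_⟩, ?_⟩
    · by_cases e : (y : ℕ) = x
      · simp [e]
      · rw [Function.update_of_ne e]; exact decide_eq_true ⟨y, hy, rfl⟩
    · by_contra hc
      rw [Bool.not_eq_false, h'.eval_iff] at hc
      obtain ⟨Q, hQ, hα⟩ := hc
      refine hn Q hQ fun y hy => ?_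
      have hα := hα y hy
      have hne : (y : ℕ) ≠ x := by
        intro e
        rw [e] at hα; simp at hα
      rw [Function.update_of_ne hne] at hα
      obtain ⟨z, hz, e⟩ := of_decide_eq_true hα
      exact Finset.mem_erase.mpr ⟨fun e => hne (by rw [e]), Fin.ext e ▸ hz⟩
  · intro hn x hcon
    obtain ⟨α, h1, h2⟩ := hn x (Finset.mem_range.mpr x.2)
    obtain ⟨P, hP, hα⟩ := (h.eval_iff _).mp h1
    obtain ⟨Q, hQ, hQP⟩ := hcon P hP
    have : ψ.eval (Function.update α x false) = true := by
      refine (h'.eval_iff _).mpr ⟨Q, hQ, fun y hy => ?_⟩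
      have hy := Finset.mem_erase.mp (hQP hy)
      have hne : (y : ℕ) ≠ x := fun e => hy.1 (Fin.ext e)
      have := hα y hy.2
      rw [Function.update_of_ne hne] at this ⊢
      exact this
    rw [h2] at this; cases this

end IsDecomposition

theorem mem_Phi {n : ℕ} {R S : Web n} :
    S ∈ Phi R ↔ S.P4Free ∧ S ≠ R ∧ valid R S ∧ ¬ triv R S := by
  simp [Phi, mem_cographs]

theorem mem_logMin {n : ℕ} {R S : Web n} :
    S ∈ logMin R ↔ S ∈ Phi R ∧ ∀ T ∈ Phi R, S ∉ Phi T := by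
  simp [logMin]

/-- `logMin` ranges over graphs on the same nodes, `LogMinimal` over all linear formulae. By
interpolation the simplified form of any linear formula in between is clean on these nodes and so
has a web `T`; by `NonTriv.mono` both halves `R → T` and `T → S` are again non-trivial, as
membership in `Phi` demands. -/
theorem mem_logMin_iff_good {n : ℕ} {R S : Web n} {r : Inference}
    (h : IsDecompositionOf r ⟨n, R, S⟩) : S ∈ logMin R ↔ Good r := by
  obtain ⟨h1, h2⟩ : IsDecomposition r.lhs R ∧ IsDecomposition r.rhs S := h
  rw [mem_logMin, mem_Phi]
  constructor
  · rintro ⟨⟨-, hne, hv, ht⟩, hm⟩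
    have himp := (h1.valid_iff h2).mp hv
    have hnt := (h1.not_triv_iff h2).mp ht
    refine ⟨h1.clean, h2.clean, h1.vars.trans h2.vars.symm, himp, hnt, ?_, ?_⟩
    · intro χ hχ i1 i2
      obtain ⟨c, v⟩ := hnt.clean_nf_of_between subset_rfl (h1.vars.trans h2.vars.symm).ge
        h1.clean.constFree.vars_nonempty i1 i2 hχ
      have e := logEquiv_nf χ
      obtain ⟨T, hT⟩ := c.exists_web (v.trans h1.vars)
      by_contra hcon
      push Not at hcon
      have n1 : T ≠ R := fun e' => hcon.1 (e.symm.trans ((hT.logEquiv_iff h1).mpr e'))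
      have n2 : S ≠ T := fun e' => hcon.2 (e.symm.trans ((hT.logEquiv_iff h2).mpr e'.symm))
      have i1' := i1.trans e.symm.implies
      have i2' := e.implies.trans i2
      refine hm T (mem_Phi.mpr ⟨hT.p4Free, n1, (h1.valid_iff hT).mpr i1',
        (h1.not_triv_iff hT).mpr (hnt.mono (fun _ => id) i2')⟩)
        (mem_Phi.mpr ⟨h2.p4Free, n2, (hT.valid_iff h2).mpr i2', (hT.not_triv_iff h2).mpr ?_⟩)
      rw [v]
      exact hnt.mono i1' fun _ => id
    · exact fun e => hne ((h1.logEquiv_iff h2).mp e).symm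
  · intro g
    refine ⟨⟨h2.p4Free, fun e => g.not_logEquiv ((h1.logEquiv_iff h2).mpr e.symm),
      (h1.valid_iff h2).mpr g.implies, (h1.not_triv_iff h2).mpr g.nonTriv⟩, fun T hT hS => ?_⟩
    rw [mem_Phi] at hT hS
    obtain ⟨χ, hχ⟩ := hT.1.exists_decomposition h1.pos
    rcases g.logMinimal χ hχ.clean.linear ((h1.valid_iff hχ).mp hT.2.2.1)
      ((hχ.valid_iff h2).mp hS.2.2.1) with e | e
    · exact hT.2.1 ((hχ.logEquiv_iff h1).mp e)
    · exact hS.2.1 ((hχ.logEquiv_iff h2).mp e).symm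

end LinearInference

namespace LinearInference
open Formula

/-! ### Rewriting in contexts -/

theorem subst1_of_notMem {φ : Formula} {x : ℕ} (hx : x ∉ φ.vars) (χ : Formula) :
    φ.subst1 x χ = φ := by
  rw [subst1]
  conv_rhs => rw [← subst_var φ]
  exact subst_congr fun y hy => Function.update_of_ne (fun e : y = x => hx (e ▸ hy)) _ _

@[simp] theorem subst1_var_self (x : ℕ) (χ : Formula) : (var x).subst1 x χ = χ := by
  simp [subst1, Formula.subst]

theorem subst1_and_left {p q : Formula} {x : ℕ} (hx : x ∉ q.vars) (χ : Formula) :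
    (and p q).subst1 x χ = and (p.subst1 x χ) q :=
  congrArg (and (p.subst1 x χ)) (subst1_of_notMem hx χ)

theorem subst1_and_right {p q : Formula} {x : ℕ} (hx : x ∉ p.vars) (χ : Formula) :
    (and p q).subst1 x χ = and p (q.subst1 x χ) :=
  congrArg (fun p => and p (q.subst1 x χ)) (subst1_of_notMem hx χ)

theorem subst1_or_left {p q : Formula} {x : ℕ} (hx : x ∉ q.vars) (χ : Formula) :
    (or p q).subst1 x χ = or (p.subst1 x χ) q :=
  congrArg (or (p.subst1 x χ)) (subst1_of_notMem hx χ)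

theorem subst1_or_right {p q : Formula} {x : ℕ} (hx : x ∉ p.vars) (χ : Formula) :
    (or p q).subst1 x χ = or p (q.subst1 x χ) :=
  congrArg (fun p => or p (q.subst1 x χ)) (subst1_of_notMem hx χ)

theorem Rewrite.mono {S T : Set Inference} (h : S ⊆ T) {φ ψ : Formula} (hr : Rewrite S φ ψ) :
    Rewrite T φ ψ := by
  induction hr with
  | rule σ hr => exact .rule σ (h hr)
  | and_right χ _ ih => exact .and_right χ ih
  | and_left χ _ ih => exact .and_left χ ih
  | or_right χ _ ih => exact .or_right χ ih
  | or_left χ _ ih => exact .or_left χ ih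

theorem Rewrite.subst {S : Set Inference} {φ ψ : Formula} (h : Rewrite S φ ψ) (τ : ℕ → Formula) :
    Rewrite S (φ.subst τ) (ψ.subst τ) := by
  induction h with
  | rule σ hr => rw [subst_subst, subst_subst]; exact .rule _ hr
  | and_right χ _ ih => exact .and_right _ ih
  | and_left χ _ ih => exact .and_left _ ih
  | or_right χ _ ih => exact .or_right _ ih
  | or_left χ _ ih => exact .or_left _ ih

/-- The hole has to be positive, since substitution negates what is put in place of a negative
literal. -/
theorem Rewrite.subst1 {S : Set Inference} {a b : Formula} (h : Rewrite S a b) {C : Formula}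
    (hC : C.Linear) {x : ℕ} (hx : x ∈ C.vars) (hn : x ∉ C.negv) :
    Rewrite S (C.subst1 x a) (C.subst1 x b) := by
  induction C with
  | top => simp [vars] at hx
  | bot => simp [vars] at hx
  | var y =>
    simp only [vars, Finset.mem_singleton] at hx
    subst hx; simpa using h
  | nvar y => exact absurd hx hn
  | and p q ihp ihq =>
    simp only [negv, Finset.mem_union, not_or] at hn
    rcases Finset.mem_union.mp hx with hx | hx
    · have hq := Finset.disjoint_left.mp hC.2.2 hx
      rw [subst1_and_left hq, subst1_and_left hq]
      exact .and_right q (ihp hC.1 hx hn.1)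
    · have hp := Finset.disjoint_right.mp hC.2.2 hx
      rw [subst1_and_right hp, subst1_and_right hp]
      exact .and_left p (ihq hC.2.1 hx hn.2)
  | or p q ihp ihq =>
    simp only [negv, Finset.mem_union, not_or] at hn
    rcases Finset.mem_union.mp hx with hx | hx
    · have hq := Finset.disjoint_left.mp hC.2.2 hx
      rw [subst1_or_left hq, subst1_or_left hq]
      exact .or_right q (ihp hC.1 hx hn.1)
    · have hp := Finset.disjoint_right.mp hC.2.2 hx
      rw [subst1_or_right hp, subst1_or_right hp]
      exact .or_left p (ihq hC.2.1 hx hn.2)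

/-- Every rewrite step takes place at a positive occurrence of a fresh variable in a linear
context. -/
theorem Rewrite.exists_context {S : Set Inference} {φ ψ : Formula} (h : Rewrite S φ ψ) :
    ∃ r ∈ S, ∃ σ : ℕ → Formula, ∀ x, x ∉ φ.vars ∪ ψ.vars → φ.Linear → ∃ C : Formula, C.Linear ∧
      x ∈ C.vars ∧ x ∉ C.negv ∧ C.vars ⊆ insert x φ.vars ∧ (φ.ConstFree → C.ConstFree) ∧
      (φ.NegFree → C.NegFree) ∧ φ = C.subst1 x (r.lhs.subst σ) ∧
      ψ = C.subst1 x (r.rhs.subst σ) := by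
  have disj : ∀ {C φ χ : Formula} {x : ℕ}, C.vars ⊆ insert x φ.vars → Disjoint φ.vars χ.vars →
      x ∉ χ.vars → Disjoint C.vars χ.vars := by
    intro C φ χ x h1 h2 h3
    exact Disjoint.mono_left h1 ((Finset.disjoint_insert_left).mpr ⟨h3, h2⟩)
  have nneg : ∀ {χ : Formula} {x : ℕ}, x ∉ χ.vars → x ∉ χ.negv := fun h h' => h (negv_subset _ h')
  induction h with
  | @rule r σ hr =>
    refine ⟨r, hr, σ, fun x hx _ => ⟨var x, trivial, by simp [vars], by simp [negv],
      by simp [vars], fun _ => trivial, fun _ => trivial, by simp, by simp⟩⟩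
  | @and_right φ ψ χ _ ih =>
    obtain ⟨r, hr, σ, ih⟩ := ih
    refine ⟨r, hr, σ, fun x hx hl => ?_⟩
    simp only [vars, Finset.mem_union, not_or] at hx ih
    obtain ⟨C, h1, h2, h3, h4, h5, h6, h7, h8⟩ := ih x ⟨hx.1.1, hx.2.1⟩ hl.1
    refine ⟨and C χ, ⟨h1, hl.2.1, disj h4 hl.2.2 hx.1.2⟩, Finset.mem_union_left _ h2,
      by simp [negv, h3, nneg hx.1.2], ?_, fun h => ⟨h5 h.1, h.2⟩, fun h => ⟨h6 h.1, h.2⟩, ?_, ?_⟩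
    · rw [vars, vars, ← Finset.insert_union]; exact Finset.union_subset_union h4 subset_rfl
    · rw [subst1_and_left hx.1.2, ← h7]
    · rw [subst1_and_left hx.1.2, ← h8]
  | @and_left φ ψ χ _ ih =>
    obtain ⟨r, hr, σ, ih⟩ := ih
    refine ⟨r, hr, σ, fun x hx hl => ?_⟩
    simp only [vars, Finset.mem_union, not_or] at hx ih
    obtain ⟨C, h1, h2, h3, h4, h5, h6, h7, h8⟩ := ih x ⟨hx.1.2, hx.2.2⟩ hl.2.1
    refine ⟨and χ C, ⟨hl.1, h1, (disj h4 hl.2.2.symm hx.1.1).symm⟩, Finset.mem_union_right _ h2,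
      by simp [negv, h3, nneg hx.1.1], ?_, fun h => ⟨h.1, h5 h.2⟩, fun h => ⟨h.1, h6 h.2⟩, ?_, ?_⟩
    · rw [vars, vars, ← Finset.union_insert]; exact Finset.union_subset_union subset_rfl h4
    · rw [subst1_and_right hx.1.1, ← h7]
    · rw [subst1_and_right hx.1.1, ← h8]
  | @or_right φ ψ χ _ ih =>
    obtain ⟨r, hr, σ, ih⟩ := ih
    refine ⟨r, hr, σ, fun x hx hl => ?_⟩
    simp only [vars, Finset.mem_union, not_or] at hx ih
    obtain ⟨C, h1, h2, h3, h4, h5, h6, h7, h8⟩ := ih x ⟨hx.1.1, hx.2.1⟩ hl.1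
    refine ⟨or C χ, ⟨h1, hl.2.1, disj h4 hl.2.2 hx.1.2⟩, Finset.mem_union_left _ h2,
      by simp [negv, h3, nneg hx.1.2], ?_, fun h => ⟨h5 h.1, h.2⟩, fun h => ⟨h6 h.1, h.2⟩, ?_, ?_⟩
    · rw [vars, vars, ← Finset.insert_union]; exact Finset.union_subset_union h4 subset_rfl
    · rw [subst1_or_left hx.1.2, ← h7]
    · rw [subst1_or_left hx.1.2, ← h8]
  | @or_left φ ψ χ _ ih =>
    obtain ⟨r, hr, σ, ih⟩ := ih
    refine ⟨r, hr, σ, fun x hx hl => ?_⟩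
    simp only [vars, Finset.mem_union, not_or] at hx ih
    obtain ⟨C, h1, h2, h3, h4, h5, h6, h7, h8⟩ := ih x ⟨hx.1.2, hx.2.2⟩ hl.2.1
    refine ⟨or χ C, ⟨hl.1, h1, (disj h4 hl.2.2.symm hx.1.1).symm⟩, Finset.mem_union_right _ h2,
      by simp [negv, h3, nneg hx.1.1], ?_, fun h => ⟨h.1, h5 h.2⟩, fun h => ⟨h.1, h6 h.2⟩, ?_, ?_⟩
    · rw [vars, vars, ← Finset.union_insert]; exact Finset.union_subset_union subset_rfl h4
    · rw [subst1_or_right hx.1.1, ← h7]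
    · rw [subst1_or_right hx.1.1, ← h8]

theorem Rewrite.implies {S : Set Inference} (hS : ∀ r ∈ S, Implies r.lhs r.rhs)
    {φ ψ : Formula} (h : Rewrite S φ ψ) : Implies φ ψ := by
  induction h with
  | rule σ hr => intro α; rw [eval_subst, eval_subst]; exact hS _ hr _
  | _ χ _ ih =>
    intro α
    simp only [eval, Bool.and_eq_true, Bool.or_eq_true]
    have := ih α
    tauto

/-! ### Clean contexts -/

/-- `C` is a clean context with hole `x`, and `σ` a clean substitution for the variables `W`, such
that plugging an instance by `σ` of a clean formula on `W` into the hole gives a clean formula. -/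
structure IsCtx (C : Formula) (x : ℕ) (σ : ℕ → Formula) (W : Finset ℕ) : Prop where
  clean : C.Clean
  hole : x ∈ C.vars
  subst_clean : ∀ z ∈ W, (σ z).Clean
  disjoint : ∀ z ∈ W, ∀ w ∈ W, z ≠ w → Disjoint (σ z).vars (σ w).vars
  disjoint_erase : ∀ z ∈ W, Disjoint (σ z).vars (C.vars.erase x)

theorem eval_plug (C : Formula) (x : ℕ) (σ : ℕ → Formula) (a : Formula) (α : ℕ → Bool) :
    (C.subst1 x (a.subst σ)).eval α =
      C.eval (Function.update α x (a.eval fun z => (σ z).eval α)) := by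
  rw [eval_subst1, eval_subst]

theorem Formula.LogEquiv.plug {a b : Formula} (h : LogEquiv a b) (C : Formula) (x : ℕ)
    (σ : ℕ → Formula) : LogEquiv (C.subst1 x (a.subst σ)) (C.subst1 x (b.subst σ)) := fun α => by
  rw [eval_plug, eval_plug, h]

theorem mem_vars_subst1 {C χ : Formula} {x y : ℕ} (hx : x ∈ C.vars) :
    y ∈ (C.subst1 x χ).vars ↔ y ∈ C.vars.erase x ∨ y ∈ χ.vars := by
  rw [subst1, mem_vars_subst]
  constructor
  · rintro ⟨z, hz, hy⟩
    by_cases e : z = x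
    · subst e; right; simpa using hy
    · rw [Function.update_of_ne e] at hy
      simp only [vars, Finset.mem_singleton] at hy
      subst hy; exact Or.inl (Finset.mem_erase.mpr ⟨e, hz⟩)
  · rintro (h | h)
    · rw [Finset.mem_erase] at h
      exact ⟨y, h.2, by simp [Function.update_of_ne h.1, vars]⟩
    · exact ⟨x, hx, by simpa using h⟩

theorem linear_subst1 {C χ : Formula} {x : ℕ} (hC : C.Linear) (hx : x ∈ C.vars) :
    (C.subst1 x χ).Linear ↔ χ.Linear ∧ Disjoint χ.vars (C.vars.erase x) := by
  rw [subst1, linear_subst hC]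
  constructor
  · rintro ⟨h1, h2⟩
    refine ⟨by simpa using h1 x hx, ?_⟩
    rw [Finset.disjoint_right]
    intro y hy
    rw [Finset.mem_erase] at hy
    have := h2 x hx y hy.2 hy.1.symm
    simp only [Function.update_self, Function.update_of_ne hy.1, vars,
      Finset.disjoint_singleton_right] at this
    exact this
  · rintro ⟨h1, h2⟩
    rw [Finset.disjoint_right] at h2
    refine ⟨fun y hy => ?_, fun y hy z hz hyz => ?_⟩
    · by_cases e : y = x
      · subst e; simpa using h1
      · rw [Function.update_of_ne e]; trivial
    · by_cases e : y = x
      · subst e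
        rw [Function.update_self, Function.update_of_ne hyz.symm]
        simpa [vars] using h2 (Finset.mem_erase.mpr ⟨hyz.symm, hz⟩)
      · by_cases e' : z = x
        · subst e'
          rw [Function.update_self, Function.update_of_ne e]
          simpa [vars] using h2 (Finset.mem_erase.mpr ⟨e, hy⟩)
        · rw [Function.update_of_ne e, Function.update_of_ne e']
          simpa [vars] using hyz

namespace IsCtx

variable {C : Formula} {x : ℕ} {σ : ℕ → Formula} {W : Finset ℕ} {a : Formula}

theorem clean_plug (h : IsCtx C x σ W) (ha : a.Clean) (hW : a.vars ⊆ W) :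
    (C.subst1 x (a.subst σ)).Clean := by
  have h1 : (a.subst σ).Clean := ha.subst (fun z hz => h.subst_clean z (hW hz))
    fun z hz w hw => h.disjoint z (hW hz) w (hW hw)
  refine ⟨(linear_subst1 h.clean.linear h.hole).mpr ⟨h1.linear, ?_⟩,
    (constFree_subst h.clean.constFree).mpr fun y _ => ?_, h.clean.negFree.subst fun y _ => ?_⟩
  · rw [vars_subst, Finset.disjoint_biUnion_left]
    exact fun z hz => h.disjoint_erase z (hW hz)
  · by_cases e : y = x
    · subst e; simpa using h1.constFree
    · rw [Function.update_of_ne e]; trivial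
  · by_cases e : y = x
    · subst e; simpa using h1.negFree
    · rw [Function.update_of_ne e]; trivial

theorem mem_vars_plug (h : IsCtx C x σ W) (hW : a.vars = W) {y : ℕ} :
    y ∈ (C.subst1 x (a.subst σ)).vars ↔ y ∈ C.vars.erase x ∨ ∃ z ∈ W, y ∈ (σ z).vars := by
  rw [mem_vars_subst1 h.hole, mem_vars_subst, hW]

/-- The inner formula can be evaluated arbitrarily, with the value of the whole equal to it. -/
theorem exists_eval (h : IsCtx C x σ W) (β : ℕ → Bool) : ∃ α : ℕ → Bool,
    (∀ z ∈ W, (σ z).eval α = β z) ∧ ∀ b, C.eval (Function.update α x b) = b := by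
  obtain ⟨α₀, h0⟩ := h.clean.exists_critical h.hole
  have : ∀ z : ℕ, ∃ γ : ℕ → Bool, z ∈ W → (σ z).eval γ = β z := by
    intro z
    by_cases hz : z ∈ W
    · obtain ⟨γ, hγ⟩ := exists_eval_eq (h.subst_clean z hz).linear (h.subst_clean z hz).constFree
        (β z)
      exact ⟨γ, fun _ => hγ⟩
    · exact ⟨β, fun h => absurd h hz⟩
  choose γ hγ using this
  classical
  -- Substitutes and context use disjoint variables, so `γ z` on the substitute of `z` can be glued
  -- with the critical assignment `α₀` on the rest of the context.
  refine ⟨fun y => if hy : ∃ z ∈ W, y ∈ (σ z).vars then γ hy.choose y else α₀ y,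
    fun z hz => ?_, fun b => ?_⟩
  · rw [← hγ z hz]
    refine eval_congr fun y hy => ?_
    have hex : ∃ z ∈ W, y ∈ (σ z).vars := ⟨z, hz, hy⟩
    have : hex.choose = z := by
      by_contra hne
      exact Finset.disjoint_left.mp (h.disjoint _ hex.choose_spec.1 z hz hne)
        hex.choose_spec.2 hy
    simp only [hex, dite_true, this]
  · refine Eq.trans ?_ (h0 b)
    refine eval_congr fun y hy => ?_
    by_cases e : y = x
    · subst e; simp
    · rw [Function.update_of_ne e, Function.update_of_ne e, dif_neg]
      rintro ⟨z, hz, hyz⟩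
      exact Finset.disjoint_left.mp (h.disjoint_erase z hz) hyz (Finset.mem_erase.mpr ⟨e, hy⟩)

/-- Every assignment of the inner variables is realised by one under which the context merely copies
its hole, so contexts reflect validity. -/
theorem implies_of_plug (h : IsCtx C x σ W) {b : Formula} (ha : a.vars ⊆ W) (hb : b.vars ⊆ W)
    (hi : Implies (C.subst1 x (a.subst σ)) (C.subst1 x (b.subst σ))) : Implies a b := by
  intro β hβ
  obtain ⟨α, h1, h2⟩ := h.exists_eval β
  have := hi α
  rw [eval_plug, eval_plug, h2, h2, eval_congr fun z hz => h1 z (ha hz),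
    eval_congr fun z hz => h1 z (hb hz)] at this
  exact this hβ

end IsCtx

/-- `φ → ψ` arises from the inference `r` by a clean substitution and a clean context. -/
def CtxInst (r : Inference) (φ ψ : Formula) : Prop :=
  ∃ C x σ, IsCtx C x σ r.lhs.vars ∧ LogEquiv φ (C.subst1 x (r.lhs.subst σ)) ∧
    LogEquiv ψ (C.subst1 x (r.rhs.subst σ))

/-- Both sides are clean and on the same variables. -/
structure CleanInf (r : Inference) : Prop where
  lhs : r.lhs.Clean
  rhs : r.rhs.Clean
  vars_eq : r.lhs.vars = r.rhs.vars

theorem CleanInf.vars {r : Inference} (h : CleanInf r) : r.vars = r.lhs.vars := by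
  rw [Inference.vars, ← h.vars_eq, Finset.union_self]

theorem Good.cleanInf {r : Inference} (h : Good r) : CleanInf r := ⟨h.lhs, h.rhs, h.vars_eq⟩

/-- `CtxInst` replaces the `AC` steps of `Instance` by logical equivalence, which is the same on
clean formulae. -/
theorem CtxInst.instance {S : Set Inference} {r : Inference} {φ ψ : Formula}
    (h : CtxInst r φ ψ) (hr : r ∈ S) (hc : CleanInf r) (hφ : φ.Clean) (hψ : ψ.Clean) :
    Instance S φ ψ := by
  obtain ⟨C, x, σ, hctx, h1, h2⟩ := h
  exact ⟨_, _, h1.ac hφ (hctx.clean_plug hc.lhs subset_rfl),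
    (Rewrite.rule σ hr).subst1 hctx.clean.linear hctx.hole
      (by rw [(negFree_iff C).mp hctx.clean.negFree]; simp),
    h2.symm.ac (hctx.clean_plug hc.rhs hc.vars_eq.ge) hψ⟩

/-- The rewritten formula is clean as a whole, and this is inherited by the context around a fresh
hole and by every substitute, because a clean rule uses each of its variables positively. -/
theorem Instance.exists_ctxInst {S : Set Inference} {φ ψ : Formula} (h : Instance S φ ψ)
    (hS : ∀ r ∈ S, CleanInf r) (hφ : φ.Clean) : ∃ r ∈ S, CtxInst r φ ψ := by
  obtain ⟨φ', ψ', h1, h2, h3⟩ := h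
  have hφ' := h1.clean_iff.mp hφ
  obtain ⟨r, hr, σ, hC⟩ := h2.exists_context
  obtain ⟨x, hx⟩ := Infinite.exists_notMem_finset (φ'.vars ∪ ψ'.vars)
  obtain ⟨C, c1, c2, c3, c4, c5, c6, rfl, rfl⟩ := hC x hx hφ'.linear
  have hr' := hS r hr
  have hl := (linear_subst1 c1 c2).mp hφ'.linear
  have hlin := (linear_subst hr'.lhs.linear).mp hl.1
  have cf := (constFree_subst (c5 hφ'.constFree)).mp hφ'.constFree x c2
  have nf := ((negFree_subst _ C).mp hφ'.negFree).1 x ((c6 hφ'.negFree).mem_posv c2)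
  rw [Function.update_self] at cf nf
  rw [constFree_subst hr'.lhs.constFree] at cf
  refine ⟨r, hr, C, x, σ, ⟨⟨c1, c5 hφ'.constFree, c6 hφ'.negFree⟩, c2, fun z hz =>
    ⟨hlin.1 z hz, cf z hz, ((negFree_subst σ _).mp nf).1 z (hr'.lhs.negFree.mem_posv hz)⟩,
    hlin.2, fun z hz => ?_⟩, h1.logEquiv, h3.logEquiv.symm⟩
  refine hl.2.mono_left fun y hy => ?_
  exact mem_vars_subst.mpr ⟨z, hz, hy⟩

/-- An instance of an instance is an instance. -/
theorem CtxInst.trans_instance {S : Set Inference} {r : Inference} {φ ψ : Formula}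
    (h : CtxInst r φ ψ) (hr : Instance S r.lhs r.rhs) (hc : CleanInf r) (hφ : φ.Clean)
    (hψ : ψ.Clean) : Instance S φ ψ := by
  obtain ⟨C, x, σ, hctx, h1, h2⟩ := h
  obtain ⟨p, q, e1, hpq, e2⟩ := hr
  have cp := e1.clean_iff.mp hc.lhs
  have cq := e2.clean_iff.mpr hc.rhs
  exact ⟨_, _, (h1.trans (LogEquiv.plug e1.logEquiv C x σ)).ac hφ
      (hctx.clean_plug cp e1.vars_eq.ge),
    (hpq.subst σ).subst1 hctx.clean.linear hctx.hole
      (by rw [(negFree_iff C).mp hctx.clean.negFree]; simp),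
    ((LogEquiv.plug e2.logEquiv C x σ).trans h2.symm).ac
      (hctx.clean_plug cq (e2.vars_eq.trans hc.vars_eq.symm).le) hψ⟩

end LinearInference

namespace LinearInference
open Formula

/-! ### Instances of graph inferences -/

/-- The least common connective of two nodes lies either inside one substitute or where the
variables that host them meet in `φ`. -/
theorem edge_subst (σ : ℕ → Formula) {φ : Formula} (h : φ.NegFree) (x y : ℕ) :
    (φ.subst σ).Edge x y ↔ (∃ u ∈ φ.vars, (σ u).Edge x y) ∨
      ∃ u v, φ.Edge u v ∧ x ∈ (σ u).vars ∧ y ∈ (σ v).vars := by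
  induction φ with
  | top => simp [Formula.subst, Edge, vars]
  | bot => simp [Formula.subst, Edge, vars]
  | var z => simp [Formula.subst, Edge, vars]
  | nvar z => exact h.elim
  | and a b iha ihb =>
    simp only [Formula.subst, Edge, vars, iha h.1, ihb h.2, mem_vars_subst, Finset.mem_union]
    constructor
    · rintro ((⟨u, hu, e⟩ | ⟨u, v, e⟩) | (⟨u, hu, e⟩ | ⟨u, v, e⟩) |
        (⟨⟨u, hu, hx⟩, v, hv, hy⟩ | ⟨⟨u, hu, hx⟩, v, hv, hy⟩))
      · exact Or.inl ⟨u, Or.inl hu, e⟩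
      · exact Or.inr ⟨u, v, Or.inl e.1, e.2⟩
      · exact Or.inl ⟨u, Or.inr hu, e⟩
      · exact Or.inr ⟨u, v, Or.inr (Or.inl e.1), e.2⟩
      · exact Or.inr ⟨u, v, Or.inr (Or.inr (Or.inl ⟨hu, hv⟩)), hx, hy⟩
      · exact Or.inr ⟨u, v, Or.inr (Or.inr (Or.inr ⟨hu, hv⟩)), hx, hy⟩
    · rintro (⟨u, hu | hu, e⟩ | ⟨u, v, e | e | ⟨hu, hv⟩ | ⟨hu, hv⟩, hx, hy⟩)
      · exact Or.inl (Or.inl ⟨u, hu, e⟩)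
      · exact Or.inr (Or.inl (Or.inl ⟨u, hu, e⟩))
      · exact Or.inl (Or.inr ⟨u, v, e, hx, hy⟩)
      · exact Or.inr (Or.inl (Or.inr ⟨u, v, e, hx, hy⟩))
      · exact Or.inr (Or.inr (Or.inl ⟨⟨u, hu, hx⟩, v, hv, hy⟩))
      · exact Or.inr (Or.inr (Or.inr ⟨⟨u, hu, hx⟩, v, hv, hy⟩))
  | or a b iha ihb =>
    simp only [Formula.subst, Edge, vars, iha h.1, ihb h.2, Finset.mem_union]
    constructor
    · rintro ((⟨u, hu, e⟩ | ⟨u, v, e⟩) | (⟨u, hu, e⟩ | ⟨u, v, e⟩))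
      · exact Or.inl ⟨u, Or.inl hu, e⟩
      · exact Or.inr ⟨u, v, Or.inl e.1, e.2⟩
      · exact Or.inl ⟨u, Or.inr hu, e⟩
      · exact Or.inr ⟨u, v, Or.inr e.1, e.2⟩
    · rintro (⟨u, hu | hu, e⟩ | ⟨u, v, e | e, hx, hy⟩)
      · exact Or.inl (Or.inl ⟨u, hu, e⟩)
      · exact Or.inr (Or.inl ⟨u, hu, e⟩)
      · exact Or.inl (Or.inr ⟨u, v, e, hx, hy⟩)
      · exact Or.inr (Or.inr ⟨u, v, e, hx, hy⟩)

namespace IsCtx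

variable {C : Formula} {h : ℕ} {σ : ℕ → Formula} {W : Finset ℕ} {a : Formula} {x y u v : ℕ}

theorem edge_plug_outer (hc : IsCtx C h σ W) (hW : a.vars ⊆ W) (hx : x ∈ C.vars.erase h)
    (hy : y ∈ C.vars.erase h) : (C.subst1 h (a.subst σ)).Edge x y ↔ C.Edge x y := by
  have key : ∀ {z : ℕ}, z ∈ C.vars.erase h → ∀ w, z ∈ (Function.update var h (a.subst σ) w).vars →
      w = z := by
    intro z hz w hw
    by_cases e : w = h
    · subst e
      rw [Function.update_self, mem_vars_subst] at hw
      obtain ⟨u, hu, hzu⟩ := hw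
      exact absurd hz (Finset.disjoint_left.mp (hc.disjoint_erase u (hW hu)) hzu)
    · rw [Function.update_of_ne e] at hw; simpa [vars, eq_comm] using hw
  have hx' := Finset.mem_erase.mp hx
  have hy' := Finset.mem_erase.mp hy
  rw [subst1, edge_subst _ hc.clean.negFree]
  constructor
  · rintro (⟨w, hw, e⟩ | ⟨w, z, e, h1, h2⟩)
    · have := key hx w e.mem.1; subst this
      rw [Function.update_of_ne hx'.1] at e; exact e.elim
    · rw [← key hx w h1, ← key hy z h2]; exact e
  · intro e
    exact Or.inr ⟨x, y, e, by simp [Function.update_of_ne hx'.1, vars],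
      by simp [Function.update_of_ne hy'.1, vars]⟩

/-- Seen from the context, every plugged node behaves like the hole; this is why the plugged part is
a module. -/
theorem edge_plug_mixed (hc : IsCtx C h σ W) (hW : a.vars ⊆ W) (hu : u ∈ a.vars)
    (hx : x ∈ (σ u).vars) (hy : y ∈ C.vars.erase h) :
    (C.subst1 h (a.subst σ)).Edge x y ↔ C.Edge h y := by
  have key : ∀ {z : ℕ}, z ∈ C.vars.erase h → ∀ w, z ∈ (Function.update var h (a.subst σ) w).vars →
      w = z := by
    intro z hz w hw
    by_cases e : w = h
    · subst e
      rw [Function.update_self, mem_vars_subst] at hw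
      obtain ⟨u, hu, hzu⟩ := hw
      exact absurd hz (Finset.disjoint_left.mp (hc.disjoint_erase u (hW hu)) hzu)
    · rw [Function.update_of_ne e] at hw; simpa [vars, eq_comm] using hw
  have keyx : ∀ w ∈ C.vars, x ∈ (Function.update var h (a.subst σ) w).vars → w = h := by
    intro w hw h'
    by_contra e
    rw [Function.update_of_ne e] at h'
    simp only [vars, Finset.mem_singleton] at h'
    subst h'
    exact Finset.disjoint_left.mp (hc.disjoint_erase u (hW hu)) hx (Finset.mem_erase.mpr ⟨e, hw⟩)
  have hy' := Finset.mem_erase.mp hy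
  rw [subst1, edge_subst _ hc.clean.negFree]
  constructor
  · rintro (⟨w, hw, e⟩ | ⟨w, z, e, h1, h2⟩)
    · have := key hy w e.mem.2; subst this
      rw [Function.update_of_ne hy'.1] at e; exact e.elim
    · rw [← key hy z h2, ← keyx w e.mem.1 h1]; exact e
  · intro e
    refine Or.inr ⟨h, y, e, ?_, by simp [Function.update_of_ne hy'.1, vars]⟩
    rw [Function.update_self, mem_vars_subst]; exact ⟨u, hu, hx⟩

theorem edge_plug_inner (hc : IsCtx C h σ W) (hW : a.vars ⊆ W) (hu : u ∈ a.vars)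
    (hv : v ∈ a.vars) (hx : x ∈ (σ u).vars) (hy : y ∈ (σ v).vars) :
    (C.subst1 h (a.subst σ)).Edge x y ↔ (a.subst σ).Edge x y := by
  have keyx : ∀ w ∈ C.vars, x ∈ (Function.update var h (a.subst σ) w).vars → w = h := by
    intro w hw h'
    by_contra e
    rw [Function.update_of_ne e] at h'
    simp only [vars, Finset.mem_singleton] at h'
    subst h'
    exact Finset.disjoint_left.mp (hc.disjoint_erase u (hW hu)) hx (Finset.mem_erase.mpr ⟨e, hw⟩)
  have keyy : ∀ w ∈ C.vars, y ∈ (Function.update var h (a.subst σ) w).vars → w = h := by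
    intro w hw h'
    by_contra e
    rw [Function.update_of_ne e] at h'
    simp only [vars, Finset.mem_singleton] at h'
    subst h'
    exact Finset.disjoint_left.mp (hc.disjoint_erase v (hW hv)) hy (Finset.mem_erase.mpr ⟨e, hw⟩)
  rw [subst1, edge_subst _ hc.clean.negFree]
  constructor
  · rintro (⟨w, hw, e⟩ | ⟨w, z, e, h1, h2⟩)
    · have := keyx w hw e.mem.1; subst this
      simpa using e
    · have h1 := keyx w e.mem.1 h1
      have h2 := keyy z e.mem.2 h2
      exact absurd (h1.trans h2.symm) (e.ne hc.clean.linear)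
  · intro e
    exact Or.inl ⟨h, hc.hole, by simpa using e⟩

theorem edge_subst_eq (hc : IsCtx C h σ W) (ha : a.Clean) (hW : a.vars ⊆ W) (hu : u ∈ a.vars)
    (hx : x ∈ (σ u).vars) (hy : y ∈ (σ u).vars) : (a.subst σ).Edge x y ↔ (σ u).Edge x y := by
  have key : ∀ {z w : ℕ}, w ∈ a.vars → z ∈ (σ u).vars → z ∈ (σ w).vars → w = u := by
    intro z w hw h1 h2
    by_contra hne
    exact Finset.disjoint_left.mp (hc.disjoint w (hW hw) u (hW hu) hne) h2 h1
  rw [edge_subst _ ha.negFree]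
  constructor
  · rintro (⟨w, hw, e⟩ | ⟨w, z, e, h1, h2⟩)
    · rwa [key hw hx e.mem.1] at e
    · exact absurd ((key e.mem.1 hx h1).trans (key e.mem.2 hy h2).symm) (e.ne ha.linear)
  · exact fun e => Or.inl ⟨u, hu, e⟩

theorem edge_subst_ne (hc : IsCtx C h σ W) (ha : a.Clean) (hW : a.vars ⊆ W) (hu : u ∈ a.vars)
    (hv : v ∈ a.vars) (hne : u ≠ v) (hx : x ∈ (σ u).vars) (hy : y ∈ (σ v).vars) :
    (a.subst σ).Edge x y ↔ a.Edge u v := by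
  have key : ∀ {z w u : ℕ}, u ∈ a.vars → w ∈ a.vars → z ∈ (σ u).vars → z ∈ (σ w).vars → w = u := by
    intro z w u hu hw h1 h2
    by_contra hne
    exact Finset.disjoint_left.mp (hc.disjoint w (hW hw) u (hW hu) hne) h2 h1
  rw [edge_subst _ ha.negFree]
  constructor
  · rintro (⟨w, hw, e⟩ | ⟨w, z, e, h1, h2⟩)
    · exact absurd ((key hu hw hx e.mem.1).symm.trans (key hv hw hy e.mem.2)) hne
    · rwa [key hu e.mem.1 hx h1, key hv e.mem.2 hy h2] at e
  · exact fun e => Or.inr ⟨u, v, e, hx, hy⟩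

end IsCtx

theorem Web.adj_eq_iff {n k : ℕ} {R : Web n} {S : Web k} {x y : Fin n} {z w : Fin k} :
    R.adj x y = S.adj z w ↔ (R.E x y ↔ S.E z w) := by
  rw [Bool.eq_iff_iff, Web.E_val, Web.E_val]

/-- The module consists of the nodes in the substitutes, partitioned by the variable of the rule
that they replace. Edges that leave it come from the context and edges inside a part from its
substitute; both are shared by the two sides. -/
theorem isInstance_of_ctxInst {n k : ℕ} {A B : Web k} {R S : Web n} {r : Inference}
    {φ ψ : Formula} (hr : IsDecompositionOf r ⟨k, A, B⟩) (hφ : IsDecomposition φ R)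
    (hψ : IsDecomposition ψ S) (h : CtxInst r φ ψ) : isInstance A B R S := by
  classical
  obtain ⟨hA, hB⟩ : IsDecomposition r.lhs A ∧ IsDecomposition r.rhs B := hr
  obtain ⟨C, h0, σ, hc, e1, e2⟩ := h
  rw [hA.vars] at hc
  have wA := hA.vars.le
  have wB := hB.vars.le
  have c1 := hc.clean_plug hA.clean wA
  have c2 := hc.clean_plug hB.clean wB
  have E1 : ∀ x y, R.E x y ↔ (C.subst1 h0 (r.lhs.subst σ)).Edge x y := fun x y =>
    (hφ.edge x y).symm.trans (e1.edge_iff hφ.clean c1 x y)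
  have E2 : ∀ x y, S.E x y ↔ (C.subst1 h0 (r.rhs.subst σ)).Edge x y := fun x y =>
    (hψ.edge x y).symm.trans (e2.edge_iff hψ.clean c2 x y)
  have hv : ∀ y, y < n ↔ y ∈ C.vars.erase h0 ∨ ∃ z ∈ Finset.range k, y ∈ (σ z).vars := by
    intro y
    rw [← hc.mem_vars_plug hA.vars, ← e1.vars_eq hφ.clean c1, hφ.vars, Finset.mem_range]
  set M : Finset (Fin n) := Finset.univ.filter fun x => ∃ z < k, (x : ℕ) ∈ (σ z).vars with hM
  have mM : ∀ x : Fin n, x ∈ M ↔ ∃ z < k, (x : ℕ) ∈ (σ z).vars := by simp [hM]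
  have nM : ∀ x : Fin n, x ∉ M → (x : ℕ) ∈ C.vars.erase h0 := by
    intro x hx
    refine ((hv x).mp x.2).resolve_right ?_
    rintro ⟨z, hz, h⟩
    exact hx ((mM x).mpr ⟨z, Finset.mem_range.mp hz, h⟩)
  have rk : ∀ {z}, z < k → z ∈ r.lhs.vars := fun h => by rw [hA.vars]; exact Finset.mem_range.mpr h
  have rk' : ∀ {z}, z < k → z ∈ r.rhs.vars := fun h => by rw [hB.vars]; exact Finset.mem_range.mpr h
  have p : ∀ x : Fin n, ∃ u : Fin k, x ∈ M → (x : ℕ) ∈ (σ u).vars := by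
    intro x
    by_cases hx : x ∈ M
    · obtain ⟨z, hz, h⟩ := (mM x).mp hx
      exact ⟨⟨z, hz⟩, fun _ => h⟩
    -- An arbitrary value: only the parts of nodes in `M` matter.
    · exact ⟨⟨0, hA.pos⟩, fun h => absurd h hx⟩
  choose p hp using p
  refine ⟨M, ⟨?_, ?_, ?_⟩, p, ?_, ?_⟩
  · intro x hx y hy z hz
    obtain ⟨u, hu, hxu⟩ := (mM x).mp hx
    obtain ⟨v, hv, hyv⟩ := (mM y).mp hy
    rw [Web.adj_eq_iff, E1, E1, hc.edge_plug_mixed wA (rk hu) hxu (nM z hz),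
      hc.edge_plug_mixed wA (rk hv) hyv (nM z hz)]
  · intro x hx y hy z hz
    obtain ⟨u, hu, hxu⟩ := (mM x).mp hx
    obtain ⟨v, hv, hyv⟩ := (mM y).mp hy
    rw [Web.adj_eq_iff, E2, E2, hc.edge_plug_mixed wB (rk' hu) hxu (nM z hz),
      hc.edge_plug_mixed wB (rk' hv) hyv (nM z hz)]
  · have mixed : ∀ x y, x ∈ M → y ∉ M → R.adj x y = S.adj x y := by
      intro x y hx hy
      obtain ⟨u, hu, hxu⟩ := (mM x).mp hx
      rw [Web.adj_eq_iff, E1, E2, hc.edge_plug_mixed wA (rk hu) hxu (nM y hy),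
        hc.edge_plug_mixed wB (rk' hu) hxu (nM y hy)]
    intro x y hxy
    by_cases hx : x ∈ M
    · exact mixed x y hx fun hy => hxy ⟨hx, hy⟩
    · by_cases hy : y ∈ M
      · rw [R.symm, S.symm]; exact mixed y x hy hx
      · rw [Web.adj_eq_iff, E1, E2, hc.edge_plug_outer wA (nM x hx) (nM y hy),
          hc.edge_plug_outer wB (nM x hx) (nM y hy)]
  · intro u
    obtain ⟨y, hy⟩ := (hc.subst_clean u (Finset.mem_range.mpr u.2)).constFree.vars_nonempty
    have hyn : y < n := (hv y).mpr (Or.inr ⟨u, Finset.mem_range.mpr u.2, hy⟩)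
    have hyM : (⟨y, hyn⟩ : Fin n) ∈ M := (mM _).mpr ⟨u, u.2, hy⟩
    refine ⟨⟨y, hyn⟩, hyM, ?_⟩
    by_contra hne
    exact Finset.disjoint_left.mp (hc.disjoint _ (Finset.mem_range.mpr (p _).2) _
      (Finset.mem_range.mpr u.2) (fun e => hne (Fin.ext e))) (hp _ hyM) hy
  · intro x hx y hy
    have hxu := hp x hx
    have hyv := hp y hy
    have hu := (p x).2
    have hv := (p y).2
    split_ifs with e
    · rw [Web.adj_eq_iff, E1, E2, hc.edge_plug_inner wA (rk hu) (rk hv) hxu hyv,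
        hc.edge_plug_inner wB (rk' hu) (rk' hv) hxu hyv]
      rw [← e] at hyv
      rw [hc.edge_subst_eq hA.clean wA (rk hu) hxu hyv, hc.edge_subst_eq hB.clean wB (rk' hu) hxu hyv]
    · have hne : ((p x : Fin k) : ℕ) ≠ p y := fun h => e (Fin.ext h)
      rw [Web.adj_eq_iff, Web.adj_eq_iff, E1,
        E2, hc.edge_plug_inner wA (rk hu) (rk hv) hxu hyv,
        hc.edge_plug_inner wB (rk' hu) (rk' hv) hxu hyv,
        hc.edge_subst_ne hA.clean wA (rk hu) (rk hv) hne hxu hyv,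
        hc.edge_subst_ne hB.clean wB (rk' hu) (rk' hv) hne hxu hyv, hA.edge, hB.edge]
      exact ⟨Iff.rfl, Iff.rfl⟩

/-- Plugging decompositions of the parts of a module into decompositions of the rule and of the
quotient gives a decomposition of the whole web. -/
theorem logEquiv_plug {n k : ℕ} {A : Web k} {T : Web n} {a φ C : Formula} {σ : ℕ → Formula}
    {M : Finset (Fin n)} {p : Fin n → Fin k} {m : Fin n} (hA : IsDecomposition a A)
    (hφ : IsDecomposition φ T) (hm : m ∈ M) (hM : IsModule T M)
    (hp : ∀ x ∈ M, ∀ y ∈ M, p x ≠ p y → T.adj x y = A.adj (p x) (p y))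
    (hc : IsCtx C m σ (Finset.range k))
    (hCv : ∀ x : Fin n, (x : ℕ) ∈ C.vars ↔ x ∉ M ∨ x = m) (hCn : ∀ x ∈ C.vars, x < n)
    (hCe : ∀ x y : Fin n, (x : ℕ) ∈ C.vars → (y : ℕ) ∈ C.vars → x ≠ y → (C.Edge x y ↔ T.E x y))
    (hσv : ∀ u : Fin k, ∀ x : Fin n, (x : ℕ) ∈ (σ u).vars ↔ x ∈ M ∧ p x = u)
    (hσn : ∀ u : Fin k, ∀ x ∈ (σ u).vars, x < n)
    (hσe : ∀ u : Fin k, ∀ x ∈ (σ u).vars, ∀ y ∈ (σ u).vars, x ≠ y → ((σ u).Edge x y ↔ T.E x y)) :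
    LogEquiv φ (C.subst1 m (a.subst σ)) := by
  have wA := hA.vars.le
  have rk : ∀ u : Fin k, (u : ℕ) ∈ a.vars := fun u => by
    rw [hA.vars]; exact Finset.mem_range.mpr u.2
  have cc := hc.clean_plug hA.clean wA
  have out : ∀ x : Fin n, x ∉ M → (x : ℕ) ∈ C.vars.erase m := fun x hx =>
    Finset.mem_erase.mpr ⟨fun e => hx (Fin.ext e ▸ hm), (hCv x).mpr (Or.inl hx)⟩
  refine (hφ.clean.ac_of_edge_iff cc ?_ ?_).logEquiv
  · ext y
    rw [hφ.vars, hc.mem_vars_plug hA.vars, Finset.mem_range]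
    constructor
    · intro hy
      by_cases h : (⟨y, hy⟩ : Fin n) ∈ M
      · exact Or.inr ⟨p ⟨y, hy⟩, Finset.mem_range.mpr (p _).2, (hσv _ ⟨y, hy⟩).mpr ⟨h, rfl⟩⟩
      · exact Or.inl (out _ h)
    · rintro (h | ⟨z, hz, h⟩)
      · exact hCn y (Finset.mem_erase.mp h).2
      · exact hσn ⟨z, Finset.mem_range.mp hz⟩ y h
  · have mixed : ∀ x y : Fin n, x ∈ M → y ∉ M →
        (T.E x y ↔ (C.subst1 m (a.subst σ)).Edge x y) := by
      intro x y hx hy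
      have hmy : m ≠ y := fun e => hy (e ▸ hm)
      rw [hc.edge_plug_mixed wA (rk (p x)) ((hσv _ x).mpr ⟨hx, rfl⟩) (out y hy),
        hCe m y ((hCv m).mpr (Or.inr rfl)) ((hCv y).mpr (Or.inl hy)) hmy, ← Web.adj_eq_iff]
      exact hM x hx m hm y hy
    have main : ∀ x y : Fin n, x ≠ y → (T.E x y ↔ (C.subst1 m (a.subst σ)).Edge x y) := by
      intro x y hxy
      by_cases hx : x ∈ M
      · by_cases hy : y ∈ M
        · have hx' := (hσv _ x).mpr ⟨hx, rfl⟩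
          have hy' := (hσv _ y).mpr ⟨hy, rfl⟩
          rw [hc.edge_plug_inner wA (rk (p x)) (rk (p y)) hx' hy']
          by_cases e : p x = p y
          · rw [← e] at hy'
            rw [hc.edge_subst_eq hA.clean wA (rk (p x)) hx' hy',
              hσe (p x) x hx' y hy' fun h => hxy (Fin.ext h)]
          · rw [hc.edge_subst_ne hA.clean wA (rk (p x)) (rk (p y)) (fun h => e (Fin.ext h)) hx' hy',
              hA.edge, T.E_val, A.E_val, hp x hx y hy e]
        · exact mixed x y hx hy
      · by_cases hy : y ∈ M
        · have := mixed y x hy hx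
          exact ⟨fun h => (this.mp (Web.E.symm _ _ h)).symm,
            fun h => Web.E.symm _ _ (this.mpr h.symm)⟩
        · rw [hc.edge_plug_outer wA (out x hx) (out y hy),
            hCe x y ((hCv x).mpr (Or.inl hx)) ((hCv y).mpr (Or.inl hy)) hxy]
    intro x y
    rw [hφ.edge]
    by_cases hxy : x < n ∧ y < n
    · by_cases e : x = y
      · subst e
        exact ⟨fun h => absurd rfl h.ne, fun h => absurd rfl (h.ne cc.linear)⟩
      · exact main ⟨x, hxy.1⟩ ⟨y, hxy.2⟩ fun h => e (Fin.mk.inj h)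
    · refine ⟨fun ⟨hx, hy, _⟩ => absurd ⟨hx, hy⟩ hxy, fun h => absurd ?_ hxy⟩
      have lt : ∀ z ∈ (C.subst1 m (a.subst σ)).vars, z < n := by
        intro z hz
        rcases (hc.mem_vars_plug hA.vars).mp hz with h | ⟨w, hw, h⟩
        · exact hCn z (Finset.mem_erase.mp h).2
        · exact hσn ⟨w, Finset.mem_range.mp hw⟩ z h
      exact ⟨lt x h.mem.1, lt y h.mem.2⟩

/-- The context is a decomposition of `R` restricted to the nodes outside `M` and one representative
of `M`; the substitutes are decompositions of `R` on the parts. As `R` and `S` agree off the module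
and inside the parts, the same formulae serve for `S`. -/
theorem ctxInst_of_isInstance {n k : ℕ} {A B : Web k} {R S : Web n} {r : Inference}
    {φ ψ : Formula} (hr : IsDecompositionOf r ⟨k, A, B⟩) (hφ : IsDecomposition φ R)
    (hψ : IsDecomposition ψ S) (h : isInstance A B R S) : CtxInst r φ ψ := by
  classical
  obtain ⟨hA, hB⟩ : IsDecomposition r.lhs A ∧ IsDecomposition r.rhs B := hr
  obtain ⟨M, ⟨m1, m2, m3⟩, p, p1, p2⟩ := h
  -- The representative `m` of the module becomes the hole; any member of `M` would do.
  obtain ⟨m, hm, -⟩ := p1 ⟨0, hA.pos⟩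
  have hfree := hφ.p4Free.p4FreeOn
  have val : ∀ {P : Finset (Fin n)} {x : ℕ}, x ∈ P.map Fin.valEmbedding ↔ ∃ h : x < n, ⟨x, h⟩ ∈ P := by
    intro P x
    rw [Finset.mem_map]
    constructor
    · rintro ⟨y, hy, rfl⟩; exact ⟨y.2, hy⟩
    · rintro ⟨h, h'⟩; exact ⟨_, h', rfl⟩
  have sub : ∀ P : Finset (Fin n), P.map Fin.valEmbedding ⊆ Finset.range n := fun P x hx =>
    Finset.mem_range.mpr (val.mp hx).choose
  obtain ⟨C, cC, vC, eC⟩ := exists_clean (E := R.E) Web.E.symm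
    (hfree.mono (sub (Finset.univ.filter fun x => x ∉ M ∨ x = m)))
    ⟨m, val.mpr ⟨m.2, by simp⟩⟩
  have : ∀ u : ℕ, ∃ χ : Formula, ∀ hu : u < k, χ.Clean ∧
      χ.vars = (M.filter fun x => p x = ⟨u, hu⟩).map Fin.valEmbedding ∧
      ∀ x ∈ χ.vars, ∀ y ∈ χ.vars, x ≠ y → (χ.Edge x y ↔ R.E x y) := by
    intro u
    by_cases hu : u < k
    · obtain ⟨y, hy, e⟩ := p1 ⟨u, hu⟩
      obtain ⟨χ, h1, h2, h3⟩ := exists_clean (E := R.E) Web.E.symm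
        (hfree.mono (sub (M.filter fun x => p x = ⟨u, hu⟩)))
        ⟨y, val.mpr ⟨y.2, Finset.mem_filter.mpr ⟨hy, e⟩⟩⟩
      exact ⟨χ, fun _ => ⟨h1, h2, by rw [h2]; exact h3⟩⟩
    · exact ⟨top, fun h => absurd h hu⟩
  choose σ hσ using this
  have mσ : ∀ u : Fin k, ∀ x : Fin n, (x : ℕ) ∈ (σ u).vars ↔ x ∈ M ∧ p x = u := by
    intro u x
    rw [(hσ u u.2).2.1, val]
    simp
  have nσ : ∀ u : Fin k, ∀ x ∈ (σ u).vars, x < n := by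
    intro u x hx
    rw [(hσ u u.2).2.1, val] at hx
    exact hx.choose
  have mC : ∀ x : Fin n, (x : ℕ) ∈ C.vars ↔ x ∉ M ∨ x = m := by
    intro x
    rw [vC, val]; simp
  have nC : ∀ x ∈ C.vars, x < n := by
    intro x hx
    rw [vC, val] at hx; exact hx.choose
  have hc : IsCtx C m σ (Finset.range k) := by
    refine ⟨cC, (mC m).mpr (Or.inr rfl), fun z hz => (hσ z (Finset.mem_range.mp hz)).1,
      fun z hz w hw hzw => ?_, fun z hz => ?_⟩
    · rw [Finset.disjoint_left]
      intro y h1 h2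
      have hz' := Finset.mem_range.mp hz
      have hw' := Finset.mem_range.mp hw
      have hy := nσ ⟨z, hz'⟩ y h1
      have e1 := ((mσ ⟨z, hz'⟩ ⟨y, hy⟩).mp h1).2
      have e2 := ((mσ ⟨w, hw'⟩ ⟨y, hy⟩).mp h2).2
      exact hzw (Fin.mk.inj (e1.symm.trans e2))
    · rw [Finset.disjoint_left]
      intro y h1 h2
      have hz' := Finset.mem_range.mp hz
      have hy := nσ ⟨z, hz'⟩ y h1
      have e1 := ((mσ ⟨z, hz'⟩ ⟨y, hy⟩).mp h1).1
      rw [Finset.mem_erase] at h2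
      rcases (mC ⟨y, hy⟩).mp h2.2 with h | h
      · exact h e1
      · exact h2.1 (Fin.ext_iff.mp h)
  refine ⟨C, m, σ, by rw [hA.vars]; exact hc, ?_, ?_⟩
  · refine logEquiv_plug hA hφ hm m1 (fun x hx y hy e => ?_) hc mC nC (fun x y hx hy e => ?_) mσ nσ
      fun u x hx y hy e => (hσ u u.2).2.2 x hx y hy e
    · have := p2 x hx y hy
      rw [if_neg e] at this; exact this.1
    · exact eC x (vC ▸ hx) y (vC ▸ hy) fun h => e (Fin.ext h)
  · refine logEquiv_plug hB hψ hm m2 (fun x hx y hy e => ?_) hc mC nC (fun x y hx hy e => ?_) mσ nσ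
      fun u x hx y hy e => ?_
    · have := p2 x hx y hy
      rw [if_neg e] at this; exact this.2
    · rw [eC x (vC ▸ hx) y (vC ▸ hy) fun h => e (Fin.ext h), ← Web.adj_eq_iff]
      -- Two distinct nodes of the context are never both in `M`, since `m` is the only member of
      -- `M` kept there.
      refine m3 x y fun h => e ?_
      rw [((mC x).mp hx).resolve_left (not_not.mpr h.1),
        ((mC y).mp hy).resolve_left (not_not.mpr h.2)]
    · rw [(hσ u u.2).2.2 x hx y hy e]
      have hx1 := (mσ u ⟨x, nσ u x hx⟩).mp hx
      have hy1 := (mσ u ⟨y, nσ u y hy⟩).mp hy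
      have := p2 _ hx1.1 _ hy1.1
      rw [if_pos (hx1.2.trans hy1.2.symm)] at this
      exact Web.adj_eq_iff.mp this

end LinearInference

namespace LinearInference
open Formula

/-! ### Elimination of units -/

/-- `r` arises from `r₀` by renaming variables and changing their polarities. -/
def SignedVariant (r₀ r : Inference) : Prop :=
  ∃ (ρ : ℕ → ℕ) (s : ℕ → Bool), Set.InjOn ρ r₀.vars ∧ r₀.vars.image ρ = r.lhs.vars ∧
    LogEquiv r.lhs (r₀.lhs.subst fun z => if s z then var (ρ z) else nvar (ρ z)) ∧
    LogEquiv r.rhs (r₀.rhs.subst fun z => if s z then var (ρ z) else nvar (ρ z))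

theorem Formula.Clean.eq_var {φ : Formula} (h : φ.Clean) {x : ℕ} (hx : φ.vars = {x}) :
    φ = var x := by
  have hs : ∀ a b : Formula, Disjoint a.vars b.vars → a.vars.Nonempty → b.vars.Nonempty →
      a.vars ∪ b.vars ≠ {x} := by
    rintro a b hd ⟨u, hu⟩ ⟨v, hv⟩ h
    have h1 : u = x := by simpa [h] using Finset.mem_union_left b.vars hu
    have h2 : v = x := by simpa [h] using Finset.mem_union_right a.vars hv
    exact Finset.disjoint_left.mp hd hu (by rw [h1, ← h2]; exact hv)
  cases φ with
  | top => exact h.constFree.elim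
  | bot => exact h.constFree.elim
  | var y => simp only [Formula.vars, Finset.singleton_inj] at hx; rw [hx]
  | nvar y => exact h.negFree.elim
  | and a b =>
    exact absurd hx (hs a b h.linear.2.2 h.constFree.1.vars_nonempty h.constFree.2.vars_nonempty)
  | or a b =>
    exact absurd hx (hs a b h.linear.2.2 h.constFree.1.vars_nonempty h.constFree.2.vars_nonempty)

theorem eval_update_mono {C : Formula} (hC : C.Linear) {x : ℕ} (hx : x ∉ C.negv) {α : ℕ → Bool}
    {b c : Bool} (hbc : b = true → c = true) (h : C.eval (Function.update α x b) = true) :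
    C.eval (Function.update α x c) = true := by
  cases b
  · cases c
    · exact h
    · have := eval_update_le hC x true (by simpa using hx) h
      rwa [Function.update_idem] at this
  · rw [hbc rfl]; exact h

theorem Formula.Implies.plug {a b : Formula} (h : Implies a b) {C : Formula} (hC : C.Linear) {x : ℕ}
    (hx : x ∉ C.negv) (σ : ℕ → Formula) :
    Implies (C.subst1 x (a.subst σ)) (C.subst1 x (b.subst σ)) := fun α => by
  rw [eval_plug, eval_plug]; exact eval_update_mono hC hx (h _)

/-- An interpolant of the rule, plugged into the context, interpolates `r` and is therefore
equivalent to one of its sides; `IsCtx.implies_of_plug` carries this equivalence back to the rule.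
-/
theorem exists_good_of_clean_rule {r r₂ : Inference} (h : Good r) {C : Formula} {x : ℕ}
    {σ : ℕ → Formula} (hc : IsCtx C x σ r₂.lhs.vars) (h₂ : CleanInf r₂)
    (hi : Implies r₂.lhs r₂.rhs) (e1 : LogEquiv r.lhs (C.subst1 x (r₂.lhs.subst σ)))
    (e2 : LogEquiv r.rhs (C.subst1 x (r₂.rhs.subst σ))) (hn : NonTriv r₂.lhs r₂.rhs r₂.lhs.vars) :
    Good r₂ := by
  have hx : x ∉ C.negv := by rw [(negFree_iff C).mp hc.clean.negFree]; simp
  refine ⟨h₂.lhs, h₂.rhs, h₂.vars_eq, hi, hn, fun χ hχ i1 i2 => ?_, fun e => ?_⟩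
  · obtain ⟨c, v⟩ := hn.clean_nf_of_between subset_rfl h₂.vars_eq.ge
      h₂.lhs.constFree.vars_nonempty i1 i2 hχ
    have e := logEquiv_nf χ
    have i1' := i1.trans e.symm.implies
    have i2' := e.implies.trans i2
    have cp := hc.clean_plug c v.le
    rcases h.logMinimal _ cp.linear (e1.implies.trans (i1'.plug hc.clean.linear hx σ))
      ((i2'.plug hc.clean.linear hx σ).trans e2.symm.implies) with h' | h'
    · left
      exact e.symm.trans (Implies.antisymm (hc.implies_of_plug v.le subset_rfl
        (h'.trans e1).implies) i1')
    · right
      exact e.symm.trans (Implies.antisymm i2' (hc.implies_of_plug h₂.vars_eq.ge v.le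
        (h'.trans e2).symm.implies))
  · exact h.not_logEquiv ((e1.trans (e.plug C x σ)).trans e2.symm)

/-- One rewrite step by an arbitrary linear inference is, when both sides are equivalent to those
of a good inference, an instance without units of a good inference with at most as many
variables. -/
theorem Good.unit_elim {r r₀ : Inference} (h : Good r) (h₀ : r₀.IsLinear) {φ' ψ' : Formula}
    (hφ' : LogEquiv r.lhs φ') (hψ' : LogEquiv r.rhs ψ') (lφ : φ'.Linear) (lψ : ψ'.Linear)
    (hrw : Rewrite {r₀} φ' ψ') : ∃ r₂ : Inference, Good r₂ ∧ CtxInst r₂ r.lhs r.rhs ∧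
      r₂.lhs.vars ⊆ r₀.vars ∧
      (r₂.lhs.vars.card = r.lhs.vars.card → r₀.vars = r₂.lhs.vars → SignedVariant r₀ r) := by
  classical
  obtain ⟨r', hr', σ, hC⟩ := hrw.exists_context
  obtain rfl : r' = r₀ := hr'
  obtain ⟨x, hx⟩ := Infinite.exists_notMem_finset (φ'.vars ∪ ψ'.vars ∪ r.lhs.vars)
  rw [Finset.mem_union, not_or] at hx
  obtain ⟨C, lC, xC, nC, -, -, -, rfl, rfl⟩ := hC x hx.1 lφ
  have hxV := hx.2
  obtain ⟨la, da⟩ := (linear_subst1 lC xC).mp lφ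
  obtain ⟨lb, db⟩ := (linear_subst1 lC xC).mp lψ
  have oa := (linear_subst h₀.1).mp la
  have ob := (linear_subst h₀.2.1).mp lb
  -- the simplified context, rule and substitution
  set D := C.nf with hD
  have lD : D.Linear := lC.nf
  have nD : x ∉ D.negv := fun h => nC (negv_nf C h)
  -- Each substitute is divided in two. Its unit value or its sign goes into the rule by `τ`; the
  -- simplified substitute, negated if it contains negative literals, goes into `θ`. Together they
  -- have the effect of `σ` (see `eτ`).
  set τ : ℕ → Formula := fun z => if (σ z).nf = top then top else if (σ z).nf = bot then bot else
    if (σ z).nf.NegFree then var z else nvar z with hτ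
  set θ : ℕ → Formula := fun z => if (σ z).nf.NegFree then (σ z).nf else (σ z).nf.neg with hθ
  have vτ : ∀ z, ∀ w ∈ (τ z).vars, w = z ∧ (σ z).nf.ConstFree := by
    intro z w hw
    simp only [hτ] at hw
    split_ifs at hw with h1 h2 h3
    · simp [vars] at hw
    · simp [vars] at hw
    · exact ⟨by simpa [vars] using hw, ((nf_cases _).resolve_left h1).resolve_left h2⟩
    · exact ⟨by simpa [vars] using hw, ((nf_cases _).resolve_left h1).resolve_left h2⟩
  have eτ : ∀ z α, (τ z).eval (fun w => (θ w).eval α) = (σ z).eval α := by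
    intro z α
    rw [← eval_nf α (σ z)]
    simp only [hτ]
    split_ifs with h1 h2 h3
    · rw [h1]; rfl
    · rw [h2]; rfl
    · simp [eval, hθ, h3]
    · simp [eval, hθ, h3]
  have vθ : ∀ z, (θ z).vars ⊆ (σ z).vars := by
    intro z
    simp only [hθ]; split_ifs
    · exact vars_nf _
    · rw [vars_neg]; exact vars_nf _
  have lθ : ∀ z, (σ z).Linear → (θ z).Linear := by
    intro z hz
    simp only [hθ]; split_ifs
    · exact hz.nf
    · exact (linear_neg _).mpr hz.nf
  have cθ : ∀ z, (σ z).nf.ConstFree → (θ z).ConstFree := by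
    intro z hz
    simp only [hθ]; split_ifs
    · exact hz
    · exact (constFree_neg _).mpr hz
  have lτ : ∀ l : Formula, l.Linear → (l.subst τ).Linear := by
    intro l hl
    refine (linear_subst hl).mpr ⟨fun z _ => ?_, fun z _ w _ hzw => ?_⟩
    · simp only [hτ]; split_ifs <;> trivial
    · rw [Finset.disjoint_left]
      exact fun y h1 h2 => hzw ((vτ z y h1).1.symm.trans (vτ w y h2).1)
  have eq : ∀ l : Formula, LogEquiv ((l.subst τ).nf.subst θ) (l.subst σ) := by
    intro l α
    rw [eval_subst, eval_nf, eval_subst, eval_subst]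
    exact congrArg (fun β => l.eval β) (funext fun z => eτ z α)
  have mem : ∀ (l : Formula), ∀ z ∈ (l.subst τ).nf.vars, z ∈ l.vars ∧ (σ z).nf.ConstFree := by
    intro l z hz
    obtain ⟨w, hw, hzw⟩ := mem_vars_subst.mp (vars_nf _ hz)
    obtain ⟨rfl, h⟩ := vτ w z hzw
    exact ⟨hw, h⟩
  set l := (r'.lhs.subst τ).nf with hl
  set m := (r'.rhs.subst τ).nf with hm
  have ll : l.Linear := (lτ _ h₀.1).nf
  have lm : m.Linear := (lτ _ h₀.2.1).nf
  have il : Implies l m := by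
    intro α hα
    rw [hl, eval_nf, eval_subst] at hα
    rw [hm, eval_nf, eval_subst]; exact h₀.2.2 _ hα
  have eD : ∀ l' : Formula, LogEquiv (C.subst1 x (l'.subst σ))
      (D.subst1 x ((l'.subst τ).nf.subst θ)) := by
    intro l' α
    rw [eval_subst1, eval_subst1, eq l' α, hD, eval_nf]
  have e1 : LogEquiv r.lhs (D.subst1 x (l.subst θ)) := hφ'.trans (eD _)
  have e2 : LogEquiv r.rhs (D.subst1 x (m.subst θ)) := hψ'.trans (eD _)
  have hne : ¬ LogEquiv l m := fun e => h.not_logEquiv ((e1.trans (e.plug D x θ)).trans e2.symm)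
  -- If simplification deleted the hole, both sides would be equivalent to the same context.
  have xD : x ∈ D.vars := by
    by_contra hxD
    rw [subst1_of_notMem hxD] at e1 e2
    exact h.not_logEquiv (e1.trans e2.symm)
  have cD : D.ConstFree := by
    rcases nf_cases C with h | h | h
    · rw [hD, h] at xD; simp [vars] at xD
    · rw [hD, h] at xD; simp [vars] at xD
    · exact h
  have erD : D.vars.erase x ⊆ C.vars.erase x := Finset.erase_subset_erase _ (vars_nf C)
  have dθ : ∀ {l' : Formula}, Disjoint (l'.subst σ).vars (C.vars.erase x) →
      ∀ z ∈ (l'.subst τ).nf.vars, Disjoint (θ z).vars (D.vars.erase x) := by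
    intro l' hd z hz
    exact hd.mono (fun y hy => mem_vars_subst.mpr ⟨z, (mem l' z hz).1, vθ z hy⟩) erD
  have lin : ∀ {l' : Formula}, l'.Linear → LinOn σ l'.vars →
      LinOn θ (l'.subst τ).nf.vars := by
    intro l' hl' ho
    exact ⟨fun z hz => lθ z (ho.1 z (mem l' z hz).1), fun z hz w hw hzw =>
      (ho.2 z (mem l' z hz).1 w (mem l' w hw).1 hzw).mono (vθ z) (vθ w)⟩
  have linl : LinOn θ l.vars := lin h₀.1 oa
  have linm : LinOn θ m.vars := lin h₀.2.1 ob
  have dl := dθ da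
  have dm := dθ db
  have lplug : ∀ {χ : Formula}, χ.Linear → LinOn θ χ.vars →
      (∀ z ∈ χ.vars, Disjoint (θ z).vars (D.vars.erase x)) → (D.subst1 x (χ.subst θ)).Linear := by
    intro χ hχ ho hd
    refine (linear_subst1 lD xD).mpr ⟨(linear_subst hχ).mpr ho, ?_⟩
    rw [vars_subst, Finset.disjoint_biUnion_left]; exact hd
  have cplug : ∀ {χ : Formula}, χ.ConstFree → (∀ z ∈ χ.vars, (σ z).nf.ConstFree) →
      (D.subst1 x (χ.subst θ)).ConstFree := by
    intro χ hχ hz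
    refine (constFree_subst cD).mpr fun y _ => ?_
    by_cases e : y = x
    · subst e
      rw [Function.update_self, constFree_subst hχ]
      exact fun z h => cθ z (hz z h)
    · rw [Function.update_of_ne e]; trivial
  -- a variable outside the context witnesses that the rule is not trivial
  have hcan : ∀ y ∈ r.lhs.vars, y ∉ D.vars.erase x → ∃ γ₁ γ₀ : ℕ → Bool, l.eval γ₁ = true ∧
      m.eval γ₀ = false ∧ ∀ w, y ∉ (θ w).vars → γ₁ w = γ₀ w := by
    intro y hy hyD
    obtain ⟨α, h1, h2⟩ := h.nonTriv y hy
    have hyx : y ≠ x := fun e => hxV (e ▸ hy)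
    have hyD' : y ∉ D.vars := fun h => hyD (Finset.mem_erase.mpr ⟨hyx, h⟩)
    rw [e1, eval_plug] at h1
    rw [e2, eval_plug] at h2
    rw [Function.update_comm hyx, eval_update_of_notMem hyD'] at h1 h2
    refine ⟨fun w => (θ w).eval (Function.update α y true),
      fun w => (θ w).eval (Function.update α y false), ?_, ?_, fun w hw => ?_⟩
    -- With `l` false, monotonicity of `D` in its hole would make the right side true together with
    -- the left. The case of `m` is dual.
    · by_contra hc
      rw [Bool.not_eq_true] at hc
      rw [hc] at h1
      have := eval_update_mono lD nD (c := m.eval fun z => (θ z).eval (Function.update α y false))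
        (by simp) h1
      rw [h2] at this; cases this
    · by_contra hc
      rw [Bool.not_eq_false] at hc
      rw [hc] at h2
      have := eval_update_mono lD nD (c := true) (by simp) h1
      rw [h2] at this; cases this
    · simp only [eval_update_of_notMem hw]
  have iφψ : ∀ {a b : Formula}, LogEquiv r.lhs a → LogEquiv r.rhs b →
      Implies r.lhs a ∧ Implies a r.rhs ∧ Implies r.lhs b ∧ Implies b r.rhs := fun ha hb =>
    ⟨ha.implies, ha.symm.implies.trans h.implies, h.implies.trans hb.implies, hb.symm.implies⟩
  obtain ⟨i1, i2, i3, i4⟩ := iφψ e1 e2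
  have outer : ∀ {χ : Formula} {z y : ℕ}, z ∈ χ.vars → y ∈ (θ z).vars →
      (∀ z ∈ χ.vars, Disjoint (θ z).vars (D.vars.erase x)) →
      y ∈ (D.subst1 x (χ.subst θ)).vars ∧ y ∉ D.vars.erase x := fun hz hy hd =>
    ⟨(mem_vars_subst1 xD).mpr (Or.inr (mem_vars_subst.mpr ⟨_, hz, hy⟩)),
      Finset.disjoint_left.mp (hd _ hz) hy⟩
  have cl : m.ConstFree → (D.subst1 x (m.subst θ)).Clean ∧
      (D.subst1 x (m.subst θ)).vars = r.lhs.vars := fun hc =>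
    h.clean_of_between i3 i4 (lplug lm linm dm) (cplug hc fun z hz => (mem _ z hz).2)
  have cl' : l.ConstFree → (D.subst1 x (l.subst θ)).Clean ∧
      (D.subst1 x (l.subst θ)).vars = r.lhs.vars := fun hc =>
    h.clean_of_between i1 i2 (lplug ll linl dl) (cplug hc fun z hz => (mem _ z hz).2)
  -- If `l` is never true, it contradicts `hcan` for a variable in some substitute of `m`; if it is
  -- always true, validity makes `m` a tautology, which no constant-free linear formula is.
  have constm : ∀ b : Bool, m.ConstFree → (∀ α, l.eval α = b) → False := by
    intro b hc hb
    cases b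
    · obtain ⟨z, hz⟩ := hc.vars_nonempty
      obtain ⟨y, hy⟩ := (cθ z (mem _ z hz).2).vars_nonempty
      obtain ⟨hyv, hyD⟩ := outer hz hy dm
      obtain ⟨γ₁, γ₀, g1, -⟩ := hcan y ((cl hc).2 ▸ hyv) hyD
      rw [hb] at g1; cases g1
    · obtain ⟨α, hα⟩ := exists_eval_eq lm hc false
      have := il α (hb α); rw [hα] at this; cases this
  have hcl : l.ConstFree := by
    rcases nf_cases (r'.lhs.subst τ) with hc | hc | hc
    · exfalso
      exact hne (il.antisymm fun α _ => by rw [hl, hc]; rfl)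
    · exfalso
      rcases nf_cases (r'.rhs.subst τ) with hc' | hc' | hc'
      -- When the rule has become ⊥ → ⊤, the context `D`, with its hole kept as a variable, lies
      -- between the two sides of `r`. An interpolant has only the variables of `r`, but `x` was
      -- chosen fresh.
      · have c := (h.clean_of_between (χ := D) (fun α hα => ?_) (fun α hα => ?_) lD cD).2
        · exact hxV (c ▸ xD)
        · have := e1 α
          rw [hα, eval_plug, hl, hc] at this
          have := eval_update_mono lD nD (c := α x) (by simp [eval]) this.symm
          rwa [Function.update_eq_self] at this
        · rw [e2, eval_plug, hm, hc']
          rw [← Function.update_eq_self x α] at hα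
          exact eval_update_mono lD nD (by simp [eval]) hα
      · exact hne (by rw [hl, hm, hc, hc']; exact .refl _)
      · exact constm false hc' fun α => by rw [hl, hc]; rfl
    · exact hc
  have hcm : m.ConstFree := by
    rcases nf_cases (r'.rhs.subst τ) with hc | hc | hc
    · exfalso
      obtain ⟨z, hz⟩ := hcl.vars_nonempty
      obtain ⟨y, hy⟩ := (cθ z (mem _ z hz).2).vars_nonempty
      obtain ⟨hyv, hyD⟩ := outer hz hy dl
      obtain ⟨γ₁, γ₀, -, g1, -⟩ := hcan y ((cl' hcl).2 ▸ hyv) hyD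
      rw [hm, hc] at g1; cases g1
    · exfalso
      obtain ⟨α, hα⟩ := exists_eval_eq ll hcl true
      have := il α hα
      rw [hm, hc] at this; cases this
    · exact hc
  obtain ⟨cφ, vφ⟩ := cl' hcl
  obtain ⟨cψ, vψ⟩ := cl hcm
  have nfD : D.NegFree := by
    rw [negFree_iff, Finset.eq_empty_iff_forall_notMem]
    intro z hz
    have := ((negFree_subst _ D).mp cφ.negFree).2 z hz
    have hzx : z ≠ x := fun e => nD (e ▸ hz)
    rw [Function.update_of_ne hzx] at this
    exact this
  have inner : ∀ {χ : Formula}, (∀ z ∈ χ.vars, (σ z).nf.ConstFree) →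
      (D.subst1 x (χ.subst θ)).Clean → χ.NegFree ∧ ∀ z ∈ χ.vars, (θ z).NegFree := by
    intro χ hz hc
    have := ((negFree_subst _ D).mp hc.negFree).1 x (nfD.mem_posv xD)
    rw [Function.update_self, negFree_subst] at this
    have hn : χ.NegFree := by
      rw [negFree_iff, Finset.eq_empty_iff_forall_notMem]
      intro z hzn
      have hzc := hz z (negv_subset χ hzn)
      have hn := this.2 z hzn
      simp only [hθ] at hn
      split_ifs at hn with hneg
      · exact hzc.not_negFree_neg hneg hn
      · rw [Formula.neg_neg] at hn; exact hneg hn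
    exact ⟨hn, fun z hz => this.1 z (hn.mem_posv hz)⟩
  obtain ⟨nl, θl⟩ := inner (χ := l) (fun z hz => (mem _ z hz).2) cφ
  obtain ⟨nm, θm⟩ := inner (χ := m) (fun z hz => (mem _ z hz).2) cψ
  -- the two sides of the rule have the same variables
  have key : ∀ y ∈ r.lhs.vars, y ∉ D.vars.erase x → ∃ w, w ∈ l.vars ∧ w ∈ m.vars ∧
      y ∈ (θ w).vars := by
    intro y hy hyD
    by_contra hcon
    push Not at hcon
    obtain ⟨γ₁, γ₀, g1, g2, g3⟩ := hcan y hy hyD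
    -- This assignment satisfies `l`. If no variable common to both sides has `y` in its substitute,
    -- it coincides on `m.vars` with `γ₀`, which falsifies `m`.
    have : m.eval (fun w => if w ∈ l.vars then γ₁ w else γ₀ w) = true :=
      il _ (by rw [← g1]; exact eval_congr fun w hw => by simp [hw])
    rw [eval_congr (β := γ₀) fun w hw => ?_, g2] at this
    · cases this
    · split_ifs with hwl
      · exact g3 w (hcon w hwl hw)
      · rfl
  have hv : l.vars = m.vars := by
    apply Finset.Subset.antisymm
    · intro z hz
      obtain ⟨y, hy⟩ := (cθ z (mem _ z hz).2).vars_nonempty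
      obtain ⟨hyv, hyD⟩ := outer hz hy dl
      obtain ⟨w, hwl, hwm, hyw⟩ := key y (vφ ▸ hyv) hyD
      by_contra hzm
      exact Finset.disjoint_left.mp (linl.2 z hz w hwl fun e => hzm (e ▸ hwm)) hy hyw
    · intro z hz
      obtain ⟨y, hy⟩ := (cθ z (mem _ z hz).2).vars_nonempty
      obtain ⟨hyv, hyD⟩ := outer hz hy dm
      obtain ⟨w, hwl, hwm, hyw⟩ := key y (vψ ▸ hyv) hyD
      by_contra hzl
      exact Finset.disjoint_left.mp (linm.2 z hz w hwm fun e => hzl (e ▸ hwl)) hy hyw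
  have cθl : ∀ z ∈ l.vars, (θ z).Clean := fun z hz =>
    ⟨linl.1 z hz, cθ z (mem _ z hz).2, θl z hz⟩
  have hctx : IsCtx D x θ l.vars := ⟨⟨lD, cD, nfD⟩, xD, cθl, linl.2, dl⟩
  have hnt : NonTriv l m l.vars := by
    intro z hz
    obtain ⟨y, hy⟩ := (cθl z hz).constFree.vars_nonempty
    obtain ⟨hyv, hyD⟩ := outer hz hy dl
    obtain ⟨γ₁, γ₀, g1, g2, g3⟩ := hcan y (vφ ▸ hyv) hyD
    -- As `y` lies in the substitute of `z` and of no other variable of the rule, `γ₁` and `γ₀`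
    -- differ on these variables at most at `z`.
    refine ⟨γ₁, nl.mono (fun w _ hw => ?_) g1, ?_⟩
    · by_cases e : w = z
      · subst e; simp
      · rwa [Function.update_of_ne e]
    · by_contra hc
      rw [Bool.not_eq_false] at hc
      have := nm.mono (β := γ₀) (fun w hw hw' => ?_) hc
      · rw [g2] at this; cases this
      · have e : w ≠ z := by rintro rfl; simp at hw'
        rw [Function.update_of_ne e] at hw'
        rw [← g3 w fun hyw => ?_]
        · exact hw'
        · exact Finset.disjoint_left.mp (linl.2 w (hv ▸ hw) z hz e) hyw hy
  have hcl2 : CleanInf ⟨l, m⟩ := ⟨⟨ll, hcl, nl⟩, ⟨lm, hcm, nm⟩, hv⟩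
  refine ⟨⟨l, m⟩, exists_good_of_clean_rule h (r₂ := ⟨l, m⟩) hctx hcl2 il e1 e2 hnt,
    ⟨D, x, θ, hctx, e1, e2⟩, fun z hz => Finset.mem_union_left _ (mem _ z hz).1, ?_⟩
  intro hcard hW
  change l.vars.card = _ at hcard
  change r'.vars = l.vars at hW
  -- A count: `r.lhs.vars` is the disjoint union of the variables of the context and of the
  -- non-empty substitutes, one for each variable of the rule. Equal cardinality leaves a bare hole
  -- as context and single variables as substitutes.
  have hV : r.lhs.vars = D.vars.erase x ∪ l.vars.biUnion fun z => (θ z).vars := by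
    ext y
    rw [← vφ, hctx.mem_vars_plug rfl, Finset.mem_union, Finset.mem_biUnion]
  have hdis : Disjoint (D.vars.erase x) (l.vars.biUnion fun z => (θ z).vars) := by
    rw [Finset.disjoint_biUnion_right]; exact fun z hz => (dl z hz).symm
  have hcb := Finset.card_biUnion (s := l.vars) (t := fun z => (θ z).vars)
    (fun z hz w hw => linl.2 z hz w hw)
  have hone : ∀ z ∈ l.vars, 1 ≤ (θ z).vars.card := fun z hz =>
    Finset.card_pos.mpr (cθl z hz).constFree.vars_nonempty
  have hle := Finset.sum_le_sum hone
  rw [Finset.sum_const, smul_eq_mul, mul_one] at hle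
  have hVc := congrArg Finset.card hV
  rw [Finset.card_union_of_disjoint hdis, hcb] at hVc
  have hDe : D.vars.erase x = ∅ := Finset.card_eq_zero.mp (by omega)
  have hsum : ∑ z ∈ l.vars, 1 = ∑ z ∈ l.vars, (θ z).vars.card := by
    rw [Finset.sum_const, smul_eq_mul, mul_one]; omega
  have hsing := (Finset.sum_eq_sum_iff_of_le hone).mp hsum
  have : ∀ z, ∃ y, z ∈ l.vars → (θ z).vars = {y} := by
    intro z
    by_cases hz : z ∈ l.vars
    · obtain ⟨y, hy⟩ := Finset.card_eq_one.mp (hsing z hz).symm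
      exact ⟨y, fun _ => hy⟩
    · exact ⟨0, fun h => absurd h hz⟩
  choose ρ hρ using this
  have θρ : ∀ z ∈ l.vars, θ z = var (ρ z) := fun z hz => (cθl z hz).eq_var (hρ z hz)
  have Dx : D = var x := by
    refine Clean.eq_var ⟨lD, cD, nfD⟩ ?_
    rw [← Finset.insert_erase xD, hDe, insert_empty_eq]
  have lit : ∀ l' : Formula, l'.vars ⊆ l.vars → l'.Linear →
      LogEquiv (D.subst1 x ((l'.subst τ).nf.subst θ))
        (l'.subst fun z => if decide ((σ z).nf.NegFree) then var (ρ z) else nvar (ρ z)) := by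
    intro l' hl' _ α
    rw [Dx, subst1_var_self, eval_subst, eval_nf, ← eval_subst, Formula.subst_subst]
    congr 1
    refine subst_congr fun z hz => ?_
    have hz' := hl' hz
    have hzc := (mem _ z hz').2
    have h1 : (σ z).nf ≠ top := fun e => by rw [e] at hzc; exact hzc
    have h2 : (σ z).nf ≠ bot := fun e => by rw [e] at hzc; exact hzc
    by_cases h3 : (σ z).nf.NegFree
    · simp only [hτ, h1, h2, h3, if_true, if_false, decide_true, Formula.subst]
      exact θρ z hz'
    · simp only [hτ, h1, h2, h3, if_false, decide_false, Formula.subst]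
      rw [θρ z hz']; rfl
  refine ⟨ρ, fun z => decide ((σ z).nf.NegFree), ?_, ?_, ?_, ?_⟩
  · intro z hz w hw hzw
    rw [hW] at hz hw
    by_contra hne
    have := linl.2 z hz w hw hne
    rw [hρ z hz, hρ w hw, hzw] at this
    simp at this
  · rw [hW, hV, hDe, Finset.empty_union]
    ext y
    simp only [Finset.mem_image, Finset.mem_biUnion]
    refine exists_congr fun z => and_congr_right fun hz => ?_
    rw [hρ z hz, Finset.mem_singleton, eq_comm]
  · exact e1.trans (lit _ (hW ▸ Finset.subset_union_left) h₀.1)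
  · exact e2.trans (lit _ (hW ▸ Finset.subset_union_right) h₀.2.1)

end LinearInference

namespace LinearInference
open Formula

/-! ### Renaming of variables -/

/-- The complements of `V` and of its image are both countably infinite, so any bijection between
them completes `ρ`. -/
theorem exists_perm_eq_on {V : Finset ℕ} {ρ : ℕ → ℕ} (h : Set.InjOn ρ V) :
    ∃ π : Equiv.Perm ℕ, ∀ x ∈ V, π x = ρ x := by
  classical
  let W := V.image ρ
  have inf : ∀ U : Finset ℕ, Infinite {x // ¬ x ∈ U} := fun U =>
    (U.finite_toSet.infinite_compl).to_subtype
  have := inf V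
  have := inf W
  obtain ⟨e'⟩ : Nonempty ({x // ¬ x ∈ V} ≃ {x // ¬ x ∈ W}) := nonempty_equiv_of_countable
  let e : {x // x ∈ V} ≃ {x // x ∈ W} := Equiv.ofBijective
    (fun x => ⟨ρ x, Finset.mem_image_of_mem _ x.2⟩) ⟨fun x y hxy => Subtype.ext
      (h x.2 y.2 (congrArg Subtype.val hxy)), fun ⟨y, hy⟩ => by
        obtain ⟨x, hx, rfl⟩ := Finset.mem_image.mp hy
        exact ⟨⟨x, hx⟩, rfl⟩⟩
  refine ⟨e.subtypeCongr e', fun x hx => ?_⟩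
  simp only [Equiv.subtypeCongr, Equiv.trans_apply, Equiv.sumCompl_symm_apply_of_pos hx]
  rfl

theorem eval_rename (ρ : ℕ → ℕ) (φ : Formula) (α : ℕ → Bool) :
    (φ.rename ρ).eval α = φ.eval (α ∘ ρ) := by
  rw [rename, eval_subst]; rfl

theorem vars_rename (ρ : ℕ → ℕ) (φ : Formula) : (φ.rename ρ).vars = φ.vars.image ρ := by
  ext x
  rw [rename, mem_vars_subst, Finset.mem_image]
  simp [vars, eq_comm]

theorem Formula.Clean.rename {φ : Formula} (h : φ.Clean) {ρ : ℕ → ℕ} (hρ : Set.InjOn ρ φ.vars) :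
    (φ.rename ρ).Clean :=
  h.subst (fun _ _ => ⟨trivial, trivial, trivial⟩) fun z hz w hw hzw => by
    simpa [vars] using fun e => hzw (hρ hz hw e)

theorem rename_rename (ρ τ : ℕ → ℕ) (φ : Formula) :
    (φ.rename ρ).rename τ = φ.rename (τ ∘ ρ) := by
  rw [rename, rename, subst_subst]; rfl

theorem rename_id (φ : Formula) : φ.rename id = φ := subst_var φ

theorem Formula.LogEquiv.rename {φ ψ : Formula} (h : LogEquiv φ ψ) (ρ : ℕ → ℕ) :
    LogEquiv (φ.rename ρ) (ψ.rename ρ) := fun α => by rw [eval_rename, eval_rename, h]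

theorem Formula.Implies.rename {φ ψ : Formula} (h : Implies φ ψ) (ρ : ℕ → ℕ) :
    Implies (φ.rename ρ) (ψ.rename ρ) := fun α => by rw [eval_rename, eval_rename]; exact h _

theorem rename_perm_symm (ρ : Equiv.Perm ℕ) (φ : Formula) : (φ.rename ρ).rename ρ.symm = φ := by
  rw [rename_rename, Equiv.symm_comp_self, rename_id]

theorem rename_symm_perm (ρ : Equiv.Perm ℕ) (φ : Formula) : (φ.rename ρ.symm).rename ρ = φ := by
  rw [rename_rename, Equiv.self_comp_symm, rename_id]

namespace Inference

/-- Equality up to renaming of variables and logical equivalence. -/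
def Iso (r r' : Inference) : Prop :=
  ∃ ρ : Equiv.Perm ℕ, LogEquiv (r.lhs.rename ρ) r'.lhs ∧ LogEquiv (r.rhs.rename ρ) r'.rhs

/-- Renaming of variables. -/
def rename (r : Inference) (ρ : ℕ → ℕ) : Inference := ⟨r.lhs.rename ρ, r.rhs.rename ρ⟩

theorem iso_rename (r : Inference) (ρ : Equiv.Perm ℕ) : r.Iso (r.rename ρ) :=
  ⟨ρ, fun _ => rfl, fun _ => rfl⟩

theorem Iso.symm {r r' : Inference} (h : r.Iso r') : r'.Iso r := by
  obtain ⟨ρ, h1, h2⟩ := h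
  refine ⟨ρ.symm, ?_, ?_⟩
  · simpa only [rename_perm_symm] using h1.symm.rename ρ.symm
  · simpa only [rename_perm_symm] using h2.symm.rename ρ.symm

theorem Iso.trans {r r' r'' : Inference} (h : r.Iso r') (h' : r'.Iso r'') : r.Iso r'' := by
  obtain ⟨ρ, h1, h2⟩ := h
  obtain ⟨τ, h3, h4⟩ := h'
  refine ⟨ρ.trans τ, ?_, ?_⟩
  · have := (h1.rename τ).trans h3
    rwa [rename_rename] at this
  · have := (h2.rename τ).trans h4
    rwa [rename_rename] at this

theorem Variant.iso {r r' : Inference} (h : r.Variant r') : r.Iso r' := by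
  obtain ⟨ρ, h1, h2⟩ := h
  exact ⟨ρ, h1.logEquiv, h2.logEquiv⟩

end Inference

theorem CleanInf.rename {r : Inference} (h : CleanInf r) (ρ : Equiv.Perm ℕ) :
    CleanInf (r.rename ρ) :=
  ⟨h.lhs.rename ρ.injective.injOn, h.rhs.rename ρ.injective.injOn, by
    simp only [Inference.rename, vars_rename, h.vars_eq]⟩

theorem CleanInf.variant_iff {r r' : Inference} (h : CleanInf r) (h' : CleanInf r') :
    r.Variant r' ↔ r.Iso r' := by
  refine ⟨fun h => h.iso, fun ⟨ρ, h1, h2⟩ => ⟨ρ, ?_, ?_⟩⟩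
  · exact h1.ac (h.rename ρ).lhs h'.lhs
  · exact h2.ac (h.rename ρ).rhs h'.rhs

theorem clean_of_rename {φ : Formula} {ρ : ℕ → ℕ} (h : (φ.rename ρ).Clean) (hl : φ.Linear) :
    φ.Clean := by
  refine ⟨hl, ?_, ?_⟩
  · have := h.constFree
    clear h hl
    induction φ with
    | and a b iha ihb => exact ⟨iha this.1, ihb this.2⟩
    | or a b iha ihb => exact ⟨iha this.1, ihb this.2⟩
    | _ => exact this
  · have := h.negFree
    clear h hl
    induction φ with
    | and a b iha ihb => exact ⟨iha this.1, ihb this.2⟩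
    | or a b iha ihb => exact ⟨iha this.1, ihb this.2⟩
    | _ => exact this

theorem Inference.Variant.cleanInf {r r' : Inference} (h : r.Variant r') (h' : CleanInf r') :
    CleanInf r := by
  obtain ⟨ρ, h1, h2⟩ := h
  have c1 := h1.clean_iff.mpr h'.lhs
  have c2 := h2.clean_iff.mpr h'.rhs
  have lin : ∀ φ : Formula, (φ.rename ρ).Linear → φ.Linear := by
    intro φ hφ
    induction φ with
    | and a b iha ihb =>
      refine ⟨iha hφ.1, ihb hφ.2.1, ?_⟩
      have := hφ.2.2
      rw [← Formula.rename, ← Formula.rename, vars_rename, vars_rename, Finset.disjoint_image ρ.injective] at this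
      exact this
    | or a b iha ihb =>
      refine ⟨iha hφ.1, ihb hφ.2.1, ?_⟩
      have := hφ.2.2
      rw [← Formula.rename, ← Formula.rename, vars_rename, vars_rename, Finset.disjoint_image ρ.injective] at this
      exact this
    | _ => trivial
  refine ⟨clean_of_rename c1 (lin _ c1.linear), clean_of_rename c2 (lin _ c2.linear), ?_⟩
  have := h'.vars_eq
  rw [← h1.vars_eq, ← h2.vars_eq, vars_rename, vars_rename] at this
  exact Finset.image_injective ρ.injective this

theorem Inference.Iso.card {r r' : Inference} (h : r.Iso r') (hr : CleanInf r)
    (hr' : CleanInf r') : r.lhs.vars.card = r'.lhs.vars.card := by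
  obtain ⟨ρ, h1, -⟩ := h
  rw [← h1.vars_eq (hr.rename ρ).lhs hr'.lhs, Inference.rename, vars_rename, Finset.card_image_of_injective _ ρ.injective]

/-- A renaming is a substitution of variables in the context that consists of the hole alone. -/
theorem Inference.Iso.ctxInst {r r' : Inference} (h : r.Iso r') :
    CtxInst r r'.lhs r'.rhs := by
  obtain ⟨ρ, h1, h2⟩ := h
  refine ⟨var 0, 0, fun z => var (ρ z), ⟨⟨trivial, trivial, trivial⟩, by simp [Formula.vars],
    fun _ _ => ⟨trivial, trivial, trivial⟩, fun z _ w _ hzw => ?_,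
    fun z _ => by simp [Formula.vars]⟩, ?_, ?_⟩
  · simpa [Formula.vars] using hzw
  · rw [subst1_var_self]; exact h1.symm
  · rw [subst1_var_self]; exact h2.symm

theorem Good.rename {r : Inference} (h : Good r) (ρ : Equiv.Perm ℕ) : Good (r.rename ρ) := by
  have hc := h.cleanInf.rename ρ
  refine ⟨hc.lhs, hc.rhs, hc.vars_eq, h.implies.rename ρ, ?_, fun χ hχ i1 i2 => ?_, fun e => ?_⟩
  · intro x hx
    simp only [Inference.rename, vars_rename, Finset.mem_image] at hx
    obtain ⟨z, hz, rfl⟩ := hx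
    obtain ⟨α, h1, h2⟩ := h.nonTriv z hz
    have key : ∀ b, (Function.update (α ∘ ρ.symm) (ρ z) b) ∘ ρ = Function.update α z b := by
      intro b
      rw [Function.update_comp_eq_of_injective _ ρ.injective, Function.comp_assoc,
        Equiv.symm_comp_self, Function.comp_id]
    refine ⟨α ∘ ρ.symm, ?_, ?_⟩
    · simp only [Inference.rename, eval_rename, key]; exact h1
    · simp only [Inference.rename, eval_rename, key]; exact h2
  · have l : (χ.rename ρ.symm).Linear := (linear_subst hχ).mpr
      ⟨fun _ _ => trivial, fun z _ w _ hzw => by simpa [vars] using hzw⟩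
    have i1' := i1.rename ρ.symm
    have i2' := i2.rename ρ.symm
    simp only [Inference.rename, rename_perm_symm] at i1' i2'
    rcases h.logMinimal _ l i1' i2' with h' | h'
    · left; simpa only [Inference.rename, rename_symm_perm] using h'.rename ρ
    · right; simpa only [Inference.rename, rename_symm_perm] using h'.rename ρ
  · have := e.rename ρ.symm
    simp only [Inference.rename, rename_perm_symm] at this
    exact h.not_logEquiv this

theorem edge_rename (ρ : ℕ → ℕ) {φ : Formula} (h : φ.NegFree) (x y : ℕ) :
    (φ.rename ρ).Edge x y ↔ ∃ u v, φ.Edge u v ∧ x = ρ u ∧ y = ρ v := by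
  rw [rename, edge_subst _ h]
  simp [Edge, vars]

/-! ### Least webs -/

namespace Web

variable {n : ℕ}

theorem map_map (R : Web n) (π τ : Equiv.Perm (Fin n)) : (R.map π).map τ = R.map (π.trans τ) := rfl

theorem map_map_symm (R : Web n) (π : Equiv.Perm (Fin n)) : (R.map π).map π.symm = R := by
  rw [map_map, Equiv.self_trans_symm]; rfl

/-- The sums are triangular numbers, and the positions with second coordinate `y` form the block
between two consecutive ones. -/
theorem sum_range_injective {x y x' y' : ℕ} (hx : x < y) (hx' : x' < y')
    (h : x + ∑ i ∈ Finset.range y, i = x' + ∑ i ∈ Finset.range y', i) : x = x' ∧ y = y' := by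
  have key : ∀ {x y x' y' : ℕ}, x < y → y < y' →
      x + ∑ i ∈ Finset.range y, i < x' + ∑ i ∈ Finset.range y', i := by
    intro x y x' y' hx hy
    have := Finset.sum_le_sum_of_subset (f := fun i => i) (Finset.range_subset_range.mpr hy)
    rw [Nat.succ_eq_add_one, Finset.sum_range_succ] at this
    omega
  rcases lt_trichotomy y y' with hy | rfl | hy
  · exact absurd h (key hx hy).ne
  · exact ⟨by omega, rfl⟩
  · exact absurd h (key hx' hy).ne'

/-- Different pairs of nodes own different bits, so the binary expansion returns the set of edges.
Without this, "least" would not single out one graph in an isomorphism class. -/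
theorem num_injective : Function.Injective (num : Web n → ℕ) := by
  let e : Fin n × Fin n → ℕ := fun p => p.1.val + ∑ i ∈ Finset.range p.2.val, i
  let F : Web n → Finset (Fin n × Fin n) := fun R =>
    Finset.univ.filter fun p => p.1 < p.2 ∧ R.adj p.1 p.2 = true
  have hnum : ∀ R : Web n, R.num = ∑ i ∈ (F R).image e, 2 ^ i := by
    intro R
    rw [Finset.sum_image, Finset.sum_filter, Fintype.sum_prod_type, Finset.sum_comm]
    · rfl
    · intro p hp q hq hpq
      simp only [F, Finset.coe_filter, Finset.mem_univ, true_and, Set.mem_ofPred_eq] at hp hq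
      have := sum_range_injective hp.1 hq.1 hpq
      exact Prod.ext (Fin.ext this.1) (Fin.ext this.2)
  intro R S h
  rw [hnum, hnum] at h
  have him := Finset.geomSum_injective le_rfl h
  have key : ∀ {R S : Web n}, (F R).image e = (F S).image e → ∀ x y, x < y → R.adj x y = true →
      S.adj x y = true := by
    intro R S h x y hxy hR
    have : e (x, y) ∈ (F R).image e :=
      Finset.mem_image_of_mem _ (by simpa [F] using ⟨hxy, hR⟩)
    rw [h, Finset.mem_image] at this
    obtain ⟨q, hq, he⟩ := this
    simp only [F, Finset.mem_filter, Finset.mem_univ, true_and] at hq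
    have := sum_range_injective hq.1 hxy he
    rw [← Fin.ext this.1, ← Fin.ext this.2]; exact hq.2
  have key' : ∀ x y, x < y → R.adj x y = S.adj x y := fun x y hxy =>
    Bool.eq_iff_iff.mpr ⟨key him x y hxy, key him.symm x y hxy⟩
  apply Web.ext
  intro x y
  rcases lt_trichotomy x y with hxy | rfl | hxy
  · exact key' x y hxy
  · rw [R.irrefl, S.irrefl]
  · rw [R.symm, S.symm]; exact key' y x hxy

/-- Minimise the number of `R` over all permutations, then that of `S` over those permutations that
attain the same least copy of `R`. -/
theorem exists_isLeastPair (R S : Web n) :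
    ∃ π : Equiv.Perm (Fin n), IsLeastPair (R.map π) (S.map π) := by
  obtain ⟨π₁, h1⟩ := Finite.exists_min fun π : Equiv.Perm (Fin n) => (R.map π).num
  have : Nonempty {π : Equiv.Perm (Fin n) // R.map π = R.map π₁} := ⟨⟨π₁, rfl⟩⟩
  obtain ⟨⟨π, hπ⟩, h2⟩ := Finite.exists_min
    fun π : {π : Equiv.Perm (Fin n) // R.map π = R.map π₁} => (S.map π).num
  refine ⟨π, fun τ => ?_, fun τ hτ => ?_⟩
  · rw [hπ]
    exact (h1 (π.trans τ)).trans_eq (by rw [← map_map, hπ])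
  · exact h2 ⟨π.trans τ, by rw [← map_map, hτ, hπ]⟩

/-- Each of the two pairs bounds the numbers of the other, by way of `π` and its inverse, so the
numbers agree and `num_injective` applies. -/
theorem IsLeastPair.map_eq {R S : Web n} {π : Equiv.Perm (Fin n)} (h : IsLeastPair R S)
    (h' : IsLeastPair (R.map π) (S.map π)) : R.map π = R ∧ S.map π = S := by
  have h1 : R.map π = R := by
    refine num_injective (le_antisymm ?_ (h.1 π))
    have := h'.1 π.symm
    rwa [map_map_symm] at this
  refine ⟨h1, num_injective (le_antisymm ?_ (h.2 π h1))⟩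
  have := h'.2 π.symm (by rw [map_map_symm, h1])
  rwa [map_map_symm] at this

end Web

theorem IsDecomposition.rename {n : ℕ} {φ : Formula} {R : Web n} (h : IsDecomposition φ R)
    (ρ : Equiv.Perm ℕ) (π : Equiv.Perm (Fin n)) (hπ : ∀ x : Fin n, ρ x = π x) :
    IsDecomposition (φ.rename ρ) (R.map π) := by
  refine .of_clean (h.clean.rename ρ.injective.injOn) ?_ fun x hx y hy => ?_
  · rw [vars_rename, h.vars]
    refine Finset.eq_of_subset_of_card_le (fun y hy => ?_)
      (by rw [Finset.card_image_of_injective _ ρ.injective])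
    obtain ⟨x, hx, rfl⟩ := Finset.mem_image.mp hy
    have hx := Finset.mem_range.mp hx
    rw [hπ ⟨x, hx⟩, Finset.mem_range]
    exact (π _).2
  · have hs : ∀ x : Fin n, ρ (π.symm x) = x := fun x => by rw [hπ, Equiv.apply_symm_apply]
    rw [edge_rename _ h.clean.negFree, Web.E_val _ ⟨x, hx⟩ ⟨y, hy⟩]
    change _ ↔ R.adj (π.symm ⟨x, hx⟩) (π.symm ⟨y, hy⟩) = true
    rw [← R.E_val, ← h.edge]
    constructor
    · rintro ⟨u, v, he, hu, hv⟩
      have h1 := hs ⟨x, hx⟩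
      have h2 := hs ⟨y, hy⟩
      rw [ρ.injective (h1.trans hu), ρ.injective (h2.trans hv)]
      exact he
    · exact fun he => ⟨_, _, he, (hs ⟨x, hx⟩).symm, (hs ⟨y, hy⟩).symm⟩

theorem exists_perm_nat {n : ℕ} (π : Equiv.Perm (Fin n)) :
    ∃ ρ : Equiv.Perm ℕ, ∀ x : Fin n, ρ x = π x := by
  classical
  exact ⟨π.extendDomain Fin.equivSubtype, fun x =>
    π.extendDomain_apply_image Fin.equivSubtype x⟩

theorem exists_perm_fin {n : ℕ} (ρ : Equiv.Perm ℕ)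
    (h : (Finset.range n).image ρ = Finset.range n) :
    ∃ π : Equiv.Perm (Fin n), ∀ x : Fin n, ρ x = π x := by
  have hρ : ∀ x : Fin n, ρ x < n := fun x => by
    rw [← Finset.mem_range, ← h]
    exact Finset.mem_image_of_mem _ (Finset.mem_range.mpr x.2)
  have hinj : Function.Injective fun x : Fin n => (⟨ρ x, hρ x⟩ : Fin n) := fun x y hxy =>
    Fin.ext (ρ.injective (Fin.mk.inj_iff.mp hxy))
  exact ⟨Equiv.ofBijective _ (Finite.injective_iff_bijective.mp hinj), fun _ => rfl⟩

theorem IsDecompositionOf.cleanInf {r : Inference} {w : GraphInference}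
    (h : IsDecompositionOf r w) : CleanInf r :=
  ⟨h.1.clean, h.2.clean, h.1.vars.trans h.2.vars.symm⟩

theorem IsDecompositionOf.iso {r r' : Inference} {w : GraphInference} (h : IsDecompositionOf r w)
    (h' : IsDecompositionOf r' w) : r.Iso r' :=
  ⟨1, by simpa [rename_id] using (h.1.logEquiv_iff h'.1).mpr rfl,
    by simpa [rename_id] using (h.2.logEquiv_iff h'.2).mpr rfl⟩

/-- Isomorphic decompositions of least pairs belong to the same pair. -/
theorem eq_of_iso {r r' : Inference} {w w' : GraphInference} (h : IsDecompositionOf r w)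
    (h' : IsDecompositionOf r' w') (hw : Web.IsLeastPair w.2.1 w.2.2)
    (hw' : Web.IsLeastPair w'.2.1 w'.2.2) (hi : r.Iso r') : w = w' := by
  have hc := hi.card h.cleanInf h'.cleanInf
  rw [h.1.vars, h'.1.vars, Finset.card_range, Finset.card_range] at hc
  obtain ⟨n, R, S⟩ := w
  obtain ⟨n', R', S'⟩ := w'
  obtain rfl : n = n' := hc
  obtain ⟨ρ, h1, h2⟩ := hi
  have hv := h1.vars_eq (h.cleanInf.rename ρ).lhs h'.1.clean
  rw [Inference.rename, vars_rename, h.1.vars, h'.1.vars] at hv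
  obtain ⟨π, hπ⟩ := exists_perm_fin ρ hv
  have e1 := ((h.1.rename ρ π hπ).logEquiv_iff h'.1).mp h1
  have e2 := ((h.2.rename ρ π hπ).logEquiv_iff h'.2).mp h2
  dsimp only at *
  subst e1 e2
  obtain ⟨e1, e2⟩ := hw.map_eq hw'
  rw [e1, e2]

/-- Every inference between clean formulae has a renaming that decomposes a least pair. -/
theorem CleanInf.exists_isLeastPair {r : Inference} (h : CleanInf r) {k : ℕ}
    (hk : r.lhs.vars.card = k) : ∃ (ρ : Equiv.Perm ℕ) (R S : Web k),
      IsDecompositionOf (r.rename ρ) ⟨k, R, S⟩ ∧ Web.IsLeastPair R S := by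
  obtain ⟨e⟩ : Nonempty (r.lhs.vars ≃ Finset.range k) :=
    ⟨Finset.equivOfCardEq (by rw [hk, Finset.card_range])⟩
  obtain ⟨τ, hτ⟩ := exists_perm_eq_on (V := r.lhs.vars)
    (ρ := fun x => if hx : x ∈ r.lhs.vars then (e ⟨x, hx⟩ : ℕ) else 0) (by
      intro x hx y hy hxy
      simp only [Finset.mem_coe] at hx hy
      simp only [hx, hy, dif_pos] at hxy
      simpa using e.injective (Subtype.ext hxy))
  have hv : (r.rename τ).lhs.vars = Finset.range k := by
    rw [Inference.rename, vars_rename]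
    refine Finset.eq_of_subset_of_card_le (fun y hy => ?_)
      (by rw [Finset.card_image_of_injective _ τ.injective, hk, Finset.card_range])
    obtain ⟨x, hx, rfl⟩ := Finset.mem_image.mp hy
    rw [hτ x hx, dif_pos hx]
    exact (e ⟨x, hx⟩).2
  have hc := h.rename τ
  obtain ⟨R, hR⟩ := hc.lhs.exists_web hv
  obtain ⟨S, hS⟩ := hc.rhs.exists_web (hc.vars_eq ▸ hv)
  obtain ⟨π, hπ⟩ := Web.exists_isLeastPair R S
  obtain ⟨ρ, hρ⟩ := exists_perm_nat π
  refine ⟨τ.trans ρ, _, _, ⟨?_, ?_⟩, hπ⟩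
  · have := hR.rename ρ π hρ
    rw [Inference.rename, rename_rename] at this
    exact this
  · have := hS.rename ρ π hρ
    rw [Inference.rename, rename_rename] at this
    exact this

/-! ### The results of the search -/

theorem mem_search {n : ℕ} {B : Finset GraphInference} {R S : Web n} :
    (R, S) ∈ search n B ↔ R.P4Free ∧ S ∈ logMin R ∧ Web.IsLeastPair R S ∧
      ∀ b ∈ B, ¬ isInstance b.2.1 b.2.2 R S := by
  simp only [search, leastWebs, Finset.mem_filter, Finset.mem_biUnion, Finset.mem_image,
    mem_cographs, Prod.mk.injEq]
  constructor
  · rintro ⟨⟨_, ⟨h1, -⟩, _, h2, rfl, rfl⟩, h3, h4⟩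
    exact ⟨h1, h2, h4, h3⟩
  · rintro ⟨h1, h2, h3, h4⟩
    exact ⟨⟨R, ⟨h1, h3.1⟩, S, h2, rfl, rfl⟩, h4, h3⟩

theorem mem_basis_succ {n : ℕ} {w : GraphInference} : w ∈ basis (n + 1) ↔ w ∈ basis n ∨
    ∃ R S : Web (n + 1), (R, S) ∈ search (n + 1) (basis n) ∧ w = ⟨n + 1, R, S⟩ := by
  simp only [basis, Finset.mem_union, Finset.mem_image, Prod.exists, eq_comm (b := w)]

theorem basis_subset_succ (n : ℕ) : basis n ⊆ basis (n + 1) :=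
  fun _ h => mem_basis_succ.mpr (Or.inl h)

theorem basis_mono {m n : ℕ} (h : m ≤ n) : basis m ⊆ basis n := by
  induction h with
  | refl => exact subset_rfl
  | step _ ih => exact ih.trans (basis_subset_succ _)

theorem le_of_mem_basis {n : ℕ} {w : GraphInference} (h : w ∈ basis n) : 0 < w.1 ∧ w.1 ≤ n := by
  induction n with
  | zero => simp [basis] at h
  | succ n ih =>
    rcases mem_basis_succ.mp h with h | ⟨R, S, -, rfl⟩
    · exact ⟨(ih h).1, (ih h).2.trans n.le_succ⟩
    · exact ⟨n.succ_pos, le_rfl⟩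

/-- Later stages only add inferences on more nodes. -/
theorem mem_basis_of_le {m n : ℕ} (h : m ≤ n) {w : GraphInference} (hw : w.1 ≤ m) :
    w ∈ basis n ↔ w ∈ basis m := by
  refine ⟨fun hn => ?_, fun h' => basis_mono h h'⟩
  induction h with
  | refl => exact hn
  | step h ih =>
    rcases mem_basis_succ.mp hn with h' | ⟨R, S, -, rfl⟩
    · exact ih h'
    · exact absurd (hw.trans h) (by simp)

theorem mem_basis_iff_search {m n : ℕ} (h : m + 1 ≤ n) {R S : Web (m + 1)} :
    (⟨m + 1, R, S⟩ : GraphInference) ∈ basis n ↔ (R, S) ∈ search (m + 1) (basis m) := by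
  rw [mem_basis_of_le h le_rfl, mem_basis_succ]
  constructor
  · rintro (h' | ⟨R', S', h', e⟩)
    · exact absurd (le_of_mem_basis h').2 (by simp)
    · simp only [Sigma.mk.injEq, heq_eq_eq, Prod.mk.injEq, true_and] at e
      rw [e.1, e.2]; exact h'
  · exact fun h' => Or.inr ⟨R, S, h', rfl⟩

theorem isLeastPair_of_mem_basis {n : ℕ} {w : GraphInference} (h : w ∈ basis n) :
    Web.IsLeastPair w.2.1 w.2.2 := by
  induction n with
  | zero => simp [basis] at h
  | succ n ih =>
    rcases mem_basis_succ.mp h with h | ⟨R, S, h', rfl⟩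
    · exact ih h
    · exact (mem_search.mp h').2.2.1

theorem exists_decomposition_of_mem_basis {n : ℕ} {w : GraphInference} (h : w ∈ basis n) :
    ∃ d, IsDecompositionOf d w := by
  induction n with
  | zero => simp [basis] at h
  | succ n ih =>
    rcases mem_basis_succ.mp h with h | ⟨R, S, h', rfl⟩
    · exact ih h
    · obtain ⟨h1, h2, -, -⟩ := mem_search.mp h'
      obtain ⟨φ, hφ⟩ := h1.exists_decomposition n.succ_pos
      obtain ⟨ψ, hψ⟩ := (mem_Phi.mp (mem_logMin.mp h2).1).1.exists_decomposition n.succ_pos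
      exact ⟨⟨φ, ψ⟩, hφ, hψ⟩

theorem good_of_mem_basis {n : ℕ} {w : GraphInference} (h : w ∈ basis n) {d : Inference}
    (hd : IsDecompositionOf d w) : Good d := by
  induction n with
  | zero => simp [basis] at h
  | succ n ih =>
    rcases mem_basis_succ.mp h with h | ⟨R, S, h', rfl⟩
    · exact ih h
    · exact (mem_logMin_iff_good hd).mp (mem_search.mp h').2.1

/-- Every good inference is an instance of an enumerated one. -/
theorem Good.exists_mem_basis {r : Inference} (h : Good r) : ∃ w ∈ basis r.lhs.vars.card,
    ∀ d, IsDecompositionOf d w → Instance {d} r.lhs r.rhs ∧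
      (w.1 = r.lhs.vars.card → d.Iso r) := by
  obtain ⟨k, hk⟩ : ∃ k, r.lhs.vars.card = k + 1 :=
    Nat.exists_eq_add_one.mpr (Finset.card_pos.mpr h.nonempty)
  obtain ⟨ρ, R, S, hd, hl⟩ := h.cleanInf.exists_isLeastPair hk
  have hg := h.rename ρ
  rw [hk]
  have hiso := (r.iso_rename ρ).symm
  -- The least renaming is either covered by a smaller enumerated inference or survives the filter
  -- of the search and is enumerated itself.
  by_cases hb : ∃ b ∈ basis k, isInstance b.2.1 b.2.2 R S
  · obtain ⟨b, hb, hi⟩ := hb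
    refine ⟨b, basis_subset_succ k hb, fun d hbd => ⟨?_, fun e => ?_⟩⟩
    · have := ctxInst_of_isInstance hbd hd.1 hd.2 hi
      exact hiso.ctxInst.trans_instance
        (this.instance rfl hbd.cleanInf hg.lhs hg.rhs) hg.cleanInf h.lhs h.rhs
    · have := (le_of_mem_basis hb).2
      omega
  · push Not at hb
    refine ⟨⟨k + 1, R, S⟩, (mem_basis_iff_search le_rfl).mpr (mem_search.mpr
      ⟨hd.1.p4Free, (mem_logMin_iff_good hd).mpr hg, hl, hb⟩), fun d hd' => ?_⟩
    have hi := (hd'.iso hd).trans hiso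
    exact ⟨hi.ctxInst.instance rfl hd'.cleanInf h.lhs h.rhs, fun _ => hi⟩

end LinearInference

namespace LinearInference
open Formula

/-! ### Closure properties of derivability -/

theorem acu_nf {φ : Formula} (h : φ.Linear) : ACU φ φ.nf := by
  induction φ with
  | and a b iha ihb =>
    have lab : (and a.nf b.nf).Linear :=
      ⟨h.1.nf, h.2.1.nf, h.2.2.mono (vars_nf a) (vars_nf b)⟩
    have lab' : (and a.nf b).Linear := ⟨h.1.nf, h.2.1, h.2.2.mono_left (vars_nf a)⟩
    have h1 : ACU (and a b) (and a.nf b.nf) :=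
      ((iha h.1).and_right b h lab').trans ((ihb h.2.1).and_left _ lab' lab)
    have lin := h.nf
    refine h1.trans ?_
    rw [Formula.nf] at lin ⊢
    rcases sand_cases a.nf b.nf with ⟨e, h⟩ | ⟨e, h⟩ | ⟨e, h⟩ | ⟨e, h⟩ | ⟨-, -, -, -, h⟩ <;>
      rw [h] at lin ⊢
    · rw [e] at lab ⊢; exact .ax (Or.inr (.top_and _)) lab lin
    · rw [e] at lab ⊢; exact .ax (Or.inr (.bot_and _)) lab lin
    · rw [e] at lab ⊢; exact .ax (Or.inr (.and_top _)) lab lin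
    · rw [e] at lab ⊢; exact .ax (Or.inr (.and_bot _)) lab lin
    · exact .refl lin
  | or a b iha ihb =>
    have lab : (or a.nf b.nf).Linear :=
      ⟨h.1.nf, h.2.1.nf, h.2.2.mono (vars_nf a) (vars_nf b)⟩
    have lab' : (or a.nf b).Linear := ⟨h.1.nf, h.2.1, h.2.2.mono_left (vars_nf a)⟩
    have h1 : ACU (or a b) (or a.nf b.nf) :=
      ((iha h.1).or_right b h lab').trans ((ihb h.2.1).or_left _ lab' lab)
    have lin := h.nf
    refine h1.trans ?_
    rw [Formula.nf] at lin ⊢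
    rcases sor_cases a.nf b.nf with ⟨e, h⟩ | ⟨e, h⟩ | ⟨e, h⟩ | ⟨e, h⟩ | ⟨-, -, -, -, h⟩ <;>
      rw [h] at lin ⊢
    · rw [e] at lab ⊢; exact .ax (Or.inr (.bot_or _)) lab lin
    · rw [e] at lab ⊢; exact .ax (Or.inr (.top_or _)) lab lin
    · rw [e] at lab ⊢; exact .ax (Or.inr (.or_bot _)) lab lin
    · rw [e] at lab ⊢; exact .ax (Or.inr (.or_top _)) lab lin
    · exact .refl lin
  | _ => exact .refl h

theorem ACU.derivableU {S : Set Inference} {φ ψ : Formula} (h : ACU φ ψ) : DerivableU S φ ψ :=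
  .single (Or.inr h)

theorem Instance.derivableU {S : Set Inference} {φ ψ : Formula} (h : Instance S φ ψ) :
    DerivableU S φ ψ := by
  obtain ⟨a, b, h1, h2, h3⟩ := h
  exact .single (Or.inl ⟨a, b, h1.acu, h2, h3.acu⟩)

theorem Rewrite.derivableU {S : Set Inference} {φ ψ : Formula} (h : Rewrite S φ ψ)
    (hφ : φ.Linear) (hψ : ψ.Linear) : DerivableU S φ ψ :=
  .single (Or.inl ⟨φ, ψ, .refl hφ, h, .refl hψ⟩)

theorem Instance.mono {S T : Set Inference} (hST : S ⊆ T) {φ ψ : Formula} (h : Instance S φ ψ) :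
    Instance T φ ψ := by
  obtain ⟨a, b, h1, h2, h3⟩ := h
  exact ⟨a, b, h1, h2.mono hST, h3⟩

/-- The substitution that changes the polarity of the variables in `N`. -/
def flip (N : Finset ℕ) (z : ℕ) : Formula := if z ∈ N then nvar z else var z

theorem vars_flip (N : Finset ℕ) (z : ℕ) : (flip N z).vars = {z} := by
  unfold flip; split_ifs <;> rfl

theorem linOn_flip (N s : Finset ℕ) : LinOn (flip N) s := by
  refine ⟨fun z _ => ?_, fun z _ w _ hzw => ?_⟩
  · unfold flip; split_ifs <;> trivial
  · simpa [vars_flip] using hzw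

theorem Formula.Linear.flip {φ : Formula} (h : φ.Linear) (N : Finset ℕ) :
    (φ.subst (flip N)).Linear := (linear_subst h).mpr (linOn_flip N _)

theorem subst_flip_flip (N : Finset ℕ) (φ : Formula) : (φ.subst (flip N)).subst (flip N) = φ := by
  rw [subst_subst]
  conv_rhs => rw [← subst_var φ]
  refine subst_congr fun z _ => ?_
  by_cases h : z ∈ N
  · simp [flip, h, Formula.subst, neg]
  · simp [flip, h, Formula.subst]

theorem vars_subst_flip (N : Finset ℕ) (φ : Formula) : (φ.subst (flip N)).vars = φ.vars := by
  simp [vars_subst, vars_flip]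

theorem ACAxiom.subst {φ ψ : Formula} (h : ACAxiom φ ψ) (σ : ℕ → Formula) :
    ACAxiom (φ.subst σ) (ψ.subst σ) := by
  cases h
  · exact .or_comm _ _
  · exact .and_comm _ _
  · exact .and_assoc _ _ _
  · exact .or_assoc _ _ _

theorem UAxiom.subst {φ ψ : Formula} (h : UAxiom φ ψ) (σ : ℕ → Formula) :
    UAxiom (φ.subst σ) (ψ.subst σ) := by
  cases h
  · exact .and_top _
  · exact .top_and _
  · exact .or_bot _
  · exact .bot_or _
  · exact .and_bot _
  · exact .bot_and _
  · exact .or_top _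
  · exact .top_or _

theorem ACU.flip {φ ψ : Formula} (h : ACU φ ψ) (N : Finset ℕ) :
    ACU (φ.subst (flip N)) (ψ.subst (flip N)) := by
  induction h with
  | ax h h1 h2 => exact .ax (h.imp (fun h => h.subst _) fun h => h.subst _) (h1.flip N) (h2.flip N)
  | refl h => exact .refl (h.flip N)
  | symm _ ih => exact ih.symm
  | trans _ _ ih1 ih2 => exact ih1.trans ih2
  | and_right χ _ h1 h2 ih => exact ih.and_right _ (h1.flip N) (h2.flip N)
  | and_left χ _ h1 h2 ih => exact ih.and_left _ (h1.flip N) (h2.flip N)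
  | or_right χ _ h1 h2 ih => exact ih.or_right _ (h1.flip N) (h2.flip N)
  | or_left χ _ h1 h2 ih => exact ih.or_left _ (h1.flip N) (h2.flip N)

/-- Rules apply under arbitrary substitutions, so the formulae of a derivation may change polarity
while its rules stay the same. -/
theorem DerivableU.flip {S : Set Inference} {φ ψ : Formula} (h : DerivableU S φ ψ)
    (N : Finset ℕ) : DerivableU S (φ.subst (flip N)) (ψ.subst (flip N)) := by
  refine Relation.ReflTransGen.lift (fun φ : Formula => φ.subst (LinearInference.flip N))
    (fun a b hab => ?_) _ _ h
  rcases hab with ⟨a', b', h1, h2, h3⟩ | h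
  · exact Or.inl ⟨_, _, h1.flip N, h2.subst _, h3.flip N⟩
  · exact Or.inr (h.flip N)

/-- A relation closed under contexts that relates literals to `t` also relates each linear
formula to the result of replacing one of its literals by `t`. -/
theorem rel_subst1_of_literal {Q : Formula → Formula → Prop}
    (q1 : ∀ a b c, Q a b → Q (and a c) (and b c)) (q2 : ∀ a b c, Q a b → Q (and c a) (and c b))
    (q3 : ∀ a b c, Q a b → Q (or a c) (or b c)) (q4 : ∀ a b c, Q a b → Q (or c a) (or c b))
    {x : ℕ} {t : Formula} (hv : Q (var x) t) (hn : Q (nvar x) t) {φ : Formula} (h : φ.Linear)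
    (hx : x ∈ φ.vars) : Q φ (φ.subst1 x (if x ∈ φ.negv then t.neg else t)) := by
  have left : ∀ {a b : Formula}, Disjoint a.vars b.vars → x ∈ a.vars →
      x ∉ b.vars ∧ (x ∈ a.negv ∪ b.negv ↔ x ∈ a.negv) := fun {a b} hd hx => by
    have hb := Finset.disjoint_left.mp hd hx
    exact ⟨hb, by simpa using fun h => absurd (negv_subset b h) hb⟩
  have right : ∀ {a b : Formula}, Disjoint a.vars b.vars → x ∈ b.vars →
      x ∉ a.vars ∧ (x ∈ a.negv ∪ b.negv ↔ x ∈ b.negv) := fun {a b} hd hx => by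
    have ha := Finset.disjoint_right.mp hd hx
    exact ⟨ha, by simpa using fun h => absurd (negv_subset a h) ha⟩
  induction φ with
  | top => simp [vars] at hx
  | bot => simp [vars] at hx
  | var y =>
    obtain rfl : x = y := by simpa [vars] using hx
    simpa [negv] using hv
  | nvar y =>
    obtain rfl : x = y := by simpa [vars] using hx
    simpa [negv, subst1, Formula.subst, neg_neg] using hn
  | and a b iha ihb =>
    rcases Finset.mem_union.mp hx with hx | hx
    · obtain ⟨h1, h2⟩ := left h.2.2 hx
      rw [subst1_and_left h1]
      simp only [negv, h2]
      exact q1 _ _ _ (iha h.1 hx)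
    · obtain ⟨h1, h2⟩ := right h.2.2 hx
      rw [subst1_and_right h1]
      simp only [negv, h2]
      exact q2 _ _ _ (ihb h.2.1 hx)
  | or a b iha ihb =>
    rcases Finset.mem_union.mp hx with hx | hx
    · obtain ⟨h1, h2⟩ := left h.2.2 hx
      rw [subst1_or_left h1]
      simp only [negv, h2]
      exact q3 _ _ _ (iha h.1 hx)
    · obtain ⟨h1, h2⟩ := right h.2.2 hx
      rw [subst1_or_right h1]
      simp only [negv, h2]
      exact q4 _ _ _ (ihb h.2.1 hx)

theorem linear_subst1_const {φ : Formula} (h : φ.Linear) (x : ℕ) {t : Formula} (ht : t.vars = ∅)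
    (lt : t.Linear) : (φ.subst1 x t).Linear ∧ (φ.subst1 x t).vars ⊆ φ.vars.erase x := by
  by_cases hx : x ∈ φ.vars
  · exact ⟨(linear_subst1 h hx).mpr ⟨lt, by simp [ht]⟩, fun y hy => by
      simpa [ht] using (mem_vars_subst1 hx).mp hy⟩
  · rw [subst1_of_notMem hx, Finset.erase_eq_of_notMem hx]
    exact ⟨h, subset_rfl⟩

/-! ### Reduction of all linear inferences to good ones -/

section Generation

variable {m : ℕ} {S : Set Inference}

theorem derivableU_of_mem {r : Inference} (hr : r ∈ S) (hl : r.IsLinear) :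
    DerivableU S r.lhs r.rhs := by
  have := Rewrite.rule var hr
  rw [subst_var, subst_var] at this
  exact this.derivableU hl.1 hl.2.1

/-- The one-variable inference `x → ⊤`, available since `2 ≤ m`, is applied at the literal of `x`.
The constant depends on the polarity so that this literal, and not merely `x`, becomes ⊤. -/
theorem derivableU_subst1 (hm : 2 ≤ m) (hS : LLt m ⊆ S) {φ : Formula} (h : φ.Linear) (x : ℕ) :
    DerivableU S φ (φ.subst1 x (if x ∈ φ.negv then bot else top)) := by
  by_cases hx : x ∈ φ.vars
  · have hr : (⟨var 0, top⟩ : Inference) ∈ S := hS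
      ⟨⟨trivial, trivial, fun _ _ => rfl⟩, by simp [Inference.vars, vars]; omega⟩
    have := rel_subst1_of_literal (Q := Rewrite S) (fun _ _ c => .and_right c)
      (fun _ _ c => .and_left c) (fun _ _ c => .or_right c) (fun _ _ c => .or_left c)
      (x := x) (.rule (fun _ => var x) hr) (.rule (fun _ => nvar x) hr) h hx
    refine this.derivableU h (linear_subst1_const h x ?_ ?_).1
    · split_ifs <;> rfl
    · split_ifs <;> trivial
  · rw [subst1_of_notMem hx]; exact .refl

theorem derivableU_of_subst1 (hm : 2 ≤ m) (hS : LLt m ⊆ S) {φ : Formula} (h : φ.Linear) (x : ℕ) :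
    DerivableU S (φ.subst1 x (if x ∈ φ.negv then top else bot)) φ := by
  by_cases hx : x ∈ φ.vars
  · have hr : (⟨bot, var 0⟩ : Inference) ∈ S := hS
      ⟨⟨trivial, trivial, fun _ h => by cases h⟩, by simp [Inference.vars, vars]; omega⟩
    have := rel_subst1_of_literal (Q := fun a b => Rewrite S b a) (fun _ _ c => .and_right c)
      (fun _ _ c => .and_left c) (fun _ _ c => .or_right c) (fun _ _ c => .or_left c)
      (x := x) (.rule (fun _ => var x) hr) (.rule (fun _ => nvar x) hr) h hx
    refine this.derivableU (linear_subst1_const h x ?_ ?_).1 h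
    · split_ifs <;> rfl
    · split_ifs <;> trivial
  · rw [subst1_of_notMem hx]; exact .refl

/-- Every non-trivial inference between clean formulae is derivable if the good ones are. -/
theorem derivableU_of_good {V : Finset ℕ} (hV : V.Nonempty)
    (hS : ∀ r : Inference, Good r → r.lhs.vars = V → DerivableU S r.lhs r.rhs) {φ ψ : Formula}
    (hφ : φ.Clean) (hψ : ψ.Clean) (vφ : φ.vars = V) (vψ : ψ.vars = V) (hi : Implies φ ψ)
    (hn : NonTriv φ ψ V) : DerivableU S φ ψ := by
  -- The measure of the induction: the assignments of `V` that satisfy the conclusion but not the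
  -- premise. A proper interpolant leaves strictly fewer of them to either half.
  let gap : Formula → Formula → Finset (Finset ℕ) := fun a b =>
    V.powerset.filter fun P => b.eval (fun x => decide (x ∈ P)) = true ∧
      a.eval (fun x => decide (x ∈ P)) = false
  have mem : ∀ {a b : Formula}, a.vars = V → b.vars = V → ∀ α : ℕ → Bool, b.eval α = true →
      a.eval α = false → V.filter (fun x => α x = true) ∈ gap a b := by
    intro a b ha hb α h1 h2
    have key : ∀ x ∈ V, decide (x ∈ V.filter fun x => α x = true) = α x := by
      intro x hx; simp [hx]
    refine Finset.mem_filter.mpr ⟨Finset.mem_powerset.mpr (Finset.filter_subset _ _), ?_⟩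
    rw [eval_congr fun x hx => key x (hb ▸ hx), eval_congr fun x hx => key x (ha ▸ hx)]
    exact ⟨h1, h2⟩
  have strict : ∀ {a b : Formula}, Implies a b → ¬ LogEquiv a b → ∃ α, b.eval α = true ∧
      a.eval α = false := by
    intro a b hi hne
    by_contra hc
    push Not at hc
    exact hne (hi.antisymm fun α hα => by simpa using hc α hα)
  induction hg : (gap φ ψ).card using Nat.strong_induction_on generalizing φ ψ with
  | _ g ih =>
    by_cases he : LogEquiv φ ψ
    · exact (he.ac hφ hψ).acu.derivableU
    by_cases hm : (⟨φ, ψ⟩ : Inference).LogMinimal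
    · exact hS ⟨φ, ψ⟩ ⟨hφ, hψ, vφ.trans vψ.symm, hi, vφ ▸ hn, hm, he⟩ vφ
    simp only [Inference.LogMinimal] at hm
    push Not at hm
    obtain ⟨χ, hχ, i1, i2, n1, n2⟩ := hm
    obtain ⟨c, v⟩ := hn.clean_nf_of_between vφ.le vψ.le hV i1 i2 hχ
    have e := logEquiv_nf χ
    have j1 := i1.trans e.symm.implies
    have j2 := e.implies.trans i2
    have m1 : ¬ LogEquiv φ χ.nf := fun h => n1 (e.symm.trans h.symm)
    have m2 : ¬ LogEquiv χ.nf ψ := fun h => n2 (e.symm.trans h)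
    refine Relation.ReflTransGen.trans (ih _ ?_ hφ c vφ v j1 (hn.mono (fun _ h => h) j2) rfl)
      (ih _ ?_ c hψ v vψ j2 (hn.mono j1 fun _ h => h) rfl)
    · rw [← hg]
      refine Finset.card_lt_card (Finset.ssubset_iff_subset_ne.mpr ⟨fun P hP => ?_, fun h => ?_⟩)
      · simp only [gap, Finset.mem_filter] at hP ⊢
        exact ⟨hP.1, j2 _ hP.2.1, hP.2.2⟩
      · obtain ⟨α, h1, h2⟩ := strict j2 m2
        have h3 : φ.eval α = false := by
          by_contra hc
          rw [Bool.not_eq_false] at hc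
          rw [j1 _ hc] at h2; cases h2
        have hP := mem vφ vψ α h1 h3
        have hQ := mem v vψ α h1 h2
        rw [← h] at hP
        simp only [gap, Finset.mem_filter] at hP hQ
        rw [hP.2.1] at hQ; exact Bool.noConfusion hQ.2.2
    · rw [← hg]
      refine Finset.card_lt_card (Finset.ssubset_iff_subset_ne.mpr ⟨fun P hP => ?_, fun h => ?_⟩)
      · simp only [gap, Finset.mem_filter] at hP ⊢
        refine ⟨hP.1, hP.2.1, ?_⟩
        by_contra hc
        rw [Bool.not_eq_false] at hc
        have := hP.2.2
        rw [j1 _ hc] at this; cases this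
      · obtain ⟨α, h1, h2⟩ := strict j1 m1
        have hP := mem vφ vψ α (j2 _ h1) h2
        have hQ := mem vφ v α h1 h2
        rw [← h] at hP
        simp only [gap, Finset.mem_filter] at hP hQ
        rw [hQ.2.1] at hP; exact Bool.noConfusion hP.2.2

/-- To derive all linear inferences on `m` variables it suffices to derive the good ones. -/
theorem derivableU_of_mem_L (hm : 2 ≤ m) (hS : LLt m ⊆ S)
    (hg : ∀ r : Inference, Good r → r.lhs.vars.card = m → DerivableU S r.lhs r.rhs)
    {r : Inference} (hr : r ∈ L m) : DerivableU S r.lhs r.rhs := by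
  obtain ⟨⟨l1, l2, hi⟩, hc⟩ := hr
  -- Triviality at `x` in a form that respects polarity: the literal of `x` becomes ⊤ on the left
  -- and ⊥ on the right. The inference then passes through one without `x`, which is in `LLt m`.
  by_cases ht : ∃ x ∈ r.vars, Implies (r.lhs.subst1 x (if x ∈ r.lhs.negv then bot else top))
      (r.rhs.subst1 x (if x ∈ r.rhs.negv then top else bot))
  · obtain ⟨x, hx, ht⟩ := ht
    have k1 := linear_subst1_const l1 x (t := if x ∈ r.lhs.negv then bot else top)
      (by split_ifs <;> rfl) (by split_ifs <;> trivial)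
    have k2 := linear_subst1_const l2 x (t := if x ∈ r.rhs.negv then top else bot)
      (by split_ifs <;> rfl) (by split_ifs <;> trivial)
    refine Relation.ReflTransGen.trans (derivableU_subst1 hm hS l1 x)
      (Relation.ReflTransGen.trans ?_ (derivableU_of_subst1 hm hS l2 x))
    refine derivableU_of_mem (r := ⟨_, _⟩) (hS ⟨⟨k1.1, k2.1, ht⟩, ?_⟩) ⟨k1.1, k2.1, ht⟩
    rw [← hc]
    refine (Finset.card_le_card (Finset.union_subset (k1.2.trans ?_) (k2.2.trans ?_))).trans_lt
      (Finset.card_erase_lt_of_mem hx)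
    · exact Finset.erase_subset_erase _ Finset.subset_union_left
    · exact Finset.erase_subset_erase _ Finset.subset_union_right
  push Not at ht
  have hw : ∀ x ∈ r.vars, ∃ α : ℕ → Bool,
      r.lhs.eval (Function.update α x (decide (x ∉ r.lhs.negv))) = true ∧
      r.rhs.eval (Function.update α x (decide (x ∈ r.rhs.negv))) = false := by
    intro x hx
    have := ht x hx
    simp only [Implies, eval_subst1] at this
    push Not at this
    obtain ⟨α, h1, h2⟩ := this
    refine ⟨α, ?_, ?_⟩
    · convert h1 using 2
      split_ifs with h <;> simp [eval, h]
    · rw [← Bool.not_eq_true]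
      convert h2 using 4
      split_ifs with h <;> simp [eval, h]
  -- If a variable had different polarities on the two sides, both updates in its witness would be
  -- the same, and the witness would refute validity.
  have hneg : r.lhs.negv = r.rhs.negv := by
    have key : ∀ x ∈ r.vars, (x ∈ r.lhs.negv ↔ x ∈ r.rhs.negv) := by
      intro x hx
      obtain ⟨α, h1, h2⟩ := hw x hx
      have h3 := hi _ h1
      by_contra hne
      have : decide (x ∉ r.lhs.negv) = decide (x ∈ r.rhs.negv) := by
        rw [decide_eq_decide]; tauto
      rw [this, h2] at h3; cases h3
    ext x
    constructor
    · exact fun h => (key x (Finset.mem_union_left _ (negv_subset _ h))).mp h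
    · exact fun h => (key x (Finset.mem_union_right _ (negv_subset _ h))).mpr h
  -- Changing the polarity of the variables in `N` makes all occurrences positive on both sides, and
  -- the witnesses become those of `NonTriv`. The change is undone at the end by a second one.
  set N := r.lhs.negv with hN
  have hV : r.vars.Nonempty := by rw [← Finset.card_pos, hc]; omega
  have hi' : Implies (r.lhs.subst (flip N)) (r.rhs.subst (flip N)) := fun α hα => by
    rw [eval_subst] at hα ⊢; exact hi _ hα
  have hnt : NonTriv (r.lhs.subst (flip N)) (r.rhs.subst (flip N)) r.vars := by
    intro x hx
    obtain ⟨α, h1, h2⟩ := hw x hx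
    have key : ∀ b : Bool, (fun z => (flip N z).eval (Function.update
        (fun w => (flip N w).eval α) x b)) = Function.update α x (if x ∈ N then !b else b) := by
      intro b
      funext z
      by_cases e : z = x
      · subst e
        by_cases h : z ∈ N <;> simp [flip, h, eval]
      · by_cases h : z ∈ N <;> simp [flip, h, eval, Function.update_of_ne e]
    refine ⟨fun w => (flip N w).eval α, ?_, ?_⟩
    · rw [eval_subst, key]
      convert h1 using 3
      by_cases h : x ∈ N <;> simp [h]
    · rw [eval_subst, key]
      convert h2 using 3
      rw [← hneg]
      by_cases h : x ∈ N <;> simp [h]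
  have hsub := hnt.subset hi'
  rw [vars_subst_flip, vars_subst_flip] at hsub
  have v1 : r.lhs.vars = r.vars := Finset.Subset.antisymm Finset.subset_union_left
    (hsub.trans Finset.inter_subset_left)
  have v2 : r.rhs.vars = r.vars := Finset.Subset.antisymm Finset.subset_union_right
    (hsub.trans Finset.inter_subset_right)
  have s1 : (r.lhs.subst (flip N)).vars ⊆ r.vars := by rw [vars_subst_flip, v1]
  have s2 : (r.rhs.subst (flip N)).vars ⊆ r.vars := by rw [vars_subst_flip, v2]
  obtain ⟨c1, w1⟩ := hnt.clean_nf_of_between s1 s2 hV (fun _ h => h) hi' (l1.flip N)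
  obtain ⟨c2, w2⟩ := hnt.clean_nf_of_between s1 s2 hV hi' (fun _ h => h) (l2.flip N)
  have e1 := logEquiv_nf (r.lhs.subst (flip N))
  have e2 := logEquiv_nf (r.rhs.subst (flip N))
  have hd := derivableU_of_good hV (S := S) (fun r' hr' hv => hg r' hr' (hv ▸ hc)) c1 c2 w1 w2
    (e1.implies.trans (hi'.trans e2.symm.implies)) (hnt.mono e1.symm.implies e2.implies)
  have := DerivableU.flip ((acu_nf (l1.flip N)).derivableU.trans (hd.trans
    (ACU.derivableU (acu_nf (l2.flip N)).symm))) N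
  rwa [subst_flip_flip, subst_flip_flip] at this

end Generation

theorem IsDecompositionOf.mem_L {d : Inference} {w : GraphInference} (h : IsDecompositionOf d w)
    (hd : Good d) : d ∈ L w.1 :=
  ⟨⟨hd.lhs.linear, hd.rhs.linear, hd.implies⟩, by
    rw [h.cleanInf.vars, h.1.vars, Finset.card_range]⟩

/-- A set that contains a version of each enumerated inference of size `m` generates. -/
theorem generates_of_iso {m : ℕ} (hm : 2 ≤ m) {X : Set Inference} (hX : X ⊆ L m)
    (h : ∀ w ∈ basis m, w.1 = m → ∃ x ∈ X, CleanInf x ∧ ∃ d, IsDecompositionOf d w ∧ x.Iso d) :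
    Generates m X := by
  refine ⟨hX, fun r hr => derivableU_of_mem_L hm Set.subset_union_right (fun g hg hc => ?_) hr⟩
  obtain ⟨w, hw, hd⟩ := hg.exists_mem_basis
  rw [hc] at hw hd
  by_cases hwm : w.1 = m
  · obtain ⟨x, hx, cx, d, hdw, hi⟩ := h w hw hwm
    have hg' := good_of_mem_basis hw hdw
    have := hi.trans ((hd d hdw).2 hwm)
    exact (this.ctxInst.instance (Or.inl hx) cx hg.lhs hg.rhs).derivableU
  · obtain ⟨d, hdw⟩ := exists_decomposition_of_mem_basis hw
    have hlt := lt_of_le_of_ne (le_of_mem_basis hw).2 hwm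
    have hL := hdw.mem_L (good_of_mem_basis hw hdw)
    have hmem : d ∈ X ∪ LLt m := Or.inr ⟨hL.1, hL.2.trans_lt hlt⟩
    exact ((hd d hdw).1.mono (Set.singleton_subset_iff.mpr hmem)).derivableU

end LinearInference

namespace LinearInference
open Formula

/-! ### Lower bound: each enumerated inference needs its own generator -/

theorem Rewrite.exists_singleton {S : Set Inference} {φ ψ : Formula} (h : Rewrite S φ ψ) :
    ∃ r ∈ S, Rewrite {r} φ ψ := by
  induction h with
  | rule σ hr => exact ⟨_, hr, .rule σ rfl⟩
  | and_right χ _ ih => obtain ⟨r, hr, h⟩ := ih; exact ⟨r, hr, .and_right χ h⟩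
  | and_left χ _ ih => obtain ⟨r, hr, h⟩ := ih; exact ⟨r, hr, .and_left χ h⟩
  | or_right χ _ ih => obtain ⟨r, hr, h⟩ := ih; exact ⟨r, hr, .or_right χ h⟩
  | or_left χ _ ih => obtain ⟨r, hr, h⟩ := ih; exact ⟨r, hr, .or_left χ h⟩

theorem implies_of_step {S : Set Inference} (hS : ∀ r ∈ S, Implies r.lhs r.rhs) {a b : Formula} (h : InstanceU S a b ∨ ACU a b) : Implies a b := by
  rcases h with ⟨a', b', h1, h2, h3⟩ | h
  · exact h1.logEquiv.implies.trans ((h2.implies hS).trans h3.logEquiv.implies)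
  · exact h.logEquiv.implies

theorem DerivableU.implies {S : Set Inference} (hS : ∀ r ∈ S, Implies r.lhs r.rhs) {a b : Formula} (h : DerivableU S a b) : Implies a b := by
  induction h with
  | refl => exact fun _ h => h
  | tail _ h ih => exact ih.trans (implies_of_step hS h)

/-- A derivation of a logically minimal inference has a single step that is not an equivalence. -/
theorem Good.exists_rewrite {S : Set Inference} (hS : ∀ r ∈ S, Implies r.lhs r.rhs)
    {r : Inference} (hr : Good r) (h : DerivableU S r.lhs r.rhs) :
    ∃ r₀ ∈ S, ∃ φ' ψ' : Formula, φ'.Linear ∧ ψ'.Linear ∧ LogEquiv r.lhs φ' ∧ LogEquiv r.rhs ψ' ∧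
      Rewrite {r₀} φ' ψ' := by
  have key : ∀ a, DerivableU S a r.rhs → LogEquiv r.lhs a →
      ∃ r₀ ∈ S, ∃ φ' ψ' : Formula, φ'.Linear ∧ ψ'.Linear ∧ LogEquiv r.lhs φ' ∧
        LogEquiv r.rhs ψ' ∧ Rewrite {r₀} φ' ψ' := by
    intro a ha
    induction ha using Relation.ReflTransGen.head_induction_on with
    | refl => exact fun e => absurd e hr.not_logEquiv
    | head h1 h2 ih =>
      intro e
      rcases h1 with ⟨a', b', k1, k2, k3⟩ | h1
      · have i1 := e.implies.trans (implies_of_step hS (Or.inl ⟨a', b', k1, k2, k3⟩))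
        -- The formula reached lies between the two sides, so it is equivalent to one of them. The
        -- first step to leave the class of the left side therefore arrives in the class of the
        -- right side.
        rcases hr.logMinimal _ k3.linear.2 i1 (DerivableU.implies hS h2) with h | h
        · exact ih h.symm
        · obtain ⟨r₀, hr₀, h0⟩ := k2.exists_singleton
          exact ⟨r₀, hr₀, a', b', k1.linear.2, k3.linear.1, e.trans k1.logEquiv,
            h.symm.trans k3.logEquiv.symm, h0⟩
      · exact ih (e.trans h1.logEquiv)
  exact key _ h (.refl _)

theorem not_isInstance_of_mem_basis {m k : ℕ} {w b : GraphInference} (hw : w ∈ basis m)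
    (hwm : w.1 = m) (hb : b ∈ basis k) (hk : k < m) :
    ¬ isInstance b.2.1 b.2.2 w.2.1 w.2.2 := by
  obtain ⟨n, R, S⟩ := w
  obtain rfl : n = m := hwm
  obtain ⟨l, rfl⟩ : ∃ l, n = l + 1 := Nat.exists_eq_add_one.mpr (by omega)
  exact (mem_search.mp ((mem_basis_iff_search le_rfl).mp hw)).2.2.2 b (basis_mono (by omega) hb)

/-- The single proper step of a derivation of `d` is, after unit elimination, an instance of a good
inference on at most as many variables as its rule. On fewer than `m` variables this good inference
would itself be an instance of an enumerated one of smaller size, and the search would have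
discarded `w`. So the rule has all `m` variables, comes from `Y`, and equals `d` up to names and
polarities. -/
theorem exists_signedVariant {m : ℕ} {Y : Set Inference} (hY : Generates m Y) {w : GraphInference}
    (hw : w ∈ basis m) (hwm : w.1 = m) {d : Inference} (hd : IsDecompositionOf d w) :
    ∃ y ∈ Y, SignedVariant y d := by
  have hg := good_of_mem_basis hw hd
  have hS : ∀ r ∈ Y ∪ LLt m, r.IsLinear ∧ r.vars.card ≤ m := by
    rintro r (hr | hr)
    · exact ⟨(hY.1 hr).1, (hY.1 hr).2.le⟩
    · exact ⟨hr.1, hr.2.le⟩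
  have hder := hY.2 d (hwm ▸ hd.mem_L hg)
  obtain ⟨r₀, hr₀, φ', ψ', l1, l2, e1, e2, hrw⟩ :=
    hg.exists_rewrite (fun r hr => (hS r hr).1.2.2) hder
  obtain ⟨r₂, g2, hc, hsub, hsv⟩ := hg.unit_elim (hS r₀ hr₀).1 e1 e2 l1 l2 hrw
  have hdm : d.lhs.vars.card = m := by rw [hd.1.vars, Finset.card_range, hwm]
  have hle := Finset.card_le_card hsub
  rcases (hle.trans (hS r₀ hr₀).2).lt_or_eq with hlt | heq
  · exfalso
    obtain ⟨w', hw', hi⟩ := g2.exists_mem_basis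
    obtain ⟨d', hd'⟩ := exists_decomposition_of_mem_basis hw'
    have hinst := hc.trans_instance (hi d' hd').1 g2.cleanInf hg.lhs hg.rhs
    obtain ⟨_, rfl, hctx⟩ := hinst.exists_ctxInst
      (fun r hr => (Set.mem_singleton_iff.mp hr) ▸ hd'.cleanInf) hg.lhs
    exact not_isInstance_of_mem_basis hw hwm hw' (by omega)
      (isInstance_of_ctxInst hd' hd.1 hd.2 hctx)
  · have h0 : r₀.vars.card = m := le_antisymm (hS r₀ hr₀).2 (heq ▸ hle)
    have hv : r₂.lhs.vars = r₀.vars := Finset.eq_of_subset_of_card_le hsub (by omega)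
    refine ⟨r₀, ?_, hsv (heq.trans hdm.symm) hv.symm⟩
    rcases hr₀ with h | h
    · exact h
    · exact absurd h.2 (by omega)

/-- The clean formula `φ` increases in `ρ z` at some assignment, so `l` must depend on `z`, and the
sign has to compensate for the polarity of `z` in `l`. -/
theorem exists_sign {l φ : Formula} (hl : l.Linear) (hφ : φ.Clean) {V : Finset ℕ} {ρ : ℕ → ℕ}
    {s : ℕ → Bool} (hV : l.vars ⊆ V) (hinj : Set.InjOn ρ V) (himg : V.image ρ = φ.vars)
    (e : LogEquiv φ (l.subst fun z => if s z then var (ρ z) else nvar (ρ z))) :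
    ∀ z ∈ V, z ∈ l.vars ∧ s z = decide (z ∉ l.negv) := by
  intro z hz
  obtain ⟨α, hα⟩ := hφ.exists_critical (himg ▸ Finset.mem_image_of_mem ρ hz)
  let β : ℕ → Bool := fun w => if s w then α (ρ w) else !α (ρ w)
  have key : ∀ b, l.eval (Function.update β z (if s z then b else !b)) = b := by
    intro b
    refine Eq.trans ?_ ((e _).symm.trans (hα b))
    rw [eval_subst]
    refine eval_congr fun w hw => ?_
    by_cases hwz : w = z
    · subst hwz
      by_cases h : s w = true <;> simp [h, eval]
    · have : ρ w ≠ ρ z := fun h => hwz (hinj (hV hw) hz h)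
      rw [Function.update_of_ne hwz]
      by_cases h : s w = true <;> simp [β, h, eval, Function.update_of_ne this]
  constructor
  · by_contra hc
    have h1 := key true
    have h2 := key false
    rw [eval_update_of_notMem hc] at h1 h2
    rw [h1] at h2; cases h2
  · by_contra hs
    have h1 := eval_update_le hl z _ rfl (key true)
    have h2 := key false
    rw [Function.update_idem] at h1
    have : (if s z = true then false else !false) = decide (z ∉ l.negv) := by
      cases h : s z <;> rw [h] at hs <;> symm <;> simpa using hs
    rw [this, h1] at h2; cases h2

/-- The polarities of a signed variant are those of its first formula. -/
theorem SignedVariant.iso {r d d' : Inference} (hl : r.lhs.Linear) (hd : CleanInf d)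
    (hd' : CleanInf d') (h : SignedVariant r d) (h' : SignedVariant r d') : d.Iso d' := by
  obtain ⟨ρ, s, i, hv, e1, e2⟩ := h
  obtain ⟨ρ', s', i', hv', e1', e2'⟩ := h'
  have k := exists_sign hl hd.lhs Finset.subset_union_left i hv e1
  have k' := exists_sign hl hd'.lhs Finset.subset_union_left i' hv' e1'
  obtain ⟨π, hπ⟩ := exists_perm_eq_on i
  obtain ⟨π', hπ'⟩ := exists_perm_eq_on i'
  have hlit : ∀ l : Formula, l.vars ⊆ r.vars →
      (l.subst fun z => if s z then var (ρ z) else nvar (ρ z)).rename (π.symm.trans π') =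
        l.subst fun z => if s' z then var (ρ' z) else nvar (ρ' z) := by
    intro l hl
    rw [rename, subst_subst]
    refine subst_congr fun z hz => ?_
    have hz := hl hz
    have : π' (π.symm (ρ z)) = ρ' z := by
      rw [← hπ z hz, Equiv.symm_apply_apply, hπ' z hz]
    rw [(k z hz).2, (k' z hz).2]
    split_ifs <;> simp [Formula.subst, neg, this]
  refine ⟨π.symm.trans π', ?_, ?_⟩
  · have := e1.rename (π.symm.trans π')
    rw [hlit _ Finset.subset_union_left] at this
    exact this.trans e1'.symm
  · have := e2.rename (π.symm.trans π')
    rw [hlit _ Finset.subset_union_right] at this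
    exact this.trans e2'.symm

/-- Clean sides have no negative occurrences, so all the signs are forced to be positive. -/
theorem SignedVariant.iso_of_clean {r d : Inference} (hl : r.lhs.Clean) (hr : r.rhs.Clean)
    (hd : CleanInf d) (h : SignedVariant r d) : CleanInf r ∧ r.Iso d := by
  obtain ⟨ρ, s, i, hv, e1, e2⟩ := h
  have k := exists_sign hl.linear hd.lhs Finset.subset_union_left i hv e1
  have k2 := exists_sign hr.linear hd.rhs Finset.subset_union_right i (hv.trans hd.vars_eq) e2
  have hs : ∀ z ∈ r.vars, s z = true := fun z hz => by
    rw [(k z hz).2, (negFree_iff _).mp hl.negFree]; simp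
  obtain ⟨π, hπ⟩ := exists_perm_eq_on i
  have hlit : ∀ l : Formula, l.vars ⊆ r.vars →
      (l.subst fun z => if s z then var (ρ z) else nvar (ρ z)) = l.rename π := fun l hl =>
    subst_congr fun z hz => by rw [hs z (hl hz), hπ z (hl hz)]; rfl
  rw [hlit _ Finset.subset_union_left] at e1
  rw [hlit _ Finset.subset_union_right] at e2
  refine ⟨⟨hl, hr, ?_⟩, π, e1.symm, e2.symm⟩
  exact Finset.Subset.antisymm (fun z hz => (k2 z (Finset.mem_union_left _ hz)).1)
    fun z hz => (k z (Finset.mem_union_right _ hz)).1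

theorem Inference.Iso.signedVariant {r d : Inference} (h : r.Iso d) (hr : CleanInf r)
    (hd : CleanInf d) : SignedVariant r d := by
  obtain ⟨ρ, h1, h2⟩ := h
  refine ⟨ρ, fun _ => true, ρ.injective.injOn, ?_, h1.symm, h2.symm⟩
  rw [hr.vars, ← vars_rename]
  exact h1.vars_eq (hr.rename ρ).lhs hd.lhs

/-- The enumerated inferences of size `m`. -/
def basisOf (m : ℕ) : Set GraphInference := {w | w ∈ basis m ∧ w.1 = m}

theorem eq_of_iso_of_mem_basis {m : ℕ} {w w' : GraphInference} (hw : w ∈ basis m)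
    (hw' : w' ∈ basis m) {d d' : Inference} (hd : IsDecompositionOf d w)
    (hd' : IsDecompositionOf d' w') (h : d.Iso d') : w = w' :=
  eq_of_iso hd hd' (isLeastPair_of_mem_basis hw) (isLeastPair_of_mem_basis hw') h

theorem exists_represents (m : ℕ) : ∃ X, Represents (basisOf m) X := by
  choose d hd using fun w : basisOf m => exists_decomposition_of_mem_basis w.2.1
  have hinj : Function.Injective d := fun w w' h => Subtype.ext
    (eq_of_iso_of_mem_basis w.2.1 w'.2.1 (hd w) (hd w') (h ▸ ⟨1, by
      simpa [rename_id] using LogEquiv.refl _, by simpa [rename_id] using LogEquiv.refl _⟩))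
  refine ⟨Set.range d, (Equiv.ofInjective d hinj).symm, ?_⟩
  rintro ⟨_, w, rfl⟩
  refine ⟨d w, ?_, ?_⟩
  · rw [Equiv.ofInjective_symm_apply]; exact hd w
  · exact ((hd w).cleanInf.variant_iff (hd w).cleanInf).mpr ((hd w).iso (hd w))

/-- The data of `Represents`, with renaming and equivalence in place of `Variant`. -/
theorem represents_iff {W : Set GraphInference} {X : Set Inference} : Represents W X ↔
    ∃ e : X ≃ W, ∀ r : X, CleanInf r ∧ ∃ d, IsDecompositionOf d (e r) ∧ (r : Inference).Iso d := by
  refine exists_congr fun e => forall_congr' fun r => ?_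
  constructor
  · rintro ⟨d, hd, h⟩
    exact ⟨h.cleanInf hd.cleanInf, d, hd, h.iso⟩
  · rintro ⟨hc, d, hd, h⟩
    exact ⟨d, hd, (hc.variant_iff hd.cleanInf).mpr h⟩

theorem generates_of_represents {m : ℕ} (hm : 2 ≤ m) {X : Set Inference}
    (h : Represents (basisOf m) X) : Generates m X := by
  obtain ⟨e, he⟩ := represents_iff.mp h
  refine generates_of_iso hm (fun x hx => ?_) fun w hw hwm => ?_
  · obtain ⟨hc, d, hd, hi⟩ := he ⟨x, hx⟩
    have hg := good_of_mem_basis (e ⟨x, hx⟩).2.1 hd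
    refine ⟨⟨hc.lhs.linear, hc.rhs.linear, ?_⟩, ?_⟩
    · obtain ⟨ρ, h1, h2⟩ := hi.symm
      exact h1.symm.implies.trans ((hg.implies.rename ρ).trans h2.implies)
    · rw [hc.vars]
      exact (hi.card hc hd.cleanInf).trans (by
        rw [hd.1.vars, Finset.card_range]; exact (e ⟨x, hx⟩).2.2)
  · obtain ⟨hc, d, hd, hi⟩ := he (e.symm ⟨w, hw, hwm⟩)
    rw [Equiv.apply_symm_apply] at hd
    exact ⟨_, (e.symm ⟨w, hw, hwm⟩).2, hc, d, hd, hi⟩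

/-- A generating `Y ⊆ X` contains a signed variant of the inference that a given `x` represents. As
a member of `X` this variant represents an enumerated inference too, which must be the same one; so
it is `x` itself. -/
theorem nMinimal_of_represents {m : ℕ} (hm : 2 ≤ m) {X : Set Inference}
    (h : Represents (basisOf m) X) : NMinimal m X ∧ ∀ r ∈ X, r.ConstFree ∧ r.NegFree := by
  have hgen := generates_of_represents hm h
  obtain ⟨e, he⟩ := represents_iff.mp h
  refine ⟨⟨hgen, fun Y hY hYX x hx => ?_⟩, fun x hx => ?_⟩
  · obtain ⟨hc, d, hd, hi⟩ := he ⟨x, hx⟩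
    obtain ⟨y, hy, hs⟩ := exists_signedVariant hY (e ⟨x, hx⟩).2.1 (e ⟨x, hx⟩).2.2 hd
    obtain ⟨hc', d', hd', hi'⟩ := he ⟨y, hYX hy⟩
    have hiso := hs.iso hc'.lhs.linear hd.cleanInf hd'.cleanInf
      (hi'.signedVariant hc' hd'.cleanInf)
    have := e.injective (Subtype.ext (eq_of_iso_of_mem_basis (e ⟨x, hx⟩).2.1
      (e ⟨y, hYX hy⟩).2.1 hd hd' hiso))
    rw [show x = y from congrArg Subtype.val this]; exact hy
  · obtain ⟨hc, -⟩ := he ⟨x, hx⟩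
    exact ⟨⟨hc.lhs.constFree, hc.rhs.constFree⟩, hc.lhs.negFree, hc.rhs.negFree⟩

/-- A generating set contains a different generator for each enumerated inference. -/
theorem exists_injective_of_generates {m : ℕ} {Y : Set Inference} (hY : Generates m Y) :
    ∃ f : basisOf m → Y, Function.Injective f ∧ ∀ (w : basisOf m) d, IsDecompositionOf d (w : GraphInference) →
      SignedVariant (f w) d := by
  choose d hd using fun w : basisOf m => exists_decomposition_of_mem_basis w.2.1
  choose y hy hs using fun w : basisOf m => exists_signedVariant hY w.2.1 w.2.2 (hd w)
  refine ⟨fun w => ⟨y w, hy w⟩, fun w w' h => ?_, fun w d' hd' => ?_⟩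
  · have h : y w = y w' := congrArg Subtype.val h
    have := (hs w).iso (hY.1 (hy w)).1.1 (hd w).cleanInf (hd w').cleanInf (h ▸ hs w')
    exact Subtype.ext (eq_of_iso_of_mem_basis w.2.1 w'.2.1 (hd w) (hd w') this)
  · obtain ⟨ρ, s, i, hv, e1, e2⟩ := hs w
    refine ⟨ρ, s, i, hv.trans ((hd w).1.vars.trans hd'.1.vars.symm), ?_, ?_⟩
    · exact ((hd'.1.logEquiv_iff (hd w).1).mpr rfl).trans e1
    · exact ((hd'.2.logEquiv_iff (hd w).2).mpr rfl).trans e2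

/-- The generators that `X` must contain, one for each enumerated inference, already generate, so
minimality leaves room for no others. Being clean, they are plain renamings. -/
theorem represents_of_nMinimal {m : ℕ} (hm : 2 ≤ m) {X : Set Inference} (h : NMinimal m X)
    (hX : ∀ r ∈ X, r.ConstFree ∧ r.NegFree) : Represents (basisOf m) X := by
  obtain ⟨f, hf, hs⟩ := exists_injective_of_generates h.1
  have hclean : ∀ x ∈ X, x.lhs.Clean ∧ x.rhs.Clean := fun x hx =>
    ⟨⟨(h.1.1 hx).1.1, (hX x hx).1.1, (hX x hx).2.1⟩, (h.1.1 hx).1.2.1, (hX x hx).1.2, (hX x hx).2.2⟩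
  have hiso : ∀ (w : basisOf m) d, IsDecompositionOf d (w : GraphInference) →
      CleanInf (f w) ∧ (f w : Inference).Iso d := fun w d hd =>
    (hs w d hd).iso_of_clean (hclean _ (f w).2).1 (hclean _ (f w).2).2 hd.cleanInf
  let Y : Set Inference := Set.range fun w => (f w : Inference)
  have hYX : Y ⊆ X := by rintro _ ⟨w, rfl⟩; exact (f w).2
  have hgen : Generates m Y := by
    refine generates_of_iso hm (hYX.trans h.1.1) fun w hw hwm => ?_
    obtain ⟨d, hd⟩ := exists_decomposition_of_mem_basis hw
    have := hiso ⟨w, hw, hwm⟩ d hd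
    exact ⟨_, Set.mem_range_self (⟨w, hw, hwm⟩ : basisOf m), this.1, d, hd, this.2⟩
  have hXY := h.2 hgen hYX
  have hsurj : Function.Surjective f := fun x => by
    obtain ⟨w, hw⟩ := hXY x.2
    exact ⟨w, Subtype.ext hw⟩
  refine represents_iff.mpr ⟨(Equiv.ofBijective f ⟨hf, hsurj⟩).symm, fun x => ?_⟩
  obtain ⟨w, rfl⟩ := hsurj x
  obtain ⟨d, hd⟩ := exists_decomposition_of_mem_basis w.2.1
  have := hiso w d hd
  refine ⟨this.1, d, ?_, this.2⟩
  rwa [show (Equiv.ofBijective f ⟨hf, hsurj⟩).symm (f w) = w from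
    (Equiv.ofBijective f ⟨hf, hsurj⟩).symm_apply_apply w]

end LinearInference

namespace LinearInference
open Formula

/-! ### Truth tables of formulae on the variables `0, 1, 2, 3` -/

/-- The truth table of a formula on `0, 1, 2, 3`; the bit number `i` is the value under the
assignment given by the binary digits of `i`. -/
def table : Formula → ℕ
  | top => 65535
  | bot => 0
  -- In hexadecimal AAAA, CCCC, F0F0 and FF00: bit `i` is the binary digit of `i` that belongs to
  -- the variable. The value 0 for other variables and for negative literals is arbitrary.
  | var 0 => 43690
  | var 1 => 52428
  | var 2 => 61680
  | var 3 => 65280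
  | var _ => 0
  | nvar _ => 0
  | .and φ ψ => table φ &&& table ψ
  | .or φ ψ => table φ ||| table ψ

def rowOf (α : ℕ → Bool) : ℕ :=
  (if α 0 then 1 else 0) + (if α 1 then 2 else 0) + (if α 2 then 4 else 0) + if α 3 then 8 else 0

theorem table_lt (φ : Formula) : table φ < 2 ^ 16 := by
  induction φ with
  | and a b iha ihb => exact Nat.and_lt_two_pow _ ihb
  | or a b iha ihb => exact Nat.or_lt_two_pow iha ihb
  | var x => rcases x with _ | _ | _ | _ | _ <;> simp [table]
  | _ => simp [table]

theorem testBit_table {φ : Formula} (hn : φ.NegFree) (hv : φ.vars ⊆ Finset.range 4)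
    (α : ℕ → Bool) : (table φ).testBit (rowOf α) = φ.eval α := by
  have lit : ∀ b0 b1 b2 b3 : Bool,
      Nat.testBit 43690 ((if b0 then 1 else 0) + (if b1 then 2 else 0) + (if b2 then 4 else 0) +
        if b3 then 8 else 0) = b0 ∧
      Nat.testBit 52428 ((if b0 then 1 else 0) + (if b1 then 2 else 0) + (if b2 then 4 else 0) +
        if b3 then 8 else 0) = b1 ∧
      Nat.testBit 61680 ((if b0 then 1 else 0) + (if b1 then 2 else 0) + (if b2 then 4 else 0) +
        if b3 then 8 else 0) = b2 ∧
      Nat.testBit 65280 ((if b0 then 1 else 0) + (if b1 then 2 else 0) + (if b2 then 4 else 0) +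
        if b3 then 8 else 0) = b3 ∧
      Nat.testBit 65535 ((if b0 then 1 else 0) + (if b1 then 2 else 0) + (if b2 then 4 else 0) +
        if b3 then 8 else 0) = true := by decide
  have lit := lit (α 0) (α 1) (α 2) (α 3)
  induction φ with
  | top => exact lit.2.2.2.2
  | bot => exact Nat.zero_testBit _
  | var x =>
    have hx : x < 4 := by simpa [vars] using hv
    interval_cases x
    · exact lit.1
    · exact lit.2.1
    · exact lit.2.2.1
    · exact lit.2.2.2.1
  | nvar x => exact hn.elim
  | and a b iha ihb =>
    rw [table, Nat.testBit_land, iha hn.1 (Finset.union_subset_left hv),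
      ihb hn.2 (Finset.union_subset_right hv), eval]
  | or a b iha ihb =>
    rw [table, Nat.testBit_lor, iha hn.1 (Finset.union_subset_left hv),
      ihb hn.2 (Finset.union_subset_right hv), eval]

theorem exists_rowOf {i : ℕ} (hi : i < 16) : ∃ α, rowOf α = i :=
  ⟨fun x => i.testBit x, by interval_cases i <;> decide⟩

theorem eq_of_testBit_rowOf {p q : ℕ} (hp : p < 2 ^ 16) (hq : q < 2 ^ 16)
    (h : ∀ α, p.testBit (rowOf α) = q.testBit (rowOf α)) : p = q := by
  refine Nat.eq_of_testBit_eq fun i => ?_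
  by_cases hi : i < 16
  · obtain ⟨α, rfl⟩ := exists_rowOf hi
    exact h α
  · have := Nat.pow_le_pow_right (n := 2) two_pos (not_lt.mp hi)
    rw [Nat.testBit_lt_two_pow (hp.trans_le this), Nat.testBit_lt_two_pow (hq.trans_le this)]

section

variable {φ ψ : Formula}

theorem logEquiv_iff_table (nφ : φ.NegFree) (vφ : φ.vars ⊆ Finset.range 4) (nψ : ψ.NegFree)
    (vψ : ψ.vars ⊆ Finset.range 4) : LogEquiv φ ψ ↔ table φ = table ψ := by
  constructor
  · intro h
    exact eq_of_testBit_rowOf (table_lt _) (table_lt _) fun α => by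
      rw [testBit_table nφ vφ, testBit_table nψ vψ, h]
  · intro h α
    rw [← testBit_table nφ vφ, ← testBit_table nψ vψ, h]

theorem implies_iff_table (nφ : φ.NegFree) (vφ : φ.vars ⊆ Finset.range 4) (nψ : ψ.NegFree)
    (vψ : ψ.vars ⊆ Finset.range 4) : Implies φ ψ ↔ table φ &&& table ψ = table φ := by
  change _ ↔ table (Formula.and φ ψ) = table φ
  rw [← logEquiv_iff_table (φ := Formula.and φ ψ) ⟨nφ, nψ⟩ (Finset.union_subset vφ vψ) nφ vφ]
  refine forall_congr' fun α => ?_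
  cases h1 : φ.eval α <;> cases h2 : ψ.eval α <;> simp [eval, h1, h2]

end

/-- The criterion on truth tables for not being trivial at `x`. -/
def nonTrivAt (p q x : ℕ) : Bool :=
  !(p &&& table (var x) &&& (q <<< 2 ^ x) == p &&& table (var x))

theorem NonTriv.nonTrivAt {φ ψ : Formula} {V : Finset ℕ} (h : NonTriv φ ψ V) (nφ : φ.NegFree)
    (vφ : φ.vars ⊆ Finset.range 4) (nψ : ψ.NegFree) (vψ : ψ.vars ⊆ Finset.range 4) {x : ℕ}
    (hx : x ∈ V) (hx4 : x < 4) : nonTrivAt (table φ) (table ψ) x = true := by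
  obtain ⟨α, h1, h2⟩ := h x hx
  simp only [LinearInference.nonTrivAt, Bool.not_eq_true', beq_eq_false_iff_ne]
  intro he
  have := congrArg (fun n => n.testBit (rowOf (Function.update α x true))) he
  have hv := testBit_table (φ := var x) trivial (by simpa [vars] using hx4)
    (Function.update α x true)
  simp only [Nat.testBit_land, testBit_table nφ vφ, hv, h1, eval, Function.update_self,
    Bool.true_and, Nat.testBit_shiftLeft] at this
  -- The shift by `2 ^ x` in `nonTrivAt` brings the value of the conclusion with `x` lowered to the
  -- row where `x` is raised.
  have hrow : rowOf (Function.update α x true) = 2 ^ x + rowOf (Function.update α x false) := by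
    interval_cases x <;> simp [rowOf, Function.update] <;> ring
  rw [hrow, Nat.add_sub_cancel_left, testBit_table nψ vψ, h2] at this
  simp at this

/-! ### The clean formulae on at most four variables -/

def forms₂ (x y : ℕ) : List Formula := [.and (var x) (var y), .or (var x) (var y)]

def forms₃ (x y z : ℕ) : List Formula :=
  [(x, forms₂ y z), (y, forms₂ x z), (z, forms₂ x y)].flatMap fun t =>
    t.2.flatMap fun φ => [.and (var t.1) φ, .or (var t.1) φ]

def forms₄ : List Formula :=
  ([(0, forms₃ 1 2 3), (1, forms₃ 0 2 3), (2, forms₃ 0 1 3), (3, forms₃ 0 1 2)].flatMap fun t =>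
    t.2.flatMap fun φ => [.and (var t.1) φ, .or (var t.1) φ]) ++
  [(forms₂ 0 1, forms₂ 2 3), (forms₂ 0 2, forms₂ 1 3), (forms₂ 0 3, forms₂ 1 2)].flatMap fun t =>
    t.1.flatMap fun φ => t.2.flatMap fun ψ => [.and φ ψ, .or φ ψ]

/-- All clean formulae, up to equivalence, on the given variables among `0, 1, 2, 3`. -/
def forms (b0 b1 b2 b3 : Bool) : List Formula :=
  match ([0, 1, 2, 3].zip [b0, b1, b2, b3]).filterMap
    fun t => if t.2 then some t.1 else none with
  | [x] => [var x]
  | [x, y] => forms₂ x y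
  | [x, y, z] => forms₃ x y z
  | [_, _, _, _] => forms₄
  | _ => []

def memTables (p : ℕ) (l : List Formula) : Bool := l.any fun χ => Nat.beq (table χ) p

-- Completeness of the lists follows by induction on clean formulae once they are closed, up to
-- truth tables, under both connectives on disjoint sets of variables; this closure is a finite
-- check.
set_option maxRecDepth 100000 in
theorem forms_closed : ∀ a0 b0 a1 b1 a2 b2 a3 b3 : Bool,
    (a0 && b0) = true ∨ (a1 && b1) = true ∨ (a2 && b2) = true ∨ (a3 && b3) = true ∨
    ((forms a0 a1 a2 a3).all fun φ => (forms b0 b1 b2 b3).all fun ψ =>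
      memTables (table φ &&& table ψ) (forms (a0 || b0) (a1 || b1) (a2 || b2) (a3 || b3)) &&
      memTables (table φ ||| table ψ) (forms (a0 || b0) (a1 || b1) (a2 || b2) (a3 || b3))) =
        true := by
  decide +kernel

theorem memTables_iff {p : ℕ} {l : List Formula} :
    memTables p l = true ↔ ∃ χ ∈ l, table χ = p := by
  simp [memTables, List.any_eq_true, Nat.beq_eq]

/-- Every clean formula has the truth table of one in the list. -/
theorem Formula.Clean.mem_forms {φ : Formula} (h : φ.Clean) (hv : φ.vars ⊆ Finset.range 4) :
    memTables (table φ) (forms (decide (0 ∈ φ.vars)) (decide (1 ∈ φ.vars)) (decide (2 ∈ φ.vars))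
      (decide (3 ∈ φ.vars))) = true := by
  have step : ∀ a b : Formula, Disjoint a.vars b.vars →
      memTables (table a) (forms (decide (0 ∈ a.vars)) (decide (1 ∈ a.vars))
        (decide (2 ∈ a.vars)) (decide (3 ∈ a.vars))) = true →
      memTables (table b) (forms (decide (0 ∈ b.vars)) (decide (1 ∈ b.vars))
        (decide (2 ∈ b.vars)) (decide (3 ∈ b.vars))) = true →
      memTables (table a &&& table b) (forms (decide (0 ∈ a.vars ∪ b.vars))
        (decide (1 ∈ a.vars ∪ b.vars)) (decide (2 ∈ a.vars ∪ b.vars))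
        (decide (3 ∈ a.vars ∪ b.vars))) = true ∧
      memTables (table a ||| table b) (forms (decide (0 ∈ a.vars ∪ b.vars))
        (decide (1 ∈ a.vars ∪ b.vars)) (decide (2 ∈ a.vars ∪ b.vars))
        (decide (3 ∈ a.vars ∪ b.vars))) = true := by
    intro a b hd ha hb
    obtain ⟨χ, hχ, ea⟩ := memTables_iff.mp ha
    obtain ⟨ξ, hξ, eb⟩ := memTables_iff.mp hb
    have key : ∀ x, ¬ (decide (x ∈ a.vars) && decide (x ∈ b.vars)) = true := by
      intro x hx
      simp only [Bool.and_eq_true, decide_eq_true_eq] at hx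
      exact Finset.disjoint_left.mp hd hx.1 hx.2
    have := ((((forms_closed (decide (0 ∈ a.vars)) (decide (0 ∈ b.vars)) (decide (1 ∈ a.vars))
      (decide (1 ∈ b.vars)) (decide (2 ∈ a.vars)) (decide (2 ∈ b.vars)) (decide (3 ∈ a.vars))
      (decide (3 ∈ b.vars))).resolve_left (key 0)).resolve_left (key 1)).resolve_left
      (key 2)).resolve_left (key 3)
    have := List.all_eq_true.mp (List.all_eq_true.mp this χ hχ) ξ hξ
    rw [Bool.and_eq_true, ea, eb] at this
    simpa only [Finset.mem_union, Bool.decide_or] using this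
  induction φ with
  | top => exact h.constFree.elim
  | bot => exact h.constFree.elim
  | var x =>
    have hx : x < 4 := by simpa [vars] using hv
    interval_cases x <;> decide
  | nvar x => exact h.negFree.elim
  | and a b iha ihb =>
    exact (step a b h.linear.2.2
      (iha ⟨h.linear.1, h.constFree.1, h.negFree.1⟩ (Finset.union_subset_left hv))
      (ihb ⟨h.linear.2.1, h.constFree.2, h.negFree.2⟩ (Finset.union_subset_right hv))).1
  | or a b iha ihb =>
    exact (step a b h.linear.2.2
      (iha ⟨h.linear.1, h.constFree.1, h.negFree.1⟩ (Finset.union_subset_left hv))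
      (ihb ⟨h.linear.2.1, h.constFree.2, h.negFree.2⟩ (Finset.union_subset_right hv))).2

/-- An executable version of `Clean` together with the inclusion of the variables in `{0,1,2,3}`. -/
def cleanBelow : Formula → Bool
  | var x => decide (x < 4)
  | .and φ ψ => cleanBelow φ && cleanBelow ψ && decide (Disjoint φ.vars ψ.vars)
  | .or φ ψ => cleanBelow φ && cleanBelow ψ && decide (Disjoint φ.vars ψ.vars)
  | _ => false

theorem clean_of_cleanBelow {φ : Formula} (h : cleanBelow φ = true) :
    φ.Clean ∧ φ.vars ⊆ Finset.range 4 := by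
  induction φ with
  | var x => exact ⟨⟨trivial, trivial, trivial⟩, by simpa [cleanBelow, vars] using h⟩
  | and a b iha ihb =>
    simp only [cleanBelow, Bool.and_eq_true, decide_eq_true_eq] at h
    obtain ⟨c1, v1⟩ := iha h.1.1
    obtain ⟨c2, v2⟩ := ihb h.1.2
    exact ⟨⟨⟨c1.1, c2.1, h.2⟩, ⟨c1.2, c2.2⟩, ⟨c1.3, c2.3⟩⟩, Finset.union_subset v1 v2⟩
  | or a b iha ihb =>
    simp only [cleanBelow, Bool.and_eq_true, decide_eq_true_eq] at h
    obtain ⟨c1, v1⟩ := iha h.1.1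
    obtain ⟨c2, v2⟩ := ihb h.1.2
    exact ⟨⟨⟨c1.1, c2.1, h.2⟩, ⟨c1.2, c2.2⟩, ⟨c1.3, c2.3⟩⟩, Finset.union_subset v1 v2⟩
  | _ => simp [cleanBelow] at h

/-- The clean formulae on `0, …, n-1`, for `n ≤ 4`. -/
def formsBelow (n : ℕ) : List Formula :=
  forms (decide (0 < n)) (decide (1 < n)) (decide (2 < n)) (decide (3 < n))

theorem formsBelow_clean : ∀ n ≤ 4, (formsBelow n).all cleanBelow = true := by
  decide +kernel

theorem Formula.Clean.mem_formsBelow {φ : Formula} (h : φ.Clean) {n : ℕ} (hn : n ≤ 4)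
    (hv : φ.vars = Finset.range n) : ∃ χ ∈ formsBelow n, table χ = table φ := by
  have := h.mem_forms (hv ▸ Finset.range_subset_range.mpr hn)
  simp only [hv, Finset.mem_range] at this
  exact memTables_iff.mp this

/-- The criteria for a good inference, on truth tables. -/
def goodTables (n p q : ℕ) : Bool :=
  Nat.beq (p &&& q) p && !Nat.beq p q && (List.range n).all (nonTrivAt p q) &&
    (formsBelow n).all fun χ => !(Nat.beq (p &&& table χ) p && Nat.beq (table χ &&& q) (table χ)) ||
      Nat.beq (table χ) p || Nat.beq (table χ) q

theorem Good.goodTables {r : Inference} (h : Good r) {n : ℕ} (hn : n ≤ 4)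
    (hv : r.lhs.vars = Finset.range n) :
    goodTables n (table r.lhs) (table r.rhs) = true := by
  have v1 : r.lhs.vars ⊆ Finset.range 4 := hv ▸ Finset.range_subset_range.mpr hn
  have v2 := h.vars_eq ▸ v1
  have n1 := h.lhs.negFree
  have n2 := h.rhs.negFree
  simp only [LinearInference.goodTables, Bool.and_eq_true, Nat.beq_eq, Bool.not_eq_true',
    List.all_eq_true, List.mem_range, Bool.or_eq_true]
  refine ⟨⟨⟨(implies_iff_table n1 v1 n2 v2).mp h.implies, ?_⟩, fun x hx => ?_⟩, fun χ hχ => ?_⟩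
  · rw [← Bool.not_eq_true, Nat.beq_eq, ← logEquiv_iff_table n1 v1 n2 v2]
    exact h.not_logEquiv
  · exact h.nonTriv.nonTrivAt n1 v1 n2 v2 (by rw [hv]; exact Finset.mem_range.mpr hx) (by omega)
  · obtain ⟨c, v⟩ := clean_of_cleanBelow (List.all_eq_true.mp (formsBelow_clean n hn) χ hχ)
    rw [or_assoc, ← logEquiv_iff_table c.negFree v n1 v1, ← logEquiv_iff_table c.negFree v n2 v2,
      ← Bool.not_eq_true, Bool.and_eq_true, Nat.beq_eq, Nat.beq_eq,
      ← implies_iff_table n1 v1 c.negFree v, ← implies_iff_table c.negFree v n2 v2, ← imp_iff_not_or]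
    exact fun hi => h.logMinimal χ c.linear hi.1 hi.2

/-- A non-trivial inference that meets the criterion on truth tables is good. -/
theorem good_of_goodTables {r : Inference} {n : ℕ} (hn : n ≤ 4) (h1 : r.lhs.Clean)
    (h2 : r.rhs.Clean) (v1 : r.lhs.vars = Finset.range n) (v2 : r.rhs.vars = Finset.range n)
    (ht : NonTriv r.lhs r.rhs r.lhs.vars)
    (h : LinearInference.goodTables n (table r.lhs) (table r.rhs) = true) : Good r := by
  have w1 : r.lhs.vars ⊆ Finset.range 4 := v1 ▸ Finset.range_subset_range.mpr hn
  have w2 : r.rhs.vars ⊆ Finset.range 4 := v2 ▸ Finset.range_subset_range.mpr hn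
  have n1 := h1.negFree
  have n2 := h2.negFree
  simp only [LinearInference.goodTables, Bool.and_eq_true, Nat.beq_eq, Bool.not_eq_true',
    List.all_eq_true, List.mem_range, Bool.or_eq_true] at h
  obtain ⟨⟨⟨hi, hne⟩, -⟩, hm⟩ := h
  rw [← implies_iff_table n1 w1 n2 w2] at hi
  rw [← Bool.not_eq_true, Nat.beq_eq, ← logEquiv_iff_table n1 w1 n2 w2] at hne
  refine ⟨h1, h2, v1.trans v2.symm, hi, ht, fun χ hχ i1 i2 => ?_, hne⟩
  obtain ⟨c, v⟩ := ht.clean_nf_of_between subset_rfl (v2.trans v1.symm).le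
    h1.constFree.vars_nonempty i1 i2 hχ
  have e := logEquiv_nf χ
  obtain ⟨ξ, hξ, et⟩ := c.mem_formsBelow hn (v.trans v1)
  have w : χ.nf.vars ⊆ Finset.range 4 := v ▸ w1
  have := hm ξ hξ
  rw [et, or_assoc, ← logEquiv_iff_table c.negFree w n1 w1, ← logEquiv_iff_table c.negFree w n2 w2,
    ← Bool.not_eq_true, Bool.and_eq_true, Nat.beq_eq, Nat.beq_eq,
    ← implies_iff_table n1 w1 c.negFree w, ← implies_iff_table c.negFree w n2 w2,
    ← imp_iff_not_or] at this
  exact (this ⟨i1.trans e.symm.implies, e.implies.trans i2⟩).imp e.symm.trans e.symm.trans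

/-! ### Switch and medial -/

def switchOf (φ ψ χ : Formula) : Inference := ⟨.and φ (.or ψ χ), .or (.and φ ψ) χ⟩

def medialOf (φ ψ χ ξ : Formula) : Inference :=
  ⟨.or (.and φ ψ) (.and χ ξ), .and (.or φ χ) (.or ψ ξ)⟩

/-- The inferences on the variables `a, b, c, d` that are instances of switch. -/
def switches₄ (a b c d : ℕ) : List Inference :=
  let s := switchOf (var a) (var b) (var c)
  [⟨.and (var d) s.lhs, .and (var d) s.rhs⟩, ⟨.or (var d) s.lhs, .or (var d) s.rhs⟩,
    switchOf (.and (var a) (var d)) (var b) (var c), switchOf (.or (var a) (var d)) (var b) (var c),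
    switchOf (var a) (.and (var b) (var d)) (var c), switchOf (var a) (.or (var b) (var d)) (var c),
    switchOf (var a) (var b) (.and (var c) (var d)), switchOf (var a) (var b) (.or (var c) (var d))]

/-- The lists of four distinct numbers less than four. -/
def arrangements : List (ℕ × ℕ × ℕ × ℕ) :=
  ([0, 1, 2, 3].flatMap fun a => [0, 1, 2, 3].flatMap fun b => [0, 1, 2, 3].flatMap fun c =>
    [0, 1, 2, 3].map fun d => (a, b, c, d)).filter fun t => decide [t.1, t.2.1, t.2.2.1, t.2.2.2].Nodup

def tablesIn (p q : ℕ) (l : List Inference) : Bool :=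
  l.any fun r => Nat.beq (table r.lhs) p && Nat.beq (table r.rhs) q

theorem not_goodTables : ∀ n ≤ 2, ((formsBelow n).all fun φ => (formsBelow n).all fun ψ =>
    !goodTables n (table φ) (table ψ)) = true := by
  decide +kernel

/-- Fixing the last entry of an arrangement to be 3 leaves the permutations of 0, 1, 2 for the other
entries. -/
theorem goodTables_three : ((formsBelow 3).all fun φ => (formsBelow 3).all fun ψ =>
    !goodTables 3 (table φ) (table ψ) || arrangements.any fun t => Nat.beq t.2.2.2 3 &&
      tablesIn (table φ) (table ψ) [switchOf (var t.1) (var t.2.1) (var t.2.2.1)]) = true := by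
  decide +kernel

theorem goodTables_four : ((formsBelow 4).all fun φ => (formsBelow 4).all fun ψ =>
    !goodTables 4 (table φ) (table ψ) || arrangements.any fun t => tablesIn (table φ) (table ψ)
      (medialOf (var t.1) (var t.2.1) (var t.2.2.1) (var t.2.2.2) ::
        switches₄ t.1 t.2.1 t.2.2.1 t.2.2.2)) = true := by
  decide +kernel

theorem goodTables_switch : goodTables 3 (table switch.lhs) (table switch.rhs) = true := by
  decide +kernel

theorem goodTables_medial : goodTables 4 (table medial.lhs) (table medial.rhs) = true := by
  decide +kernel

end LinearInference

namespace LinearInference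
open Formula

/-! ### Good inferences on at most four variables -/

theorem arrangements_distinct : ∀ t ∈ arrangements,
    [t.1, t.2.1, t.2.2.1, t.2.2.2].Nodup ∧ ∀ r ∈ medialOf (var t.1) (var t.2.1) (var t.2.2.1)
      (var t.2.2.2) :: switchOf (var t.1) (var t.2.1) (var t.2.2.1) ::
        switches₄ t.1 t.2.1 t.2.2.1 t.2.2.2,
      cleanBelow r.lhs = true ∧ cleanBelow r.rhs = true ∧ r.lhs.vars = r.rhs.vars := by
  decide +kernel

theorem exists_perm_arrangement {t : ℕ × ℕ × ℕ × ℕ} (ht : t ∈ arrangements) :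
    ∃ π : Equiv.Perm ℕ, π 0 = t.1 ∧ π 1 = t.2.1 ∧ π 2 = t.2.2.1 ∧ π 3 = t.2.2.2 := by
  have hd := (arrangements_distinct t ht).1
  obtain ⟨a, b, c, d⟩ := t
  simp only [List.nodup_cons, List.mem_cons, List.not_mem_nil, or_false, not_or,
    not_false_eq_true, List.nodup_nil, and_true] at hd
  obtain ⟨π, hπ⟩ := exists_perm_eq_on (V := Finset.range 4)
    (ρ := fun x => if x = 0 then a else if x = 1 then b else if x = 2 then c else d) (by
      intro x hx y hy h
      simp only [Finset.coe_range, Set.mem_Iio] at hx hy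
      interval_cases x <;> interval_cases y <;> simp_all)
  exact ⟨π, hπ 0 (by simp), hπ 1 (by simp), hπ 2 (by simp), hπ 3 (by simp)⟩

theorem cleanInf_of_mem {t : ℕ × ℕ × ℕ × ℕ} (ht : t ∈ arrangements) {r : Inference}
    (hr : r ∈ medialOf (var t.1) (var t.2.1) (var t.2.2.1) (var t.2.2.2) ::
      switchOf (var t.1) (var t.2.1) (var t.2.2.1) :: switches₄ t.1 t.2.1 t.2.2.1 t.2.2.2) :
    CleanInf r ∧ r.lhs.vars ⊆ Finset.range 4 ∧ r.rhs.vars ⊆ Finset.range 4 := by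
  obtain ⟨h1, h2, h3⟩ := (arrangements_distinct t ht).2 r hr
  obtain ⟨c1, v1⟩ := clean_of_cleanBelow h1
  obtain ⟨c2, v2⟩ := clean_of_cleanBelow h2
  exact ⟨⟨c1, c2, h3⟩, v1, v2⟩

theorem rewrite_switches₄ {a b c d : ℕ} {r : Inference} (hr : r ∈ switches₄ a b c d) :
    Rewrite {switch} r.lhs r.rhs := by
  have base : ∀ φ ψ χ : Formula, Rewrite {switch} (switchOf φ ψ χ).lhs (switchOf φ ψ χ).rhs :=
    fun φ ψ χ => Rewrite.rule (r := switch)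
      (fun z => if z = 0 then φ else if z = 1 then ψ else χ) (Set.mem_singleton _)
  simp only [switches₄, List.mem_cons, List.not_mem_nil, or_false] at hr
  rcases hr with rfl | rfl | rfl | rfl | rfl | rfl | rfl | rfl
  · exact .and_left _ (base _ _ _)
  · exact .or_left _ (base _ _ _)
  all_goals exact base _ _ _

theorem switch_cleanInf : CleanInf switch :=
  ⟨(clean_of_cleanBelow (by decide)).1, (clean_of_cleanBelow (by decide)).1, by decide⟩

theorem medial_cleanInf : CleanInf medial :=
  ⟨(clean_of_cleanBelow (by decide)).1, (clean_of_cleanBelow (by decide)).1, by decide⟩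

theorem switch_good : Good switch := by
  refine good_of_goodTables (n := 3) (by omega) switch_cleanInf.lhs switch_cleanInf.rhs (by decide)
    (by decide) (fun x hx => ?_) goodTables_switch
  have hx : x < 3 := by
    rwa [show switch.lhs.vars = Finset.range 3 by decide, Finset.mem_range] at hx
  refine ⟨fun z => decide (z = if x = 0 then 1 else 0), ?_⟩
  -- The only variable set to true is a partner of `x` in a minterm of the left side; without `x` it
  -- satisfies no minterm of the right side.
  interval_cases x <;> decide

theorem medial_good : Good medial := by
  refine good_of_goodTables (n := 4) le_rfl medial_cleanInf.lhs medial_cleanInf.rhs (by decide)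
    (by decide) (fun x hx => ?_) goodTables_medial
  have hx : x < 4 := by
    rwa [show medial.lhs.vars = Finset.range 4 by decide, Finset.mem_range] at hx
  refine ⟨fun z => decide (z = if x = 0 then 1 else if x = 1 then 0 else if x = 2 then 3 else 2), ?_⟩
  interval_cases x <;> decide

section

variable {r : Inference}

theorem logEquiv_of_tablesIn (h : CleanInf r) {t : ℕ × ℕ × ℕ × ℕ} (ht : t ∈ arrangements)
    (hv : r.lhs.vars ⊆ Finset.range 4) {l : List Inference}
    (hl : l ⊆ medialOf (var t.1) (var t.2.1) (var t.2.2.1) (var t.2.2.2) ::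
      switchOf (var t.1) (var t.2.1) (var t.2.2.1) :: switches₄ t.1 t.2.1 t.2.2.1 t.2.2.2)
    (hm : tablesIn (table r.lhs) (table r.rhs) l = true) :
    ∃ s ∈ l, CleanInf s ∧ LogEquiv s.lhs r.lhs ∧ LogEquiv s.rhs r.rhs := by
  simp only [tablesIn, List.any_eq_true, Bool.and_eq_true, Nat.beq_eq] at hm
  obtain ⟨s, hs, e1, e2⟩ := hm
  obtain ⟨c, v1, v2⟩ := cleanInf_of_mem ht (hl hs)
  exact ⟨s, hs, c, (logEquiv_iff_table c.lhs.negFree v1 h.lhs.negFree hv).mpr e1,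
    (logEquiv_iff_table c.rhs.negFree v2 h.rhs.negFree (h.vars_eq ▸ hv)).mpr e2⟩

theorem Good.exists_tables (h : Good r) {n : ℕ} (hn : n ≤ 4) (hv : r.lhs.vars = Finset.range n) :
    ∃ φ ∈ formsBelow n, ∃ ψ ∈ formsBelow n, table φ = table r.lhs ∧ table ψ = table r.rhs := by
  obtain ⟨φ, hφ, e1⟩ := h.lhs.mem_formsBelow hn hv
  obtain ⟨ψ, hψ, e2⟩ := h.rhs.mem_formsBelow hn (h.vars_eq ▸ hv)
  exact ⟨φ, hφ, ψ, hψ, e1, e2⟩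

theorem Good.two_lt (h : Good r) {n : ℕ} (hv : r.lhs.vars = Finset.range n) : 2 < n := by
  by_contra hn
  obtain ⟨φ, hφ, ψ, hψ, e1, e2⟩ := h.exists_tables (by omega) hv
  have := List.all_eq_true.mp (List.all_eq_true.mp (not_goodTables n (not_lt.mp hn)) φ hφ) ψ hψ
  rw [e1, e2, h.goodTables (by omega) hv] at this
  cases this

theorem Good.iso_switch (h : Good r) (hv : r.lhs.vars = Finset.range 3) : switch.Iso r := by
  obtain ⟨φ, hφ, ψ, hψ, e1, e2⟩ := h.exists_tables (by omega) hv
  have := List.all_eq_true.mp (List.all_eq_true.mp goodTables_three φ hφ) ψ hψ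
  rw [e1, e2, h.goodTables (by omega) hv, Bool.not_true, Bool.false_or, List.any_eq_true] at this
  obtain ⟨t, ht, hm⟩ := this
  obtain ⟨s, hs, -, l1, l2⟩ := logEquiv_of_tablesIn h.cleanInf ht (hv ▸ by decide) (by simp)
    (Bool.and_eq_true_iff.mp hm).2
  obtain rfl := List.mem_singleton.mp hs
  obtain ⟨π, p0, p1, p2, -⟩ := exists_perm_arrangement ht
  refine ⟨π, ?_, ?_⟩
  · simpa [switch, switchOf, Formula.rename, Formula.subst, p0, p1, p2] using l1
  · simpa [switch, switchOf, Formula.rename, Formula.subst, p0, p1, p2] using l2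

theorem Good.iso_medial_or (h : Good r) (hv : r.lhs.vars = Finset.range 4) :
    medial.Iso r ∨ Instance {switch} r.lhs r.rhs := by
  obtain ⟨φ, hφ, ψ, hψ, e1, e2⟩ := h.exists_tables le_rfl hv
  have := List.all_eq_true.mp (List.all_eq_true.mp goodTables_four φ hφ) ψ hψ
  rw [e1, e2, h.goodTables le_rfl hv, Bool.not_true, Bool.false_or, List.any_eq_true] at this
  obtain ⟨t, ht, hm⟩ := this
  obtain ⟨s, hs, c, l1, l2⟩ := logEquiv_of_tablesIn h.cleanInf ht hv.le
    (fun s hs => by simp only [List.mem_cons] at hs ⊢; tauto) hm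
  rcases List.mem_cons.mp hs with rfl | hs
  · left
    obtain ⟨π, p0, p1, p2, p3⟩ := exists_perm_arrangement ht
    refine ⟨π, ?_, ?_⟩
    · simpa [medial, medialOf, Formula.rename, Formula.subst, p0, p1, p2, p3] using l1
    · simpa [medial, medialOf, Formula.rename, Formula.subst, p0, p1, p2, p3] using l2
  · right
    exact ⟨_, _, l1.symm.ac h.lhs c.lhs, rewrite_switches₄ hs, l2.ac c.rhs h.rhs⟩

end

/-- Switch only deletes edges of the relation web. -/
theorem edge_of_rewrite_switch {φ ψ : Formula} (h : Rewrite {switch} φ ψ) :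
    φ.vars = ψ.vars ∧ ∀ x y, ψ.Edge x y → φ.Edge x y := by
  induction h with
  | rule σ hr =>
    obtain rfl := Set.mem_singleton_iff.mp hr
    refine ⟨by simp [switch, Formula.subst, vars, Finset.union_assoc], fun x y h => ?_⟩
    simp only [switch, Formula.subst, Edge, vars, Finset.mem_union] at h ⊢
    tauto
  | _ χ _ ih =>
    obtain ⟨h1, h2⟩ := ih
    refine ⟨by simp only [vars, h1], fun x y h => ?_⟩
    have := h2 x y
    simp only [Edge, h1] at h ⊢
    tauto

/-- Medial creates the edge between 0 and 3, whereas switch never adds edges. -/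
theorem not_instance_switch_medial : ¬ Instance {switch} medial.lhs medial.rhs := by
  rintro ⟨φ, ψ, h1, h2, h3⟩
  have he : medial.rhs.Edge 0 3 := by simp [medial, Edge, vars]
  have := (h1.edge_iff 0 3).mpr ((edge_of_rewrite_switch h2).2 0 3 ((h3.edge_iff 0 3).mpr he))
  simp [medial, Edge, vars] at this

theorem two_lt_of_mem_basis {n : ℕ} {w : GraphInference} (h : w ∈ basis n) : 2 < w.1 := by
  obtain ⟨d, hd⟩ := exists_decomposition_of_mem_basis h
  exact (good_of_mem_basis h hd).two_lt hd.1.vars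

theorem basisOf_eq_empty {m : ℕ} (hm : m ≤ 2) : basisOf m = ∅ := by
  refine Set.eq_empty_of_forall_notMem fun w ⟨h, e⟩ => ?_
  have := two_lt_of_mem_basis h
  omega

/-- Being good, `s` is an instance of some enumerated inference, and `hmem` makes its size `m`. By
`hiso` all enumerated inferences of this size are renamings of `s`, so least pairs leave only one.
-/
theorem basisOf_eq_singleton {m : ℕ} {s : Inference} (hs : Good s) (hm : s.lhs.vars.card = m)
    (hiso : ∀ w ∈ basis m, w.1 = m → ∀ d, IsDecompositionOf d w → s.Iso d)
    (hmem : ∀ w ∈ basis m, ∀ d, IsDecompositionOf d w → Instance {d} s.lhs s.rhs → w.1 = m) :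
    ∃ w ∈ basis m, basisOf m = {w} ∧ ∀ d, IsDecompositionOf d w → s.Iso d := by
  obtain ⟨w, hw, hinst⟩ := hs.exists_mem_basis
  rw [hm] at hw
  obtain ⟨d, hd⟩ := exists_decomposition_of_mem_basis hw
  have hwm := hmem w hw d hd (hinst d hd).1
  refine ⟨w, hw, Set.eq_singleton_iff_unique_mem.mpr ⟨⟨hw, hwm⟩, fun w₁ h₁ => ?_⟩,
    hiso w hw hwm⟩
  obtain ⟨d₁, hd₁⟩ := exists_decomposition_of_mem_basis h₁.1
  exact eq_of_iso_of_mem_basis h₁.1 hw hd₁ hd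
    ((hiso w₁ h₁.1 h₁.2 d₁ hd₁).symm.trans (hiso w hw hwm d hd))

theorem basisOf_three {m : ℕ} (hm : m = 3) :
    ∃ w ∈ basis m, basisOf m = {w} ∧ ∀ d, IsDecompositionOf d w → switch.Iso d :=
  basisOf_eq_singleton switch_good (hm ▸ by decide)
    (fun _ hw hwm _ hd => (good_of_mem_basis hw hd).iso_switch (hd.1.vars.trans (by rw [hwm, hm])))
    fun _ hw _ _ _ => le_antisymm (le_of_mem_basis hw).2 (hm ▸ two_lt_of_mem_basis hw)

/-- Switch is itself represented among the enumerated inferences, on three nodes, so the search on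
more nodes rejects all its instances. -/
theorem not_instance_switch_of_mem_basis {m : ℕ} (hm : 3 < m) {w : GraphInference}
    (hw : w ∈ basis m) (hwm : w.1 = m) {d : Inference} (hd : IsDecompositionOf d w) :
    ¬ Instance {switch} d.lhs d.rhs := by
  intro hi
  obtain ⟨k, hk⟩ : ∃ k, k = 3 := ⟨3, rfl⟩
  rw [← hk] at hm
  obtain ⟨w₃, m₃, -, i₃⟩ := basisOf_three hk
  obtain ⟨d₃, hd₃⟩ := exists_decomposition_of_mem_basis m₃
  obtain ⟨s, hs, hc⟩ := hi.exists_ctxInst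
    (fun r hr => (Set.mem_singleton_iff.mp hr) ▸ switch_cleanInf) hd.1.clean
  rw [Set.mem_singleton_iff.mp hs] at hc
  have := hc.trans_instance ((i₃ d₃ hd₃).symm.ctxInst.instance rfl hd₃.cleanInf
    switch_cleanInf.lhs switch_cleanInf.rhs) switch_cleanInf hd.1.clean hd.2.clean
  obtain ⟨_, rfl, hc⟩ := this.exists_ctxInst
    (fun r hr => (Set.mem_singleton_iff.mp hr) ▸ hd₃.cleanInf) hd.1.clean
  exact not_isInstance_of_mem_basis hw hwm m₃ hm (isInstance_of_ctxInst hd₃ hd.1 hd.2 hc)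

theorem not_instance_medial {w : GraphInference} {n : ℕ} (hw : w ∈ basis n) (h3 : w.1 = 3)
    {d : Inference} (hd : IsDecompositionOf d w) : ¬ Instance {d} medial.lhs medial.rhs := by
  intro hi
  have hg := good_of_mem_basis hw hd
  have hsw := hg.iso_switch (hd.1.vars.trans (by rw [h3]))
  obtain ⟨s, hs, hc⟩ := hi.exists_ctxInst
    (fun r hr => (Set.mem_singleton_iff.mp hr) ▸ hd.cleanInf) medial_cleanInf.lhs
  rw [Set.mem_singleton_iff.mp hs] at hc
  exact not_instance_switch_medial (hc.trans_instance (hsw.ctxInst.instance rfl switch_cleanInf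
    hg.lhs hg.rhs) hg.cleanInf medial_cleanInf.lhs medial_cleanInf.rhs)

/-- On four variables a good inference is medial or an instance of switch; the latter are rejected
by the search, and medial is kept because no smaller enumerated inference has it as an instance. -/
theorem basisOf_four {m : ℕ} (hm : m = 4) :
    ∃ w ∈ basis m, basisOf m = {w} ∧ ∀ d, IsDecompositionOf d w → medial.Iso d :=
  basisOf_eq_singleton medial_good (hm ▸ by decide)
    (fun _ hw hwm _ hd => ((good_of_mem_basis hw hd).iso_medial_or
      (hd.1.vars.trans (by rw [hwm, hm]))).resolve_right
        (not_instance_switch_of_mem_basis (by omega) hw hwm hd))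
    fun _ hw _ hd hi => le_antisymm (le_of_mem_basis hw).2 (hm ▸ lt_of_le_of_ne
      (two_lt_of_mem_basis hw) fun h3 => not_instance_medial hw h3.symm hd hi)

/-! ### The sets `M_m` -/

theorem sameUpToAC_singleton_iff {s : Inference} (hs : CleanInf s) {w : GraphInference}
    (hw : ∃ d, IsDecompositionOf d w) (h : ∀ d, IsDecompositionOf d w → s.Iso d)
    {X : Set Inference} : SameUpToAC X {s} ↔ Represents {w} X := by
  obtain ⟨d, hd⟩ := hw
  constructor
  · rintro ⟨e, he⟩
    let e' : X ≃ ({w} : Set GraphInference) := e.trans (Equiv.ofUnique _ _)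
    refine ⟨e', fun r => ⟨d, ?_, ?_⟩⟩
    · rw [Set.mem_singleton_iff.mp (e' r).2]; exact hd
    · have := he r
      rw [Set.mem_singleton_iff.mp (e r).2] at this
      exact ((this.cleanInf hs).variant_iff hd.cleanInf).mpr (this.iso.trans (h d hd))
  · intro hr
    obtain ⟨e, he⟩ := represents_iff.mp hr
    let e' : X ≃ ({s} : Set Inference) := e.trans (Equiv.ofUnique _ _)
    refine ⟨e', fun r => ?_⟩
    obtain ⟨hc, d', hd', hi⟩ := he r
    rw [Set.mem_singleton_iff.mp (e' r).2]
    rw [Set.mem_singleton_iff.mp (e r).2] at hd'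
    exact (hc.variant_iff hs).mpr (hi.trans (h d' hd').symm)

theorem represents_empty_iff {X : Set Inference} : Represents ∅ X ↔ X = ∅ := by
  constructor
  · rintro ⟨e, -⟩
    exact Set.eq_empty_of_forall_notMem fun x hx => (e ⟨x, hx⟩).2
  · rintro rfl
    exact ⟨Equiv.refl _ |>.trans (Equiv.equivOfIsEmpty _ _), fun r => r.2.elim⟩

/-- Up to four variables `IsM` is an explicit list, matched by the truth table computation; from
five on it is minimality, matched by the two bounds on generating sets. -/
theorem isM_iff_represents (m : ℕ) (X : Set Inference) : IsM m X ↔ Represents (basisOf m) X := by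
  obtain hm | hm | hm | ⟨n, rfl⟩ : m ≤ 2 ∨ m = 3 ∨ m = 4 ∨ ∃ n, m = n + 5 := by
    rcases m with _ | _ | _ | _ | _ | n <;> simp
  · rw [basisOf_eq_empty hm, represents_empty_iff]
    interval_cases m <;> rfl
  · obtain ⟨w, hw, e, h⟩ := basisOf_three hm
    rw [e, ← sameUpToAC_singleton_iff switch_cleanInf (exists_decomposition_of_mem_basis hw) h, hm]
    rfl
  · obtain ⟨w, hw, e, h⟩ := basisOf_four hm
    rw [e, ← sameUpToAC_singleton_iff medial_cleanInf (exists_decomposition_of_mem_basis hw) h, hm]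
    rfl
  · exact ⟨fun h => represents_of_nMinimal (by omega) h.1 h.2,
      fun h => nMinimal_of_represents (by omega) h⟩

theorem Represents.encard_le {m : ℕ} {X Y : Set Inference} (hX : Represents (basisOf m) X)
    (hY : Generates m Y) : X.encard ≤ Y.encard := by
  obtain ⟨e, -⟩ := hX
  obtain ⟨f, hf, -⟩ := exists_injective_of_generates hY
  exact (e.toEmbedding.trans ⟨f, hf⟩).encard_le

/-! ### The enumerated inferences -/

theorem good_iff {r : Inference} {n : ℕ} {R S : Web n} (hd : IsDecompositionOf r ⟨n, R, S⟩) :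
    Good r ↔ R ≠ S ∧ r.IsLinear ∧ ¬ r.Trivial ∧ r.LogMinimal := by
  have hc := hd.cleanInf
  have hne : ¬ LogEquiv r.lhs r.rhs ↔ R ≠ S := (hd.1.logEquiv_iff hd.2).not
  rw [Inference.not_trivial_iff, hc.vars, ← hne]
  exact ⟨fun h => ⟨h.not_logEquiv, ⟨hc.lhs.linear, hc.rhs.linear, h.implies⟩, h.nonTriv,
    h.logMinimal⟩, fun h => ⟨hc.lhs, hc.rhs, hc.vars_eq, h.2.1.2.2, h.2.2.1, h.2.2.2, h.1⟩⟩

theorem instance_smallerDecompositions_iff {B : Set GraphInference} {m : ℕ} {r : Inference}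
    {n : ℕ} {R S : Web n} (hd : IsDecompositionOf r ⟨n, R, S⟩)
    (hB : ∀ b ∈ B, ∃ d, IsDecompositionOf d b) :
    Instance (smallerDecompositions B m) r.lhs r.rhs ↔
      ∃ b ∈ B, b.1 < m ∧ isInstance b.2.1 b.2.2 R S := by
  have hc := hd.cleanInf
  constructor
  · intro h
    obtain ⟨d, ⟨b, hb, hbm, hdb⟩, hi⟩ := h.exists_ctxInst
      (by rintro d ⟨b, -, -, hdb⟩; exact hdb.cleanInf) hc.lhs
    exact ⟨b, hb, hbm, isInstance_of_ctxInst hdb hd.1 hd.2 hi⟩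
  · rintro ⟨b, hb, hbm, hi⟩
    obtain ⟨d, hdb⟩ := hB b hb
    exact (ctxInst_of_isInstance hdb hd.1 hd.2 hi).instance ⟨b, hb, hbm, hdb⟩ hdb.cleanInf
      hc.lhs hc.rhs

/-- The search tests against the basis of the preceding stage, the right-hand side against all
smaller members of the final one; these agree because later stages add only larger inferences. -/
theorem mem_basis_iff {m n : ℕ} (h : m ≤ n) (R S : Web m) :
    (⟨m, R, S⟩ : GraphInference) ∈ basis n ↔
      R.P4Free ∧ S.P4Free ∧ R ≠ S ∧ Web.IsLeastPair R S ∧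
      ∃ r : Inference, IsDecompositionOf r ⟨m, R, S⟩ ∧
        r.IsLinear ∧ ¬ r.Trivial ∧ r.LogMinimal ∧
        ¬ Instance (smallerDecompositions {w | w ∈ basis n} m) r.lhs r.rhs := by
  rcases m with _ | m
  -- There is only one graph without nodes, so `R ≠ S` fails.
  · refine iff_of_false (fun h => (le_of_mem_basis h).1.ne rfl) fun h => h.2.2.1 ?_
    exact Web.ext fun x => x.elim0
  have hinst : ∀ r, IsDecompositionOf r ⟨m + 1, R, S⟩ →
      (¬ Instance (smallerDecompositions {w | w ∈ basis n} (m + 1)) r.lhs r.rhs ↔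
        ∀ b ∈ basis m, ¬ isInstance b.2.1 b.2.2 R S) := by
    intro r hr
    rw [instance_smallerDecompositions_iff (B := {w | w ∈ basis n}) hr
      fun b hb => exists_decomposition_of_mem_basis hb]
    push Not
    refine forall_congr' fun b => ⟨fun h' hb => ?_, fun h' hb hbm => ?_⟩
    · exact h' (basis_mono (by omega) hb) (Nat.lt_succ_of_le (le_of_mem_basis hb).2)
    · exact h' ((mem_basis_of_le (by omega) (Nat.le_of_lt_succ hbm)).mp hb)
  rw [mem_basis_iff_search h, mem_search]
  constructor
  · rintro ⟨h1, h2, h3, h4⟩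
    have h5 := (mem_Phi.mp (mem_logMin.mp h2).1).1
    obtain ⟨φ, hφ⟩ := h1.exists_decomposition m.succ_pos
    obtain ⟨ψ, hψ⟩ := h5.exists_decomposition m.succ_pos
    have hd : IsDecompositionOf ⟨φ, ψ⟩ ⟨m + 1, R, S⟩ := ⟨hφ, hψ⟩
    obtain ⟨k1, k2, k3, k4⟩ := (good_iff hd).mp ((mem_logMin_iff_good hd).mp h2)
    exact ⟨h1, h5, k1, h3, _, hd, k2, k3, k4, (hinst _ hd).mpr h4⟩
  · rintro ⟨h1, -, k1, h3, r, hd, k2, k3, k4, h4⟩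
    exact ⟨h1, (mem_logMin_iff_good hd).mpr ((good_iff hd).mpr ⟨k1, k2, k3, k4⟩), h3,
      (hinst r hd).mp h4⟩

end LinearInference

/-! ### The main theorem -/

open LinearInference

theorem mainTheorem4 (n : ℕ) :
    (∀ w ∈ basis n, w.1 ≤ n) ∧
    (∀ m ≤ n,
      -- the part of `basis n` of size `m` is `M_m`
      (∃ X : Set Inference, IsM m X) ∧
      (∀ X : Set Inference, IsM m X ↔ Represents {w | w ∈ basis n ∧ w.1 = m} X) ∧
      -- the `m`-minimal sets have the least possible cardinality as well
      (4 < m → ∀ X Y : Set Inference, IsM m X → Generates m Y → X.encard ≤ Y.encard) ∧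
      -- which graph inferences on `m` nodes are enumerated
      (∀ R S : Web m, (⟨m, R, S⟩ : GraphInference) ∈ basis n ↔
        R.P4Free ∧ S.P4Free ∧ R ≠ S ∧ Web.IsLeastPair R S ∧
        ∃ r : Inference, IsDecompositionOf r ⟨m, R, S⟩ ∧
          r.IsLinear ∧ ¬ r.Trivial ∧ r.LogMinimal ∧
          ¬ Instance (smallerDecompositions {w | w ∈ basis n} m) r.lhs r.rhs)) := by
  refine ⟨fun w hw => (le_of_mem_basis hw).2, fun m hm => ⟨?_, fun X => ?_, fun _ X Y hX hY => ?_,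
    mem_basis_iff hm⟩⟩
  · obtain ⟨X, hX⟩ := exists_represents m
    exact ⟨X, (isM_iff_represents m X).mpr hX⟩
  · have : {w | w ∈ basis n ∧ w.1 = m} = basisOf m :=
      Set.ext fun w => and_congr_left fun e => mem_basis_of_le hm e.le
    rw [this]
    exact isM_iff_represents m X
  · exact ((isM_iff_represents m X).mp hX).encard_le hY
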